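/- Let $(\Sigma,g)$ be a compact connected smooth Riemannian surface without boundary, with Riemannian distance $d$, volume measure $dV_g$ and area $|\Sigma|$. Let $h:\Sigma\to\mathbb R$ be smooth and positive, let $p_1,\dots,p_m\in\Sigma$ ($m\ge 0$) be distinct points, let $\alpha_1,\dots,\alpha_m\in(0,1]$, and let $\rho\in(4\pi,8\pi)$ with $\rho\ne 4\pi(1+\alpha_j)$ for all $j$. For each $j$ let $G_{p_j}$ be the Green's function of $-\Delta_g$ with pole $p_j$, that is, the integrable function with $-\Delta_g G_{p_j}=\delta_{p_j}-\frac1{|\Sigma|}$ in the sense of distributions and $\int_\Sigma G_{p_j}\,dV_g=0$. Put $$\tilde h = h\,\exp\Big(-4\pi\sum_{j=1}^m\alpha_j G_{p_j}\Big),\qquad I_\rho(u)=\int_\Sigma|\nabla_g u|^2\,dV_g+\frac{2\rho}{|\Sigma|}\int_\Sigma u\,dV_g-\rho\log\int_\Sigma\tilde h\,e^{2u}\,dV_g\quad(u\in H^1(\Sigma)).$$ Let $J_\rho=\{p_j:\rho<4\pi(1+\alpha_j)\}$, let $\theta>0$, and let $\Theta_\rho=\Sigma\setminus\bigcup_{p_j\in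 J_\rho}B_{p_j}(\theta)$ (open balls). Let $\tilde\alpha=\max\{\alpha_j: p_j\notin J_\rho\}$, with $\tilde\alpha=0$ if there is no such $j$. Fix $\alpha\in\big(\tilde\alpha,\frac{\rho}{4\pi}-1\big)$ and, for $\lambda>0$ and $x\in\Sigma$, put $$\varphi_{\alpha,\lambda,x}(y)=\log\left(\frac{\lambda^{1+\alpha}}{1+(\lambda\,d(y,x))^{2(1+\alpha)}}\right).$$ Then $\varphi_{\alpha,\lambda,x}\in H^1(\Sigma)$ and $\tilde h e^{2\varphi_{\alpha,\lambda,x}}$ is integrable for all $\lambda>0$ and $x\in\Sigma$, and $I_\rho(\varphi_{\alpha,\lambda,x})\to-\infty$ as $\lambda\to+\infty$, uniformly in $x\in\Theta_\rho$: for every $K\in\mathbb R$ there is $\Lambda>0$ such that $I_\rho(\varphi_{\alpha,\lambda,x})\le K$ for all $\lambda\ge\Lambda$ and all $x\in\Theta_\rho$. -/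

import Mathlib

open Set Filter Topology MeasureTheory Bundle Manifold
open scoped ENNReal ContDiff

noncomputable section

namespace SingularLiouville

/-- The model plane `ℝ²` with its Euclidean norm. -/
abbrev Plane : Type := EuclideanSpace ℝ (Fin 2)

section Covering

variable (M : Type*) [TopologicalSpace M] [ChartedSpace Plane M] [CompactSpace M] [Nonempty M]

/-- A compact surface is covered by a sequence of its preferred charts. -/
theorem exists_chart_cover :
    ∃ c : ℕ → M, (⋃ n, (chartAt Plane (c n)).source) = univ := by
  obtain ⟨s, hs, hU⟩ := countable_cover_nhds_of_sigmaCompact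
    (fun x : M => (chartAt Plane x).open_source.mem_nhds (mem_chart_source Plane x))
  have hne : s.Nonempty := by
    obtain ⟨x⟩ := (inferInstance : Nonempty M)
    have hx : x ∈ ⋃ x ∈ s, (chartAt Plane x).source := hU ▸ mem_univ x
    obtain ⟨y, hy, -⟩ := mem_iUnion₂.1 hx
    exact ⟨y, hy⟩
  obtain ⟨c, rfl⟩ := hs.exists_eq_range hne
  refine ⟨c, ?_⟩
  rw [← hU, biUnion_range]

/-- A sequence of base points whose preferred charts cover `M`. -/
def coverCenter : ℕ → M := Classical.choose (exists_chart_cover M)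

end Covering

section Volume

variable {M : Type*} [TopologicalSpace M] [ChartedSpace Plane M]
  [RiemannianBundle (fun x : M => TangentSpace 𝓘(ℝ, Plane) x)]

/-- The coordinate vector `∂ᵥ` at the point with coordinates `y` in the chart `e`. -/
def coordVector (e : OpenPartialHomeomorph M Plane) (y v : Plane) :
    TangentSpace 𝓘(ℝ, Plane) (e.symm y) :=
  mfderiv 𝓘(ℝ, Plane) 𝓘(ℝ, Plane) e.symm y v

/-- The matrix `(g_{ij})` of the Riemannian metric in the chart `e`, at the coordinates `y`. -/
def metricMatrix (e : OpenPartialHomeomorph M Plane) (y : Plane) : Matrix (Fin 2) (Fin 2) ℝ :=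
  Matrix.of fun i j =>
    inner ℝ (coordVector e y (EuclideanSpace.single i 1)) (coordVector e y (EuclideanSpace.single j 1))

/-- The measure `√(det g_{ij}) dy` of the chart `e`, carried to the domain of `e` in `M`. -/
def chartVolume [MeasurableSpace M] (e : OpenPartialHomeomorph M Plane) : Measure M :=
  ((volume.restrict e.target).withDensity
    fun y => ENNReal.ofReal (Real.sqrt (metricMatrix e y).det)).map e.symm

variable (M) in
/-- The Riemannian volume measure `dV_g` of a compact surface. The surface is cut into disjoint
Borel pieces, each lying in the domain of one chart, and each piece is measured by the density
`√(det g_{ij})` of its chart. By the change of variables formula the result does not depend on the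
pieces or on the charts. -/
def riemannianVolume [CompactSpace M] [Nonempty M] [MeasurableSpace M] : Measure M :=
  Measure.sum fun n => (chartVolume (chartAt Plane (coverCenter M n))).restrict
    (disjointed (fun k => (chartAt Plane (coverCenter M k)).source) n)

variable (M) in
/-- The total area `|Σ|`. -/
def area [CompactSpace M] [Nonempty M] [MeasurableSpace M] : ℝ :=
  (riemannianVolume M).real univ

end Volume

section Calculus

variable {M : Type*} [TopologicalSpace M] [ChartedSpace Plane M]
  [RiemannianBundle (fun x : M => TangentSpace 𝓘(ℝ, Plane) x)]

/-- The Riemannian gradient of a differentiable function. -/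
def gradient (u : M → ℝ) (x : M) : TangentSpace 𝓘(ℝ, Plane) x :=
  haveI : FiniteDimensional ℝ (TangentSpace 𝓘(ℝ, Plane) x) :=
    inferInstanceAs (FiniteDimensional ℝ Plane)
  haveI : CompleteSpace (TangentSpace 𝓘(ℝ, Plane) x) := FiniteDimensional.complete ℝ _
  (InnerProductSpace.toDual ℝ (TangentSpace 𝓘(ℝ, Plane) x)).symm
    (mfderiv 𝓘(ℝ, Plane) 𝓘(ℝ, ℝ) u x)

/-- The vector field `V` is the weak gradient `∇_g u`: in every smooth chart `e`, the function
`u ∘ e⁻¹` is locally integrable and has the locally integrable weak derivative `⟨V, ∂ᵥ⟩` in each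
direction `v`. -/
def IsWeakGradient (u : M → ℝ) (V : (x : M) → TangentSpace 𝓘(ℝ, Plane) x) : Prop :=
  ∀ e ∈ IsManifold.maximalAtlas 𝓘(ℝ, Plane) ∞ M,
    LocallyIntegrableOn (fun y => u (e.symm y)) e.target ∧
    ∀ v : Plane,
      LocallyIntegrableOn (fun y => inner ℝ (V (e.symm y)) (coordVector e y v)) e.target ∧
      ∀ ψ : Plane → ℝ, ContDiff ℝ ∞ ψ → HasCompactSupport ψ → tsupport ψ ⊆ e.target →
        ∫ y in e.target, u (e.symm y) * fderiv ℝ ψ y v =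
          -∫ y in e.target, inner ℝ (V (e.symm y)) (coordVector e y v) * ψ y

variable [CompactSpace M] [Nonempty M] [MeasurableSpace M]

/-- The Dirichlet energy `∫ |∇_g u|² dV_g`. Any two weak gradients of `u` agree almost everywhere,
so the infimum is over one single value; it is `∞` if there is no weak gradient. -/
def dirichletEnergy (u : M → ℝ) : ℝ≥0∞ :=
  ⨅ (V : (x : M) → TangentSpace 𝓘(ℝ, Plane) x) (_ : IsWeakGradient u V),
    ∫⁻ x, ‖V x‖ₑ ^ 2 ∂(riemannianVolume M)

/-- Membership in the Sobolev space `H¹(Σ)`. -/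
def MemH1 (u : M → ℝ) : Prop :=
  MemLp u 2 (riemannianVolume M) ∧ dirichletEnergy u < ⊤

/-- `f = Δ_g η` for a smooth function `η`, expressed by Green's identity
`∫ ⟨∇η, ∇ζ⟩ dV_g = -∫ f ζ dV_g` for all smooth `ζ`. -/
def IsLaplacian (η f : M → ℝ) : Prop :=
  Continuous f ∧ ∀ ζ : M → ℝ, ContMDiff 𝓘(ℝ, Plane) 𝓘(ℝ, ℝ) ∞ ζ →
    ∫ x, inner ℝ (gradient η x) (gradient ζ x) ∂(riemannianVolume M) =
      -∫ x, f x * ζ x ∂(riemannianVolume M)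

/-- `G` is the Green's function of `-Δ_g` with pole `p`: the integrable function of mean zero that
solves `-Δ_g G = δ_p - 1/|Σ|` in the sense of distributions. -/
def IsGreenFunction (p : M) (G : M → ℝ) : Prop :=
  Integrable G (riemannianVolume M) ∧
  ∫ x, G x ∂(riemannianVolume M) = 0 ∧
  ∀ η f : M → ℝ, ContMDiff 𝓘(ℝ, Plane) 𝓘(ℝ, ℝ) ∞ η → IsLaplacian η f →
    -∫ x, G x * f x ∂(riemannianVolume M) =
      η p - (area M)⁻¹ * ∫ x, η x ∂(riemannianVolume M)

/-- The functional
`I_ρ(u) = ∫ |∇_g u|² dV_g + 2 (ρ / |Σ|) ∫ u dV_g - ρ log ∫ h̃ e^{2u} dV_g`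
for `u ∈ H¹(Σ)`, with weight `w = h̃`. -/
def energyFunctional (ρ : ℝ) (w u : M → ℝ) : ℝ :=
  (dirichletEnergy u).toReal + 2 * (ρ / area M) * ∫ x, u x ∂(riemannianVolume M)
    - ρ * Real.log (∫ x, w x * Real.exp (2 * u x) ∂(riemannianVolume M))

end Calculus

/-- The weight `h̃ = h exp(-4π ∑ⱼ αⱼ G_{pⱼ})`, where `G j` is the Green's function with pole
`pⱼ`. -/
def singularWeight {M : Type*} {m : ℕ} (h : M → ℝ) (a : Fin m → ℝ) (G : Fin m → M → ℝ)
    (x : M) : ℝ :=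
  h x * Real.exp (-(4 * Real.pi * ∑ j, a j * G j x))

/-- The indices of the points of `J_ρ`, those with `ρ < 4π(1 + αⱼ)`. -/
def indexJ {m : ℕ} (ρ : ℝ) (a : Fin m → ℝ) : Set (Fin m) :=
  {j | ρ < 4 * Real.pi * (1 + a j)}

/-- `α̃`, the maximum of the `αⱼ` over the `j` outside `J_ρ`; it is `0` if there is no such `j`. -/
def alphaTilde {m : ℕ} (ρ : ℝ) (a : Fin m → ℝ) : ℝ :=
  ⨆ j : {j : Fin m // j ∉ indexJ ρ a}, a j

/-- `Θ_ρ`: the surface without the open balls of radius `θ` about the points of `J_ρ`. -/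
def thetaSet {M : Type*} [MetricSpace M] {m : ℕ} (ρ θ : ℝ) (a : Fin m → ℝ) (p : Fin m → M) :
    Set M :=
  univ \ ⋃ j ∈ indexJ ρ a, Metric.ball (p j) θ

/-- The test function `φ_{α,λ,x}`. -/
def testFunction {M : Type*} [MetricSpace M] (α lam : ℝ) (x y : M) : ℝ :=
  Real.log (lam ^ (1 + α) / (1 + (lam * dist y x) ^ (2 * (1 + α))))

end SingularLiouville

end

/-!
The value of `I_ρ` at the test function `φ` centred at `x` is a multiple of `log λ` up to a bounded
error, uniformly in `x`, and the multiple is negative.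

* Energy. `|∇φ| ≤ 2 (1 + α) min(λ, 1 / d(·, x))`, so the Dirichlet energy is at most
  `4 (1 + α)²` times the integral of `min(λ², d⁻²)`. Small balls of the surface are almost Euclidean,
  uniformly in the centre, and that integral is at most `(1 + ε) 2π log λ + C`
  (`dirichletEnergy_testFunction_le`, `exists_lintegral_truncated_inv_sq_le`).
* Mean. Off a small ball about `x`, `φ` is `-(1 + α) log λ` up to a constant
  (`exists_integral_testFunction_le`).
* Mass. `∫ h̃ e^{2φ}` is bounded below by a positive constant (`exists_le_integral_singularWeight`):
  in the ball of radius `1 / λ` about `x`, which has area of order `λ⁻²`, `e^{2φ}` is of order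
  `λ^{2 (1 + α)}`, and off still smaller balls about the singular points `h̃` is at least of order
  `λ^{-2 α̃}`, because `x ∈ Θ_ρ` keeps away from the points of `J_ρ`. Here `α̃ < α` enters.

Altogether the coefficient of `log λ` is, up to `ε`, equal to `8π (1 + α)² - 2ρ (1 + α)`, which is
negative because `4π (1 + α) < ρ`.

The lower bound for the mass and the integrability of `h̃ e^{2φ}` need the behaviour of `h̃` at the
singular points, that is, `G_p = -(2π)⁻¹ log d(·, p) + O(1)` (`exists_abs_green_add_log_le`), for a
function known only through its distributional equation. The equation is tested with a parametrix: in
a chart, the logarithm of the length of `z - y` in the metric frozen at `y`, smoothed out at the scale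
`ε` and cut off. Its Laplacian is an approximate delta function at `y` up to an error of order
`1 / |z - y|`, uniformly in `ε` and `y` (`exists_parametrix_bound`). At Lebesgue points of `G` the limit
`ε → 0` gives `|2π G + log d(·, p)| ≤ C (1 + S|G|)`, where `S` is the potential operator with kernel
`1 / d` (`exists_green_bound`). Composing this kernel with itself lowers the singularity to `d^{-1/2}`
and then removes it, so that iterating the inequality bounds `S|G|` by the integral of `|G|`.
-/

set_option linter.unusedSectionVars false

namespace SingularLiouville

/-! ### Coordinate vectors of a chart -/

section Charts

variable {M : Type*} [MetricSpace M] [ChartedSpace Plane M] [IsManifold 𝓘(ℝ, Plane) ∞ M]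
  {e : OpenPartialHomeomorph M Plane}

theorem mdifferentiableAt_symm (he : e ∈ IsManifold.maximalAtlas 𝓘(ℝ, Plane) ∞ M) {y : Plane}
    (hy : y ∈ e.target) : MDifferentiableAt 𝓘(ℝ, Plane) 𝓘(ℝ, Plane) e.symm y :=
  (contMDiffAt_symm_of_mem_maximalAtlas he hy).mdifferentiableAt (by simp)

theorem mdifferentiableAt_chart (he : e ∈ IsManifold.maximalAtlas 𝓘(ℝ, Plane) ∞ M) {x : M}
    (hx : x ∈ e.source) : MDifferentiableAt 𝓘(ℝ, Plane) 𝓘(ℝ, Plane) e x :=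
  (contMDiffAt_of_mem_maximalAtlas he hx).mdifferentiableAt (by simp)

theorem mfderiv_chart_symm_apply (he : e ∈ IsManifold.maximalAtlas 𝓘(ℝ, Plane) ∞ M) {y : Plane}
    (hy : y ∈ e.target) (v : Plane) :
    mfderiv 𝓘(ℝ, Plane) 𝓘(ℝ, Plane) e (e.symm y) (coordVector e y v) = v := by
  have h1 : mfderiv 𝓘(ℝ, Plane) 𝓘(ℝ, Plane) (e ∘ e.symm) y =
      (mfderiv 𝓘(ℝ, Plane) 𝓘(ℝ, Plane) e (e.symm y)).comp
        (mfderiv 𝓘(ℝ, Plane) 𝓘(ℝ, Plane) e.symm y) :=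
    mfderiv_comp y (mdifferentiableAt_chart he (e.map_target hy)) (mdifferentiableAt_symm he hy)
  have h2 : (e ∘ e.symm) =ᶠ[𝓝 y] id := by
    filter_upwards [e.open_target.mem_nhds hy] with z hz using e.right_inv hz
  rw [h2.mfderiv_eq, mfderiv_id] at h1
  exact (congrArg (fun L => L v) h1).symm

theorem coordVector_mfderiv_chart (he : e ∈ IsManifold.maximalAtlas 𝓘(ℝ, Plane) ∞ M) {y : Plane}
    (hy : y ∈ e.target) (w : TangentSpace 𝓘(ℝ, Plane) (e.symm y)) :
    coordVector e y (mfderiv 𝓘(ℝ, Plane) 𝓘(ℝ, Plane) e (e.symm y) w) = w := by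
  have hx := e.map_target hy
  have hd := mdifferentiableAt_symm he hy
  have h1 : mfderiv 𝓘(ℝ, Plane) 𝓘(ℝ, Plane) (e.symm ∘ e) (e.symm y) =
      (mfderiv 𝓘(ℝ, Plane) 𝓘(ℝ, Plane) e.symm (e (e.symm y))).comp
        (mfderiv 𝓘(ℝ, Plane) 𝓘(ℝ, Plane) e (e.symm y)) :=
    mfderiv_comp (e.symm y) (by rwa [e.right_inv hy]) (mdifferentiableAt_chart he hx)
  have h2 : (e.symm ∘ e) =ᶠ[𝓝 (e.symm y)] id := by
    filter_upwards [e.open_source.mem_nhds hx] with z hz using e.left_inv hz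
  rw [h2.mfderiv_eq, mfderiv_id, e.right_inv hy] at h1
  exact (congrArg (fun L => L w) h1).symm

variable [RiemannianBundle (fun x : M => TangentSpace 𝓘(ℝ, Plane) x)]

theorem coordVector_add (e : OpenPartialHomeomorph M Plane) (y v w : Plane) :
    coordVector e y (v + w) = coordVector e y v + coordVector e y w :=
  map_add (mfderiv 𝓘(ℝ, Plane) 𝓘(ℝ, Plane) e.symm y) v w

theorem coordVector_smul (e : OpenPartialHomeomorph M Plane) (y : Plane) (c : ℝ) (v : Plane) :
    coordVector e y (c • v) = c • coordVector e y v :=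
  map_smul (mfderiv 𝓘(ℝ, Plane) 𝓘(ℝ, Plane) e.symm y) c v

theorem coordVector_eq_zero (he : e ∈ IsManifold.maximalAtlas 𝓘(ℝ, Plane) ∞ M) {y : Plane}
    (hy : y ∈ e.target) {v : Plane} (hv : coordVector e y v = 0) : v = 0 := by
  rw [← mfderiv_chart_symm_apply he hy v, hv]
  exact map_zero _

/-- The metric coefficients of a smooth chart are smooth. -/
theorem contDiffOn_inner_coordVector
    [IsContMDiffRiemannianBundle 𝓘(ℝ, Plane) ∞ Plane (fun x : M => TangentSpace 𝓘(ℝ, Plane) x)]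
    (he : e ∈ IsManifold.maximalAtlas 𝓘(ℝ, Plane) ∞ M) (v w : Plane) :
    ContDiffOn ℝ ∞ (fun y => inner ℝ (coordVector e y v) (coordVector e y w)) e.target := by
  have hsec : ∀ v : Plane, ContMDiffOn 𝓘(ℝ, Plane) (𝓘(ℝ, Plane).prod 𝓘(ℝ, Plane)) ∞
      (fun y => (⟨e.symm y, coordVector e y v⟩ : TotalSpace Plane (TangentSpace 𝓘(ℝ, Plane) (M := M))))
      e.target := by
    intro v
    have h1 := (contMDiffOn_symm_of_mem_maximalAtlas he).contMDiffOn_tangentMapWithin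
      (m := ∞) (by simp) e.open_target.uniqueMDiffOn
    have h2 : ContMDiff 𝓘(ℝ, Plane) (𝓘(ℝ, Plane).prod 𝓘(ℝ, Plane)) ∞
      (fun y => (⟨y, v⟩ : TotalSpace Plane (TangentSpace 𝓘(ℝ, Plane) (M := Plane)))) :=
      contMDiff_vectorSpace_iff_contDiff.2 contDiff_const
    refine (h1.comp h2.contMDiffOn (fun y hy => hy)).congr fun y hy => ?_
    simp only [Function.comp, tangentMapWithin, coordVector]
    rw [mfderivWithin_of_isOpen e.open_target hy]
  rw [← contMDiffOn_iff_contDiffOn]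
  exact ContMDiffOn.inner_bundle (hsec v) (hsec w)

end Charts

/-! ### Riemannian distance in a chart -/

section Distance

variable {M : Type*} [MetricSpace M] [ChartedSpace Plane M] [IsManifold 𝓘(ℝ, Plane) ∞ M]
  [RiemannianBundle (fun x : M => TangentSpace 𝓘(ℝ, Plane) x)]
  {e : OpenPartialHomeomorph M Plane}

/-- If the inverse of a chart does not shorten tangent vectors by more than the factor `k`, the chart
does not stretch them by more than `k⁻¹`. -/
theorem mul_norm_mfderiv_chart_le (he : e ∈ IsManifold.maximalAtlas 𝓘(ℝ, Plane) ∞ M) {k : ℝ}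
    {s : Set Plane} (hk : ∀ y ∈ s, ∀ v : Plane, k * ‖v‖ ≤ ‖coordVector e y v‖)
    {x : M} (hx : x ∈ e.source) (hxs : e x ∈ s) (w : TangentSpace 𝓘(ℝ, Plane) x) :
    k * ‖(show Plane from mfderiv 𝓘(ℝ, Plane) 𝓘(ℝ, Plane) e x w)‖ ≤ ‖w‖ := by
  obtain ⟨y, hy, rfl⟩ : ∃ y ∈ e.target, e.symm y = x := ⟨e x, e.map_source hx, e.left_inv hx⟩
  rw [e.right_inv hy] at hxs
  have := hk y hxs (mfderiv 𝓘(ℝ, Plane) 𝓘(ℝ, Plane) e (e.symm y) w)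
  rwa [coordVector_mfderiv_chart he hy] at this

variable [IsContMDiffRiemannianBundle 𝓘(ℝ, Plane) ∞ Plane
    (fun x : M => TangentSpace 𝓘(ℝ, Plane) x)]
  [IsRiemannianManifold 𝓘(ℝ, Plane) M]

/-- If tangent vectors are stretched by at most the factor `C` over a coordinate disc, so are
distances, since straight segments of the disc are paths in `M`. -/
theorem dist_symm_le (he : e ∈ IsManifold.maximalAtlas 𝓘(ℝ, Plane) ∞ M) {c : Plane} {r : ℝ}
    (hr : Metric.ball c r ⊆ e.target) {C : ℝ} (hC0 : 0 ≤ C)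
    (hC : ∀ y ∈ Metric.ball c r, ∀ v : Plane, ‖coordVector e y v‖ ≤ C * ‖v‖)
    {y z : Plane} (hy : y ∈ Metric.ball c r) (hz : z ∈ Metric.ball c r) :
    dist (e.symm y) (e.symm z) ≤ C * ‖y - z‖ := by
  let η : ℝ →ᴬ[ℝ] Plane := ContinuousAffineMap.lineMap y z
  set γ : ℝ → M := e.symm ∘ η
  have hη : MapsTo η (Icc 0 1) (Metric.ball c r) := by
    intro t ht
    have : η t ∈ segment ℝ y z := by
      rw [segment_eq_image_lineMap]
      exact ⟨t, ht, by simp [η, ContinuousAffineMap.coe_lineMap_eq]⟩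
    exact (convex_ball c r).segment_subset hy hz this
  have hηs : ContMDiffOn 𝓘(ℝ, ℝ) 𝓘(ℝ, Plane) 1 η (Icc 0 1) :=
    (contMDiff_iff_contDiff.2 η.contDiff).contMDiffOn
  have h1 : riemannianEDist 𝓘(ℝ, Plane) (e.symm y) (e.symm z) ≤
      pathELength 𝓘(ℝ, Plane) γ 0 1 := by
    apply riemannianEDist_le_pathELength _ _ _ zero_le_one
    · exact ((contMDiffOn_symm_of_mem_maximalAtlas he).of_le (by simp)).comp hηs
        (hη.mono_right hr)
    · simp [γ, η, ContinuousAffineMap.coe_lineMap_eq]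
    · simp [γ, η, ContinuousAffineMap.coe_lineMap_eq]
  have h2 : pathELength 𝓘(ℝ, Plane) γ 0 1 ≤ ∫⁻ _ in Icc (0 : ℝ) 1, ENNReal.ofReal (C * ‖y - z‖) := by
    rw [pathELength_eq_lintegral_mfderivWithin_Icc]
    apply setLIntegral_mono' measurableSet_Icc (fun t ht ↦ ?_)
    have h3 : mfderivWithin 𝓘(ℝ, ℝ) 𝓘(ℝ, Plane) γ (Icc 0 1) t =
        (mfderiv 𝓘(ℝ, Plane) 𝓘(ℝ, Plane) e.symm (η t)).comp
          (mfderivWithin 𝓘(ℝ, ℝ) 𝓘(ℝ, Plane) η (Icc 0 1) t) := by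
      apply mfderiv_comp_mfderivWithin
      · exact mdifferentiableAt_symm he (hr (hη ht))
      · exact hηs.mdifferentiableOn one_ne_zero t ht
      · rw [uniqueMDiffWithinAt_iff_uniqueDiffWithinAt]
        exact uniqueDiffOn_Icc zero_lt_one t ht
    have h4 : mfderivWithin 𝓘(ℝ, ℝ) 𝓘(ℝ, Plane) η (Icc 0 1) t 1 = z - y := by
      rw [mfderivWithin_eq_fderivWithin,
        fderivWithin_eq_fderiv (uniqueDiffOn_Icc zero_lt_one _ ht)
          η.differentiableAt]
      change fderiv ℝ η t 1 = z - y
      simp [η]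
    have h5 : mfderivWithin 𝓘(ℝ, ℝ) 𝓘(ℝ, Plane) γ (Icc 0 1) t 1 = coordVector e (η t) (z - y) := by
      rw [h3, ← h4]
      rfl
    rw [h5, ← ofReal_norm]
    refine ENNReal.ofReal_le_ofReal ((hC _ (hη ht) _).trans_eq ?_)
    rw [norm_sub_rev]
  rw [setLIntegral_const, Real.volume_Icc] at h2
  have h3 : edist (e.symm y) (e.symm z) ≤ ENNReal.ofReal (C * ‖y - z‖) := by
    rw [IsRiemannianManifold.out (I := 𝓘(ℝ, Plane)) (e.symm y) (e.symm z)]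
    simpa using h1.trans h2
  rw [edist_dist] at h3
  exact (ENNReal.ofReal_le_ofReal_iff (by positivity)).1 h3

/-- A chart in which tangent vectors are not shortened by more than the factor `k` does not shorten
short distances by more than `k` either: a path from `x` to `z` of length less than `k * ρ` cannot
leave the coordinate disc of radius `ρ` about `x`. -/
theorem mul_norm_sub_le_dist (he : e ∈ IsManifold.maximalAtlas 𝓘(ℝ, Plane) ∞ M) {c : Plane}
    {r : ℝ} (hr : Metric.ball c r ⊆ e.target) {k : ℝ} (hk0 : 0 < k)
    (hk : ∀ y ∈ Metric.ball c r, ∀ v : Plane, k * ‖v‖ ≤ ‖coordVector e y v‖)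
    {x z : M} (hx : x ∈ e.source) (hxc : dist (e x) c < r / 2) (hxz : dist x z < k * (r / 2)) :
    z ∈ e.source ∧ e z ∈ Metric.ball c r ∧ k * ‖e x - e z‖ ≤ dist x z := by
  -- it is enough to bound `k * ‖e x - e z‖` by every `k * ρ` with `dist x z < k * ρ < k * r / 2`
  suffices H : ∀ ρ, dist x z / k < ρ → ρ < r / 2 →
      z ∈ e.source ∧ e z ∈ Metric.closedBall (e x) ρ by
    have h0 : dist x z / k < r / 2 := by rw [div_lt_iff₀ hk0]; linarith
    obtain ⟨ρ, hρ1, hρ2⟩ := exists_between h0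
    refine ⟨(H ρ hρ1 hρ2).1, ?_, ?_⟩
    · have := (H ρ hρ1 hρ2).2
      rw [Metric.mem_closedBall] at this
      rw [Metric.mem_ball]
      linarith [dist_triangle (e z) (e x) c]
    · have : ‖e x - e z‖ ≤ dist x z / k := by
        refine le_of_forall_gt_imp_ge_of_dense fun a ha => ?_
        have h1 := (H (min a ρ) (lt_min ha hρ1) ((min_le_right _ _).trans_lt hρ2)).2
        rw [Metric.mem_closedBall, dist_comm, dist_eq_norm] at h1
        exact h1.trans (min_le_left _ _)
      rw [le_div_iff₀ hk0] at this
      linarith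
  intro ρ hρ1 hρ2
  have hρ0 : 0 < ρ := lt_of_le_of_lt (by positivity) hρ1
  rw [div_lt_iff₀ hk0] at hρ1
  have hball : Metric.closedBall (e x) ρ ⊆ Metric.ball c r := by
    intro y hy
    rw [Metric.mem_closedBall] at hy
    rw [Metric.mem_ball]
    linarith [dist_triangle y (e x) c]
  have hlt : riemannianEDist 𝓘(ℝ, Plane) x z < ENNReal.ofReal (k * ρ) := by
    rw [← IsRiemannianManifold.out (I := 𝓘(ℝ, Plane)) x z, edist_dist]
    exact (ENNReal.ofReal_lt_ofReal_iff (by positivity)).2 (by linarith)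
  obtain ⟨γ, hγx, hγz, γ_smooth, hγ, -⟩ :=
    exists_lt_locally_constant_of_riemannianEDist_lt hlt zero_lt_one
  set u : Set M := e.symm '' Metric.closedBall (e x) ρ with hu_def
  have u_closed : IsClosed u := by
    refine ((isCompact_closedBall (e x) ρ).image_of_continuousOn ?_).isClosed
    exact e.continuousOn_symm.mono (hball.trans hr)
  have hmem : ∀ w, w ∈ u ↔ w ∈ e.source ∧ e w ∈ Metric.closedBall (e x) ρ := by
    intro w
    constructor
    · rintro ⟨y, hy, rfl⟩
      have hyt := hr (hball hy)
      exact ⟨e.map_target hyt, by rwa [e.right_inv hyt]⟩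
    · rintro ⟨h1, h2⟩
      exact ⟨e w, h2, e.left_inv h1⟩
  set v : Set M := e.source ∩ e ⁻¹' Metric.ball (e x) ρ
  have v_open : IsOpen v := e.isOpen_inter_preimage Metric.isOpen_ball
  have hvu : v ⊆ u := fun w hw => (hmem w).2 ⟨hw.1, Metric.ball_subset_closedBall hw.2⟩
  let A := γ ⁻¹' u
  have zero_mem : 0 ∈ A := by
    refine (hmem _).2 ?_
    rw [hγx]
    exact ⟨hx, Metric.mem_closedBall_self hρ0.le⟩
  have A_closed : IsClosed (A ∩ Icc 0 1) :=
    (u_closed.preimage γ_smooth.continuous).inter isClosed_Icc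
  -- The path `γ` stays in the coordinate disc: the set of times up to which it does is closed, and it
  -- is open because the length bound keeps `γ` off the boundary of the disc.
  suffices Icc 0 1 ⊆ A by
    have h1 : γ 1 ∈ u := this ⟨zero_le_one, le_rfl⟩
    rw [hγz] at h1
    exact (hmem z).1 h1
  apply A_closed.Icc_subset_of_forall_mem_nhdsGT_of_Icc_subset zero_mem
  rintro t₁ ⟨ht₁0, ht₁1⟩ t₁_mem
  suffices γ t₁ ∈ v from
    γ_smooth.continuous.continuousWithinAt <| mem_of_superset (v_open.mem_nhds this) hvu
  have hsrc : ∀ t ∈ Icc 0 t₁, γ t ∈ e.source := fun t ht => ((hmem _).1 (t₁_mem ht)).1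
  let γ' : ℝ → Plane := e ∘ γ
  have hC : ContMDiffOn 𝓘(ℝ, ℝ) 𝓘(ℝ, Plane) 1 γ' (Icc 0 t₁) :=
    ((contMDiffOn_of_mem_maximalAtlas he).of_le (by simp)).comp γ_smooth.contMDiffOn hsrc
  have hlen : ENNReal.ofReal k * ‖γ' t₁ - γ' 0‖ₑ < ENNReal.ofReal (k * ρ) := by
    rcases ht₁0.eq_or_lt with rfl | h't'
    · simp only [sub_self, enorm_zero, mul_zero, ENNReal.ofReal_pos]
      positivity
    calc
      ENNReal.ofReal k * ‖γ' t₁ - γ' 0‖ₑ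
    _ ≤ ENNReal.ofReal k * ∫⁻ t' in Icc 0 t₁, ‖derivWithin γ' (Icc 0 t₁) t'‖ₑ := by
      gcongr
      apply enorm_sub_le_lintegral_derivWithin_Icc_of_contDiffOn_Icc _ ht₁0
      rwa [← contMDiffOn_iff_contDiffOn]
    _ = ∫⁻ t' in Icc 0 t₁, ENNReal.ofReal k * ‖derivWithin γ' (Icc 0 t₁) t'‖ₑ := by
      rw [lintegral_const_mul' _ _ ENNReal.ofReal_ne_top]
    _ ≤ ∫⁻ t' in Icc 0 t₁, ‖mfderivWithin 𝓘(ℝ, ℝ) 𝓘(ℝ, Plane) γ (Icc 0 t₁) t' 1‖ₑ := by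
      apply setLIntegral_mono' measurableSet_Icc (fun t' ht' ↦ ?_)
      have h1 : mfderivWithin 𝓘(ℝ, ℝ) 𝓘(ℝ, Plane) γ' (Icc 0 t₁) t' =
          (mfderiv 𝓘(ℝ, Plane) 𝓘(ℝ, Plane) e (γ t')).comp
            (mfderivWithin 𝓘(ℝ, ℝ) 𝓘(ℝ, Plane) γ (Icc 0 t₁) t') := by
        apply mfderiv_comp_mfderivWithin
        · exact mdifferentiableAt_chart he (hsrc t' ht')
        · exact (γ_smooth.mdifferentiable one_ne_zero).mdifferentiableOn _ ht'
        · rw [uniqueMDiffWithinAt_iff_uniqueDiffWithinAt]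
          exact uniqueDiffOn_Icc h't' _ ht'
      have h2 : derivWithin γ' (Icc 0 t₁) t' =
          (show Plane from mfderiv 𝓘(ℝ, Plane) 𝓘(ℝ, Plane) e (γ t')
            (mfderivWithin 𝓘(ℝ, ℝ) 𝓘(ℝ, Plane) γ (Icc 0 t₁) t' 1)) := by
        rw [← fderivWithin_derivWithin, ← mfderivWithin_eq_fderivWithin, h1]
        rfl
      rw [h2, ← ofReal_norm, ← ofReal_norm, ← ENNReal.ofReal_mul hk0.le]
      exact ENNReal.ofReal_le_ofReal (mul_norm_mfderiv_chart_le he hk (hsrc t' ht')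
        (hball ((hmem _).1 (t₁_mem ht')).2) _)
    _ = pathELength 𝓘(ℝ, Plane) γ 0 t₁ := by
      rw [pathELength_eq_lintegral_mfderivWithin_Icc]
    _ ≤ pathELength 𝓘(ℝ, Plane) γ 0 1 := pathELength_mono le_rfl ht₁1.le
    _ < ENNReal.ofReal (k * ρ) := hγ
  refine ⟨hsrc t₁ ⟨ht₁0, le_rfl⟩, ?_⟩
  rw [← ofReal_norm, ← ENNReal.ofReal_mul hk0.le,
    ENNReal.ofReal_lt_ofReal_iff (by positivity)] at hlen
  have := lt_of_mul_lt_mul_left hlen hk0.le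
  simpa [γ', hγx, dist_eq_norm] using this

end Distance

/-! ### The matrix of the metric and almost isometric charts -/

section Metric

variable {M : Type*} [MetricSpace M] [ChartedSpace Plane M] [IsManifold 𝓘(ℝ, Plane) ∞ M]
  [RiemannianBundle (fun x : M => TangentSpace 𝓘(ℝ, Plane) x)]
  {e : OpenPartialHomeomorph M Plane}

theorem plane_eq (v : Plane) :
    v = v 0 • EuclideanSpace.single 0 (1 : ℝ) + v 1 • EuclideanSpace.single 1 (1 : ℝ) := by
  ext i; fin_cases i <;> simp

theorem plane_norm_sq (v : Plane) : ‖v‖ ^ 2 = v 0 ^ 2 + v 1 ^ 2 := by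
  rw [EuclideanSpace.norm_sq_eq]; simp

/-- The inner product of two coordinate vectors in terms of the metric coefficients. -/
theorem inner_coordVector (e : OpenPartialHomeomorph M Plane) (y v w : Plane) :
    inner ℝ (coordVector e y v) (coordVector e y w) =
      ∑ i, ∑ j, metricMatrix e y i j * v i * w j := by
  conv_lhs => rw [plane_eq v, plane_eq w]
  simp only [coordVector_add, coordVector_smul, inner_add_left, inner_add_right,
    real_inner_smul_left, real_inner_smul_right, Fin.sum_univ_two, metricMatrix, Matrix.of_apply]
  ring

theorem norm_sq_coordVector (e : OpenPartialHomeomorph M Plane) (y v : Plane) :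
    ‖coordVector e y v‖ ^ 2 = ∑ i, ∑ j, metricMatrix e y i j * v i * v j := by
  rw [← real_inner_self_eq_norm_sq, inner_coordVector]

theorem metricMatrix_comm (e : OpenPartialHomeomorph M Plane) (y : Plane) (i j : Fin 2) :
    metricMatrix e y i j = metricMatrix e y j i := by
  simp only [metricMatrix, Matrix.of_apply]
  exact real_inner_comm _ _

theorem det_metricMatrix (e : OpenPartialHomeomorph M Plane) (y : Plane) :
    (metricMatrix e y).det =
      metricMatrix e y 0 0 * metricMatrix e y 1 1 - metricMatrix e y 0 1 ^ 2 := by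
  rw [Matrix.det_fin_two, metricMatrix_comm e y 1 0]; ring

/-- If the metric is bounded below by `k` in a chart, its determinant is at least `k ^ 4`. -/
theorem pow_four_le_det_metricMatrix {y : Plane} {k : ℝ} (hk0 : 0 ≤ k)
    (hk : ∀ v : Plane, k * ‖v‖ ≤ ‖coordVector e y v‖) :
    k ^ 4 ≤ (metricMatrix e y).det := by
  set a := metricMatrix e y 0 0
  set b := metricMatrix e y 0 1
  set c := metricMatrix e y 1 1
  have key : ∀ s t : ℝ, k ^ 2 * (s ^ 2 + t ^ 2) ≤ a * s ^ 2 + 2 * b * s * t + c * t ^ 2 := by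
    intro s t
    have h1 := pow_le_pow_left₀ (by positivity) (hk (!₂[s, t])) 2
    rw [mul_pow, plane_norm_sq, norm_sq_coordVector] at h1
    simp only [Fin.sum_univ_two] at h1
    rw [metricMatrix_comm e y 1 0] at h1
    simp at h1
    nlinarith [h1]
  rw [det_metricMatrix]
  change k ^ 4 ≤ a * c - b ^ 2
  have h1 := key 1 0
  have h2 := key 0 1
  have h3 := key (-b) (a - k ^ 2)
  rcases eq_or_lt_of_le (show 0 ≤ a - k ^ 2 by linarith) with h | h
  · have ha : a = k ^ 2 := by linarith
    have hb : b = 0 := by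
      by_contra hb
      have := key (-(c - k ^ 2 + 1) / (2 * b)) 1
      have h5 : 2 * b * (-(c - k ^ 2 + 1) / (2 * b)) = -(c - k ^ 2 + 1) := by
        field_simp
      nlinarith
    rw [hb, ha]
    nlinarith [sq_nonneg k]
  · have h5 : 0 ≤ (a - k ^ 2) * ((a - k ^ 2) * (c - k ^ 2) - b ^ 2) := by nlinarith
    have h6 : 0 ≤ (a - k ^ 2) * (c - k ^ 2) - b ^ 2 := nonneg_of_mul_nonneg_right h5 h
    nlinarith [sq_nonneg k]

/-- If the metric is bounded above by `C` in a chart, its determinant is at most `C ^ 4`. -/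
theorem det_metricMatrix_le_pow_four {y : Plane} {C : ℝ}
    (hC : ∀ v : Plane, ‖coordVector e y v‖ ≤ C * ‖v‖) :
    (metricMatrix e y).det ≤ C ^ 4 := by
  have h : ∀ i, metricMatrix e y i i ≤ C ^ 2 := by
    intro i
    have := pow_le_pow_left₀ (norm_nonneg _) (hC (EuclideanSpace.single i 1)) 2
    rw [← real_inner_self_eq_norm_sq] at this
    simpa [metricMatrix] using this
  have h' : ∀ i, 0 ≤ metricMatrix e y i i := by
    intro i
    simp only [metricMatrix, Matrix.of_apply]
    exact real_inner_self_nonneg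
  rw [det_metricMatrix]
  nlinarith [h 0, h 1, h' 0, h' 1, sq_nonneg (metricMatrix e y 0 1),
    mul_le_mul (h 0) (h 1) (h' 1) (sq_nonneg C)]

theorem abs_metricMatrix_le {y : Plane} {C : ℝ}
    (hC : ∀ v : Plane, ‖coordVector e y v‖ ≤ C * ‖v‖) (i j : Fin 2) :
    |metricMatrix e y i j| ≤ C ^ 2 := by
  simp only [metricMatrix, Matrix.of_apply]
  refine (abs_real_inner_le_norm _ _).trans ?_
  have h := fun i => hC (EuclideanSpace.single i 1)
  simp only [PiLp.norm_single, norm_one, mul_one] at h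
  have := (norm_nonneg _).trans (h i)
  nlinarith [h i, h j, norm_nonneg (coordVector e y (EuclideanSpace.single i 1)),
    norm_nonneg (coordVector e y (EuclideanSpace.single j 1)),
    mul_le_mul (h i) (h j) (norm_nonneg _) this]

theorem det_metricMatrix_pos (he : e ∈ IsManifold.maximalAtlas 𝓘(ℝ, Plane) ∞ M) {y : Plane}
    (hy : y ∈ e.target) : 0 < (metricMatrix e y).det := by
  have hpos : ∀ v : Plane, v ≠ 0 → 0 < ‖coordVector e y v‖ ^ 2 := fun v hv =>
    pow_pos (norm_pos_iff.2 fun h => hv (coordVector_eq_zero he hy h)) 2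
  rw [det_metricMatrix]
  have h0 := hpos (!₂[1, 0]) (by intro h; have := congrFun (congrArg WithLp.ofLp h) 0; simp at this)
  have h1 : 0 < metricMatrix e y 0 0 := by
    rw [norm_sq_coordVector] at h0
    simpa [Fin.sum_univ_two] using h0
  have h2 := hpos (!₂[-metricMatrix e y 0 1, metricMatrix e y 0 0]) (by
    intro h; have := congrFun (congrArg WithLp.ofLp h) 1; simp at this; linarith)
  rw [norm_sq_coordVector] at h2
  simp only [Fin.sum_univ_two] at h2
  rw [metricMatrix_comm e y 1 0] at h2
  simp at h2
  have h3 : 0 < metricMatrix e y 0 0 *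
    (metricMatrix e y 0 0 * metricMatrix e y 1 1 - metricMatrix e y 0 1 ^ 2) := by nlinarith
  exact (pos_iff_pos_of_mul_pos h3).1 h1

variable [IsContMDiffRiemannianBundle 𝓘(ℝ, Plane) ∞ Plane
    (fun x : M => TangentSpace 𝓘(ℝ, Plane) x)]

theorem contDiffOn_metricMatrix (he : e ∈ IsManifold.maximalAtlas 𝓘(ℝ, Plane) ∞ M)
    (i j : Fin 2) : ContDiffOn ℝ ∞ (fun y => metricMatrix e y i j) e.target :=
  contDiffOn_inner_coordVector he _ _

theorem contDiffOn_det_metricMatrix (he : e ∈ IsManifold.maximalAtlas 𝓘(ℝ, Plane) ∞ M) :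
    ContDiffOn ℝ ∞ (fun y => (metricMatrix e y).det) e.target := by
  simp only [det_metricMatrix]
  exact ((contDiffOn_metricMatrix he 0 0).mul (contDiffOn_metricMatrix he 1 1)).sub
    ((contDiffOn_metricMatrix he 0 1).pow 2)

/-- Around every point there is a smooth chart in which the metric at that point is Euclidean. -/
theorem exists_isometric_chart (q : M) :
    ∃ e ∈ IsManifold.maximalAtlas 𝓘(ℝ, Plane) ∞ M, q ∈ e.source ∧
      ∀ v : Plane, ‖coordVector e (e q) v‖ = ‖v‖ := by
  set e₀ := chartAt Plane q
  have he₀ : e₀ ∈ IsManifold.maximalAtlas 𝓘(ℝ, Plane) ∞ M := IsManifold.chart_mem_maximalAtlas q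
  have hq : q ∈ e₀.source := mem_chart_source Plane q
  have hq' : e₀ q ∈ e₀.target := e₀.map_source hq
  have : FiniteDimensional ℝ (TangentSpace 𝓘(ℝ, Plane) (e₀.symm (e₀ q))) :=
    inferInstanceAs (FiniteDimensional ℝ Plane)
  have hfin : Module.finrank ℝ (TangentSpace 𝓘(ℝ, Plane) (e₀.symm (e₀ q))) = 2 := by
    change Module.finrank ℝ Plane = 2
    simp
  let b := (stdOrthonormalBasis ℝ (TangentSpace 𝓘(ℝ, Plane) (e₀.symm (e₀ q)))).reindex
    (finCongr hfin)
  let φ : TangentSpace 𝓘(ℝ, Plane) (e₀.symm (e₀ q)) ≃ₗᵢ[ℝ] Plane := b.repr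
  let C : Plane →ₗ[ℝ] TangentSpace 𝓘(ℝ, Plane) (e₀.symm (e₀ q)) :=
    { toFun := coordVector e₀ (e₀ q)
      map_add' := coordVector_add e₀ (e₀ q)
      map_smul' := coordVector_smul e₀ (e₀ q) }
  have hCinj : Function.Injective (φ.toLinearEquiv.toLinearMap ∘ₗ C) := by
    rw [injective_iff_map_eq_zero]
    intro v hv
    exact coordVector_eq_zero he₀ hq' (φ.map_eq_zero_iff.1 hv)
  let L : Plane ≃L[ℝ] Plane :=
    (LinearEquiv.ofInjectiveEndo _ hCinj).toContinuousLinearEquiv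
  have hL : ∀ v, ‖coordVector e₀ (e₀ q) v‖ = ‖L v‖ := fun v => (φ.norm_map _).symm
  -- The chart `e₀` followed by the linear map that makes the metric at `q` Euclidean.
  let e := e₀.transHomeomorph L.toHomeomorph
  have hsymm : ∀ y, e.symm y = e₀.symm (L.symm y) := fun y => rfl
  have hLs : ContMDiff 𝓘(ℝ, Plane) 𝓘(ℝ, Plane) ∞ L :=
    contMDiff_iff_contDiff.2 L.contDiff
  have hLs' : ContMDiff 𝓘(ℝ, Plane) 𝓘(ℝ, Plane) ∞ L.symm :=
    contMDiff_iff_contDiff.2 L.symm.contDiff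
  refine ⟨e, ?_, hq, ?_⟩
  · apply OpenPartialHomeomorph.mem_maximalAtlas_of_contMDiffOn
    · exact hLs.comp_contMDiffOn (contMDiffOn_of_mem_maximalAtlas he₀)
    · exact (contMDiffOn_symm_of_mem_maximalAtlas he₀).comp hLs'.contMDiffOn (fun y hy => hy)
  · intro v
    have h1 : L.symm (e q) = e₀ q := L.symm_apply_apply _
    have h2 : MDifferentiableAt 𝓘(ℝ, Plane) 𝓘(ℝ, Plane) e₀.symm (L.symm (e q)) := by
      rw [h1]; exact mdifferentiableAt_symm he₀ hq'
    have h3 : mfderiv 𝓘(ℝ, Plane) 𝓘(ℝ, Plane) e.symm (e q) =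
        (mfderiv 𝓘(ℝ, Plane) 𝓘(ℝ, Plane) e₀.symm (L.symm (e q))).comp
          (mfderiv 𝓘(ℝ, Plane) 𝓘(ℝ, Plane) L.symm (e q)) :=
      mfderiv_comp (e q) h2 (hLs'.mdifferentiableAt (by simp))
    have h4 : mfderiv 𝓘(ℝ, Plane) 𝓘(ℝ, Plane) L.symm (e q) = (L.symm : Plane →L[ℝ] Plane) := by
      rw [mfderiv_eq_fderiv]; exact L.symm.fderiv
    have h5 : coordVector e (e q) v = coordVector e₀ (L.symm (e q)) (L.symm v) := by
      rw [h4] at h3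
      exact congrArg (fun A => A v) h3
    have h6 : ‖coordVector e (e q) v‖ = ‖coordVector e₀ (L.symm (e q)) (L.symm v)‖ := by
      rw [h5]; rfl
    rw [h6, h1, hL, L.apply_symm_apply]

/-- Around every point there are charts which are isometric up to an arbitrarily small error. -/
theorem exists_almost_isometric_chart (q : M) {ε : ℝ} (hε : 0 < ε) (hε1 : ε < 1) :
    ∃ e ∈ IsManifold.maximalAtlas 𝓘(ℝ, Plane) ∞ M, q ∈ e.source ∧ ∃ r > 0,
      Metric.ball (e q) r ⊆ e.target ∧ ∀ y ∈ Metric.ball (e q) r, ∀ v : Plane,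
        (1 - ε) * ‖v‖ ≤ ‖coordVector e y v‖ ∧ ‖coordVector e y v‖ ≤ (1 + ε) * ‖v‖ := by
  obtain ⟨e, he, hq, hiso⟩ := exists_isometric_chart q
  refine ⟨e, he, hq, ?_⟩
  have hqt := e.map_source hq
  have hcont : ∀ i j, ∀ᶠ y in 𝓝 (e q),
      |metricMatrix e y i j - metricMatrix e (e q) i j| < ε / 4 := by
    intro i j
    have h1 : ContinuousAt (fun y => metricMatrix e y i j) (e q) :=
      (contDiffOn_metricMatrix he i j).continuousOn.continuousAt (e.open_target.mem_nhds hqt)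
    exact (Metric.continuousAt_iff'.1 h1) (ε / 4) (by positivity)
  have hall : ∀ᶠ y in 𝓝 (e q), y ∈ e.target ∧
      ∀ i j, |metricMatrix e y i j - metricMatrix e (e q) i j| < ε / 4 := by
    refine Filter.Eventually.and (e.open_target.mem_nhds hqt) ?_
    simp only [eventually_all]
    exact hcont
  obtain ⟨r, hr0, hr⟩ := Metric.eventually_nhds_iff_ball.1 hall
  refine ⟨r, hr0, fun y hy => (hr y hy).1, fun y hy v => ?_⟩
  have hd := (hr y hy).2
  -- the two quadratic forms differ by at most `ε * ‖v‖ ^ 2`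
  have hdiff : |‖coordVector e y v‖ ^ 2 - ‖v‖ ^ 2| ≤ ε * ‖v‖ ^ 2 := by
    rw [← hiso v, norm_sq_coordVector, norm_sq_coordVector, ← Finset.sum_sub_distrib]
    simp only [← Finset.sum_sub_distrib, ← sub_mul]
    refine (Finset.abs_sum_le_sum_abs _ _).trans ?_
    have : ∀ i j, |(metricMatrix e y i j - metricMatrix e (e q) i j) * v i * v j| ≤
        ε / 4 * ‖v‖ ^ 2 := by
      intro i j
      rw [abs_mul, abs_mul, mul_assoc, pow_two]
      have hi : ∀ i, |v i| ≤ ‖v‖ := fun i => by simpa using PiLp.norm_apply_le v i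
      exact mul_le_mul (hd i j).le (mul_le_mul (hi i) (hi j) (abs_nonneg _) (norm_nonneg _))
        (by positivity) (by positivity)
    calc _ ≤ ∑ i : Fin 2, ∑ j : Fin 2, ε / 4 * ‖v‖ ^ 2 := Finset.sum_le_sum fun i _ =>
          (Finset.abs_sum_le_sum_abs _ _).trans (Finset.sum_le_sum fun j _ => this i j)
      _ = ε * ‖v‖ ^ 2 := by simp; ring
      _ = _ := by rw [← norm_sq_coordVector, hiso]
  obtain ⟨h1, h2⟩ := abs_le.1 hdiff
  have hv := sq_nonneg ‖v‖
  constructor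
  · refine le_of_sq_le_sq ?_ (norm_nonneg _)
    nlinarith
  · refine le_of_sq_le_sq ?_ (by positivity)
    nlinarith

variable [IsRiemannianManifold 𝓘(ℝ, Plane) M]

/-- The comparison of a surface with the plane near a point `q`: in a suitable chart the metric,
hence also the distance, is Euclidean up to a factor between `1 - ε` and `1 + ε`. -/
theorem exists_comparison_chart (q : M) {ε : ℝ} (hε : 0 < ε) (hε1 : ε < 1) :
    ∃ e ∈ IsManifold.maximalAtlas 𝓘(ℝ, Plane) ∞ M, q ∈ e.source ∧ ∃ r > 0,
      Metric.ball (e q) r ⊆ e.target ∧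
      (∀ y ∈ Metric.ball (e q) r, ∀ v : Plane,
        (1 - ε) * ‖v‖ ≤ ‖coordVector e y v‖ ∧ ‖coordVector e y v‖ ≤ (1 + ε) * ‖v‖) ∧
      (∀ y ∈ Metric.ball (e q) r, ∀ z ∈ Metric.ball (e q) r,
        dist (e.symm y) (e.symm z) ≤ (1 + ε) * ‖y - z‖) ∧
      ∀ s > 0, ∃ δ > 0, ∀ x z : M, dist x q < δ → dist x z < δ →
        x ∈ e.source ∧ z ∈ e.source ∧ e x ∈ Metric.ball (e q) s ∧ e z ∈ Metric.ball (e q) s ∧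
          (1 - ε) * ‖e x - e z‖ ≤ dist x z := by
  obtain ⟨e, he, hq, r, hr0, hr, hiso⟩ := exists_almost_isometric_chart q hε hε1
  refine ⟨e, he, hq, r, hr0, hr, hiso, fun y hy z hz =>
    dist_symm_le he hr (by linarith) (fun y hy v => (hiso y hy v).2) hy hz, ?_⟩
  intro s hs
  set t := min r s with ht
  have ht0 : 0 < t := lt_min hr0 hs
  have htr : Metric.ball (e q) t ⊆ Metric.ball (e q) r := Metric.ball_subset_ball (min_le_left _ _)
  have hk : ∀ y ∈ Metric.ball (e q) t, ∀ v : Plane, (1 - ε) * ‖v‖ ≤ ‖coordVector e y v‖ :=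
    fun y hy v => (hiso y (htr hy) v).1
  have hε' : 0 < 1 - ε := by linarith
  have hcont : ∀ᶠ x in 𝓝 q, x ∈ e.source ∧ dist (e x) (e q) < t / 2 := by
    refine Filter.Eventually.and (e.open_source.mem_nhds hq) ?_
    exact (e.continuousAt hq).eventually (Metric.ball_mem_nhds _ (by positivity))
  obtain ⟨δ₀, hδ₀, hδ⟩ := Metric.eventually_nhds_iff_ball.1 hcont
  refine ⟨min δ₀ ((1 - ε) * (t / 2)), lt_min hδ₀ (by positivity), fun x z hx hz => ?_⟩
  obtain ⟨hxs, hxd⟩ := hδ x (hx.trans_le (min_le_left _ _))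
  obtain ⟨h1, h2, h3⟩ := mul_norm_sub_le_dist he (htr.trans hr) hε' hk hxs hxd
    (hz.trans_le (min_le_right _ _))
  have hts : Metric.ball (e q) t ⊆ Metric.ball (e q) s := Metric.ball_subset_ball (min_le_right _ _)
  exact ⟨hxs, h1, hts (Metric.mem_ball.2 (by linarith)), hts h2, h3⟩

end Metric

/-! ### Riemannian volume in a chart -/

theorem plane_det_eq (L : Plane →ₗ[ℝ] Plane) :
    LinearMap.det L = L (EuclideanSpace.single 0 1) 0 * L (EuclideanSpace.single 1 1) 1 -
      L (EuclideanSpace.single 1 1) 0 * L (EuclideanSpace.single 0 1) 1 := by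
  rw [← LinearMap.det_toMatrix (EuclideanSpace.basisFun (Fin 2) ℝ).toBasis, Matrix.det_fin_two]
  simp [LinearMap.toMatrix_apply]

/-- The Gram determinant of a quadratic form after a linear change of variables. -/
theorem gram_det_comp {B : Plane → Plane → ℝ} {A A' : Matrix (Fin 2) (Fin 2) ℝ}
    (L : Plane →ₗ[ℝ] Plane) (hB : ∀ v w, B v w = ∑ i, ∑ j, A i j * v i * w j)
    (hA' : ∀ i j, A' i j = B (L (EuclideanSpace.single i 1)) (L (EuclideanSpace.single j 1))) :
    A'.det = LinearMap.det L ^ 2 * A.det := by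
  rw [plane_det_eq, Matrix.det_fin_two, Matrix.det_fin_two]
  simp only [hA', hB, Fin.sum_univ_two]
  ring

theorem measurableSet_preimage_inter {X Y : Type*} [TopologicalSpace X] [MeasurableSpace X]
    [BorelSpace X] [TopologicalSpace Y] [MeasurableSpace Y] [BorelSpace Y] {f : X → Y} {s : Set X}
    {t : Set Y} (hf : ContinuousOn f s) (hs : MeasurableSet s) (ht : MeasurableSet t) :
    MeasurableSet (f ⁻¹' t ∩ s) := by
  have h : Measurable (s.domRestrict f) :=
    (continuousOn_iff_continuous_domRestrict.1 hf).measurable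
  have := (MeasurableEmbedding.subtype_coe hs).measurableSet_image.2 (h ht)
  convert this using 1
  ext y
  simp [and_comm]

section Volume

variable {M : Type*} [MetricSpace M] [ChartedSpace Plane M] [IsManifold 𝓘(ℝ, Plane) ∞ M]
  [RiemannianBundle (fun x : M => TangentSpace 𝓘(ℝ, Plane) x)]
  {e e' : OpenPartialHomeomorph M Plane}

/-- Under a change of charts the determinant of the metric is multiplied by the square of the
Jacobian determinant. -/
theorem det_metricMatrix_transition (he : e ∈ IsManifold.maximalAtlas 𝓘(ℝ, Plane) ∞ M)
    (he' : e' ∈ IsManifold.maximalAtlas 𝓘(ℝ, Plane) ∞ M) {y : Plane} (hy : y ∈ e.target)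
    (hy' : e.symm y ∈ e'.source) :
    DifferentiableAt ℝ (e' ∘ e.symm) y ∧
    (metricMatrix e y).det =
      (fderiv ℝ (e' ∘ e.symm) y).det ^ 2 * (metricMatrix e' (e' (e.symm y))).det := by
  have hd : MDifferentiableAt 𝓘(ℝ, Plane) 𝓘(ℝ, Plane) (e' ∘ e.symm) y :=
    (mdifferentiableAt_chart he' hy').comp y (mdifferentiableAt_symm he hy)
  refine ⟨mdifferentiableAt_iff_differentiableAt.1 hd, ?_⟩
  set D := fderiv ℝ (e' ∘ e.symm) y
  have hz : e' (e.symm y) ∈ e'.target := e'.map_source hy'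
  -- inner products, read in the fixed model plane
  let N : M → Plane → Plane → ℝ := fun x v w =>
    inner ℝ (show TangentSpace 𝓘(ℝ, Plane) x from v) (show TangentSpace 𝓘(ℝ, Plane) x from w)
  have h1 : (e'.symm ∘ (e' ∘ e.symm)) =ᶠ[𝓝 y] e.symm := by
    have : ∀ᶠ z in 𝓝 y, e.symm z ∈ e'.source :=
      (e.continuousAt_symm hy).eventually (e'.open_source.mem_nhds hy')
    filter_upwards [this] with z hz using e'.left_inv hz
  have h2 : mfderiv 𝓘(ℝ, Plane) 𝓘(ℝ, Plane) (e'.symm ∘ (e' ∘ e.symm)) y =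
      (mfderiv 𝓘(ℝ, Plane) 𝓘(ℝ, Plane) e'.symm (e' (e.symm y))).comp
        (mfderiv 𝓘(ℝ, Plane) 𝓘(ℝ, Plane) (e' ∘ e.symm) y) :=
    mfderiv_comp y (mdifferentiableAt_symm he' hz) hd
  rw [h1.mfderiv_eq, mfderiv_eq_fderiv] at h2
  have h3 : ∀ v w, inner ℝ (coordVector e y v) (coordVector e y w) =
      inner ℝ (coordVector e' (e' (e.symm y)) (D v)) (coordVector e' (e' (e.symm y)) (D w)) := by
    intro v w
    have hv : ∀ v, (show Plane from coordVector e y v) =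
        (show Plane from coordVector e' (e' (e.symm y)) (D v)) := fun v =>
      congrArg (fun A => A v) h2
    change N (e.symm y) (coordVector e y v) (coordVector e y w) =
      N (e'.symm (e' (e.symm y))) (coordVector e' (e' (e.symm y)) (D v))
        (coordVector e' (e' (e.symm y)) (D w))
    rw [e'.left_inv hy']
    exact congrArg₂ (N (e.symm y)) (hv v) (hv w)
  have := gram_det_comp (A := metricMatrix e' (e' (e.symm y))) (A' := metricMatrix e y)
    (B := fun v w => inner ℝ (coordVector e' (e' (e.symm y)) v) (coordVector e' (e' (e.symm y)) w))
    D.toLinearMap (fun v w => inner_coordVector e' _ v w) (fun i j => by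
      simp only [metricMatrix, Matrix.of_apply, h3]; rfl)
  exact this

variable [MeasurableSpace M] [BorelSpace M]

theorem measurableSet_chart_preimage (e : OpenPartialHomeomorph M Plane) {t : Set M}
    (ht : MeasurableSet t) : MeasurableSet (e.symm ⁻¹' t ∩ e.target) :=
  measurableSet_preimage_inter e.continuousOn_symm e.open_target.measurableSet ht

theorem aemeasurable_symm (e : OpenPartialHomeomorph M Plane) :
    AEMeasurable e.symm (volume.restrict e.target) :=
  e.continuousOn_symm.aemeasurable e.open_target.measurableSet

theorem aemeasurable_symm_withDensity (e : OpenPartialHomeomorph M Plane) (f : Plane → ℝ≥0∞) :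
    AEMeasurable e.symm ((volume.restrict e.target).withDensity f) :=
  (aemeasurable_symm e).mono_ac (withDensity_absolutelyContinuous _ _)

theorem chartVolume_apply (e : OpenPartialHomeomorph M Plane) {t : Set M} (ht : MeasurableSet t) :
    chartVolume e t = ∫⁻ y in e.symm ⁻¹' t ∩ e.target,
      ENNReal.ofReal (Real.sqrt (metricMatrix e y).det) := by
  rw [chartVolume, Measure.map_apply_of_aemeasurable (aemeasurable_symm_withDensity e _) ht,
    withDensity_apply', Measure.restrict_restrict' e.open_target.measurableSet]

/-- The measure of a chart is carried by the domain of the chart. -/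
theorem chartVolume_inter_source (e : OpenPartialHomeomorph M Plane) {t : Set M}
    (ht : MeasurableSet t) : chartVolume e (t ∩ e.source) = chartVolume e t := by
  rw [chartVolume_apply e ht, chartVolume_apply e (ht.inter e.open_source.measurableSet)]
  congr 2
  ext y
  simp only [mem_inter_iff, mem_preimage]
  exact ⟨fun h => ⟨h.1.1, h.2⟩, fun h => ⟨⟨h.1, e.map_target h.2⟩, h.2⟩⟩

/-- The volume of a set lying in the domains of two charts does not depend on the chart. -/
theorem chartVolume_congr (he : e ∈ IsManifold.maximalAtlas 𝓘(ℝ, Plane) ∞ M)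
    (he' : e' ∈ IsManifold.maximalAtlas 𝓘(ℝ, Plane) ∞ M) {t : Set M} (ht : MeasurableSet t)
    (hte : t ⊆ e.source) (hte' : t ⊆ e'.source) : chartVolume e t = chartVolume e' t := by
  rw [chartVolume_apply e ht, chartVolume_apply e' ht]
  set T := e.symm ⁻¹' t ∩ e.target
  have hT : MeasurableSet T := measurableSet_chart_preimage e ht
  have himage : e'.symm ⁻¹' t ∩ e'.target = (e' ∘ e.symm) '' T := by
    ext z
    constructor
    · rintro ⟨hz1, hz2⟩
      refine ⟨e (e'.symm z), ⟨?_, e.map_source (hte hz1)⟩, ?_⟩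
      · rwa [mem_preimage, e.left_inv (hte hz1)]
      · simp [e.left_inv (hte hz1), e'.right_inv hz2]
    · rintro ⟨y, ⟨hy1, hy2⟩, rfl⟩
      refine ⟨?_, e'.map_source (hte' hy1)⟩
      simpa [e'.left_inv (hte' hy1)] using hy1
  have hinj : InjOn (e' ∘ e.symm) T :=
    e'.injOn.comp (e.symm.injOn.mono inter_subset_right) fun y hy => hte' hy.1
  rw [himage, lintegral_image_eq_lintegral_abs_det_fderiv_mul volume hT
    (fun y hy => (det_metricMatrix_transition he he' hy.2
      (hte' hy.1)).1.hasFDerivAt.hasFDerivWithinAt) hinj]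
  refine setLIntegral_congr_fun hT fun y hy => ?_
  have := (det_metricMatrix_transition he he' hy.2 (hte' hy.1)).2
  simp only [Function.comp]
  rw [this, Real.sqrt_mul (sq_nonneg _), Real.sqrt_sq_eq_abs, ENNReal.ofReal_mul (abs_nonneg _)]

variable [CompactSpace M] [Nonempty M]

/-- Inside the domain of a chart the Riemannian volume is the measure of that chart. -/
theorem riemannianVolume_apply (he : e ∈ IsManifold.maximalAtlas 𝓘(ℝ, Plane) ∞ M) {t : Set M}
    (ht : MeasurableSet t) (hte : t ⊆ e.source) : riemannianVolume M t = chartVolume e t := by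
  rw [riemannianVolume, Measure.sum_apply _ ht]
  set U : ℕ → Set M := fun k => (chartAt Plane (coverCenter M k)).source
  have hU : ∀ n, MeasurableSet (U n) := fun n => (chartAt Plane _).open_source.measurableSet
  have hD : ∀ n, MeasurableSet (disjointed U n) := fun n => MeasurableSet.disjointed hU n
  have huniv : (⋃ n, disjointed U n) = univ := by
    rw [iUnion_disjointed]; exact Classical.choose_spec (exists_chart_cover M)
  have h1 : ∀ n, (chartVolume (chartAt Plane (coverCenter M n))).restrict (disjointed U n) t =
      chartVolume e (t ∩ disjointed U n) := by
    intro n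
    rw [Measure.restrict_apply ht]
    exact chartVolume_congr (IsManifold.chart_mem_maximalAtlas _) he (ht.inter (hD n))
      (inter_subset_right.trans (disjointed_subset U n)) (inter_subset_left.trans hte)
  simp only [h1]
  rw [← measure_iUnion]
  · rw [← inter_iUnion, huniv, inter_univ]
  · exact fun i j hij => (disjoint_disjointed U hij).mono inter_subset_right inter_subset_right
  · exact fun n => ht.inter (hD n)

/-- In any smooth chart the Riemannian volume is `√(det g_{ij}) dy`. -/
theorem restrict_riemannianVolume (he : e ∈ IsManifold.maximalAtlas 𝓘(ℝ, Plane) ∞ M) :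
    (riemannianVolume M).restrict e.source = chartVolume e := by
  ext t ht
  rw [Measure.restrict_apply ht, riemannianVolume_apply he (ht.inter e.open_source.measurableSet)
    inter_subset_right, chartVolume_inter_source e ht]

/-- Sets that are null in coordinates are null in the domain of the chart. -/
theorem ae_chart_of_ae (he : e ∈ IsManifold.maximalAtlas 𝓘(ℝ, Plane) ∞ M) {P : M → Prop}
    (h : ∀ᵐ y ∂(volume.restrict e.target), P (e.symm y)) :
    ∀ᵐ x ∂((riemannianVolume M).restrict e.source), P x := by
  obtain ⟨N, hN, hNm, hN0⟩ := exists_measurable_superset_of_null (ae_iff.1 h)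
  have hsub : {x | ¬ P x} ∩ e.source ⊆ e.symm.symm ⁻¹' N ∩ e.symm.target := by
    rintro x ⟨hx1, hx2⟩
    refine ⟨hN ?_, hx2⟩
    simpa [e.left_inv hx2] using hx1
  have hmeas : MeasurableSet (e.symm.symm ⁻¹' N ∩ e.symm.target) :=
    measurableSet_preimage_inter e.continuousOn e.open_source.measurableSet hNm
  rw [ae_iff, Measure.restrict_apply₀']
  · refine measure_mono_null hsub ?_
    rw [riemannianVolume_apply he hmeas inter_subset_right, chartVolume_apply e hmeas]
    apply setLIntegral_measure_zero
    rw [Measure.restrict_apply hNm] at hN0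
    refine measure_mono_null ?_ hN0
    rintro y ⟨⟨hy1, hy2⟩, hy3⟩
    refine ⟨?_, hy3⟩
    simpa [e.right_inv hy3] using hy1
  · exact e.open_source.measurableSet.nullMeasurableSet

theorem aemeasurable_density
    [IsContMDiffRiemannianBundle 𝓘(ℝ, Plane) ∞ Plane (fun x : M => TangentSpace 𝓘(ℝ, Plane) x)]
    (he : e ∈ IsManifold.maximalAtlas 𝓘(ℝ, Plane) ∞ M) :
    AEMeasurable (fun y => ENNReal.ofReal (Real.sqrt (metricMatrix e y).det))
      (volume.restrict e.target) :=
  ((contDiffOn_det_metricMatrix he).continuousOn.sqrt.aemeasurable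
    e.open_target.measurableSet).ennreal_ofReal

variable [IsContMDiffRiemannianBundle 𝓘(ℝ, Plane) ∞ Plane
    (fun x : M => TangentSpace 𝓘(ℝ, Plane) x)]

theorem volume_absolutelyContinuous_withDensity
    (he : e ∈ IsManifold.maximalAtlas 𝓘(ℝ, Plane) ∞ M) :
    volume.restrict e.target ≪ (volume.restrict e.target).withDensity
      fun y => ENNReal.ofReal (Real.sqrt (metricMatrix e y).det) := by
  apply withDensity_absolutelyContinuous' (aemeasurable_density he)
  filter_upwards [ae_restrict_mem e.open_target.measurableSet] with y hy
  rw [ne_eq, ENNReal.ofReal_eq_zero, not_le]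
  exact Real.sqrt_pos.2 (det_metricMatrix_pos he hy)

/-- Null sets in the domain of a chart are null in coordinates, because the density `√(det g)` does
not vanish. -/
theorem ae_target_of_ae (he : e ∈ IsManifold.maximalAtlas 𝓘(ℝ, Plane) ∞ M) {P : M → Prop}
    (h : ∀ᵐ x ∂((riemannianVolume M).restrict e.source), P x) :
    ∀ᵐ y ∂(volume.restrict e.target), P (e.symm y) := by
  rw [restrict_riemannianVolume he, chartVolume] at h
  exact (volume_absolutelyContinuous_withDensity he).ae_le
    (ae_of_ae_map (aemeasurable_symm_withDensity e _) h)

theorem setLIntegral_chart (he : e ∈ IsManifold.maximalAtlas 𝓘(ℝ, Plane) ∞ M) {f : M → ℝ≥0∞}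
    (hf : AEMeasurable f ((riemannianVolume M).restrict e.source)) :
    ∫⁻ x in e.source, f x ∂(riemannianVolume M) =
      ∫⁻ y in e.target, ENNReal.ofReal (Real.sqrt (metricMatrix e y).det) * f (e.symm y) := by
  have hf' := hf
  rw [restrict_riemannianVolume he, chartVolume] at hf ⊢
  rw [lintegral_map' hf (aemeasurable_symm_withDensity e _),
    lintegral_withDensity_eq_lintegral_mul₀ (aemeasurable_density he)]
  · rfl
  · exact (hf'.measurable_mk.comp_aemeasurable (aemeasurable_symm e)).congr
      (ae_target_of_ae he hf'.ae_eq_mk.symm)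

theorem setIntegral_chart (he : e ∈ IsManifold.maximalAtlas 𝓘(ℝ, Plane) ∞ M) {f : M → ℝ}
    (hf : AEStronglyMeasurable f ((riemannianVolume M).restrict e.source)) :
    ∫ x in e.source, f x ∂(riemannianVolume M) =
      ∫ y in e.target, Real.sqrt (metricMatrix e y).det * f (e.symm y) := by
  rw [restrict_riemannianVolume he, chartVolume] at hf ⊢
  rw [integral_map (aemeasurable_symm_withDensity e _) hf,
    integral_withDensity_eq_integral_toReal_smul₀ (aemeasurable_density he)
      (Eventually.of_forall fun y => ENNReal.ofReal_lt_top)]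
  refine integral_congr_ae (Eventually.of_forall fun y => ?_)
  simp [ENNReal.toReal_ofReal (Real.sqrt_nonneg _)]

theorem integrableOn_chart (he : e ∈ IsManifold.maximalAtlas 𝓘(ℝ, Plane) ∞ M) {f : M → ℝ}
    (hf : IntegrableOn f e.source (riemannianVolume M)) :
    IntegrableOn (fun y => Real.sqrt (metricMatrix e y).det * f (e.symm y)) e.target := by
  rw [IntegrableOn, restrict_riemannianVolume he, chartVolume] at hf
  have h := hf.comp_aemeasurable (aemeasurable_symm_withDensity e _)
  rw [integrable_withDensity_iff_integrable_smul₀' (aemeasurable_density he)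
      (Eventually.of_forall fun y => ENNReal.ofReal_lt_top)] at h
  refine h.congr (Eventually.of_forall fun y => ?_)
  simp [ENNReal.toReal_ofReal (Real.sqrt_nonneg _)]

end Volume

/-! ### Integrals over small balls -/

/-- On a compact space, a property which holds locally at a small enough scale holds everywhere at
one common scale. -/
theorem exists_uniform_scale {M : Type*} [MetricSpace M] [CompactSpace M] {P : ℝ → M → Prop}
    (hmono : ∀ δ δ' x, 0 < δ' → δ' ≤ δ → P δ x → P δ' x)
    (hloc : ∀ q, ∃ δ > 0, ∀ x, dist x q < δ → P δ x) : ∃ δ > 0, ∀ x, P δ x := by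
  have : ∃ δ > 0, ∀ x ∈ (univ : Set M), P δ x := by
    refine isCompact_univ.induction_on (p := fun s => ∃ δ > 0, ∀ x ∈ s, P δ x) ⟨1, one_pos, by simp⟩
      ?_ ?_ ?_
    · rintro s t hst ⟨δ, hδ, h⟩
      exact ⟨δ, hδ, fun x hx => h x (hst hx)⟩
    · rintro s t ⟨δ, hδ, h⟩ ⟨δ', hδ', h'⟩
      have hm := lt_min hδ hδ'
      refine ⟨min δ δ', hm, fun x hx => ?_⟩
      rcases hx with hx | hx
      · exact hmono _ _ x hm (min_le_left _ _) (h x hx)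
      · exact hmono _ _ x hm (min_le_right _ _) (h' x hx)
    · intro q _
      obtain ⟨δ, hδ, h⟩ := hloc q
      exact ⟨Metric.ball q δ, mem_nhdsWithin_of_mem_nhds (Metric.ball_mem_nhds q hδ), δ, hδ, h⟩
  simpa using this

theorem plane_lintegral_comp_smul_sub {f : Plane → ℝ≥0∞} (hf : Measurable f) {k : ℝ} (hk : 0 < k)
    (c : Plane) :
    ∫⁻ y, f (k • (y - c)) = ENNReal.ofReal (k ^ 2)⁻¹ * ∫⁻ v, f v := by
  rw [lintegral_sub_right_eq_self (fun y => f (k • y)) c,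
    ← lintegral_map hf (measurable_const_smul k), Measure.map_addHaar_smul volume hk.ne',
    lintegral_smul_measure]
  simp [abs_of_nonneg (sq_nonneg k)]

theorem plane_lintegral_rpow_norm_lt_top :
    ∫⁻ v in Metric.ball (0 : Plane) 1, ENNReal.ofReal (‖v‖ ^ (-(3 / 2) : ℝ)) < ⊤ := by
  have h : IntegrableOn (fun v : Plane => ‖v‖ ^ (-(3 / 2) : ℝ)) (Metric.ball 0 1) := by
    rw [integrableOn_fun_norm_addHaar volume (f := fun t : ℝ => t ^ (-(3 / 2) : ℝ))]
    simp only [finrank_euclideanSpace, Fintype.card_fin, Nat.add_one_sub_one, pow_one, smul_eq_mul]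
    refine ((intervalIntegral.integrableOn_Ioo_rpow_iff (s := -(1 / 2)) one_pos).2 (by norm_num)).congr_fun
      (fun t ht => ?_) measurableSet_Ioo
    conv_rhs => rw [← Real.rpow_one t, ← Real.rpow_mul ht.1.le, ← Real.rpow_add ht.1]
    norm_num
  exact (hasFiniteIntegral_iff_ofReal (Eventually.of_forall fun v => by positivity)).1 h.2

/-- The truncated Dirichlet integral of `log ‖v‖` over a disc. -/
theorem plane_lintegral_truncated_inv_sq_le {lam s : ℝ} (hlam : 0 < lam) (hs : lam⁻¹ ≤ s) :
    ∫⁻ v in Metric.ball (0 : Plane) s, ENNReal.ofReal ((max lam⁻¹ ‖v‖ ^ 2)⁻¹) ≤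
      ENNReal.ofReal (Real.pi + 2 * Real.pi * Real.log (s * lam)) := by
  have hl : 0 < lam⁻¹ := inv_pos.2 hlam
  have hs0 : 0 < s := hl.trans_le hs
  let f : ℝ → ℝ := fun t => (max lam⁻¹ t ^ 2)⁻¹
  have hfc : Continuous f := by
    refine Continuous.inv₀ (by fun_prop) fun t => ?_
    have : 0 < max lam⁻¹ t := lt_max_of_lt_left hl
    positivity
  have hint : IntegrableOn (fun v : Plane => f ‖v‖) (Metric.ball 0 s) :=
    ((hfc.comp continuous_norm).continuousOn.integrableOn_compact
      (isCompact_closedBall (0 : Plane) s)).mono_set Metric.ball_subset_closedBall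
  have h0 : ∀ t, 0 ≤ f t := fun t => by positivity
  rw [← ofReal_integral_eq_lintegral_ofReal hint (Eventually.of_forall fun v => h0 _)]
  apply ENNReal.ofReal_le_ofReal
  have h1 : ∫ v in Metric.ball (0 : Plane) s, f ‖v‖ =
      ∫ v : Plane, (Iio s).indicator f ‖v‖ := by
    rw [← integral_indicator Metric.isOpen_ball.measurableSet]
    refine integral_congr_ae (Eventually.of_forall fun v => ?_)
    simp [indicator]
  have h2 : ∫ y in Ioi (0 : ℝ), y ^ (Module.finrank ℝ Plane - 1) • (Iio s).indicator f y =
      ∫ y in (0 : ℝ)..s, y * f y := by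
    rw [intervalIntegral.integral_of_le hs0.le, ← integral_Ioc_eq_integral_Ioo.symm,
      ← integral_indicator measurableSet_Ioi, ← integral_indicator measurableSet_Ioo]
    refine integral_congr_ae (Eventually.of_forall fun y => ?_)
    simp only [indicator, finrank_euclideanSpace, Fintype.card_fin, mem_Ioi, mem_Iio, mem_Ioo]
    by_cases h : 0 < y <;> by_cases h' : y < s <;> simp [h, h']
  have h3 : ∫ y in (0 : ℝ)..lam⁻¹, y * f y = 1 / 2 := by
    have : ∀ y ∈ uIcc 0 lam⁻¹, y * f y = lam ^ 2 * y := by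
      intro y hy
      rw [uIcc_of_le hl.le] at hy
      simp only [f, max_eq_left hy.2]
      field_simp
    rw [intervalIntegral.integral_congr this, intervalIntegral.integral_const_mul, integral_id]
    field_simp
    ring
  have h4 : ∫ y in lam⁻¹..s, y * f y = Real.log (s * lam) := by
    have : ∀ y ∈ uIcc lam⁻¹ s, y * f y = y⁻¹ := by
      intro y hy
      rw [uIcc_of_le hs] at hy
      have : 0 < y := hl.trans_le hy.1
      simp only [f, max_eq_right hy.1]
      field_simp
    rw [intervalIntegral.integral_congr this, integral_inv_of_pos hl hs0, div_inv_eq_mul]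
  have h5 : ∫ y in (0 : ℝ)..s, y * f y = 1 / 2 + Real.log (s * lam) := by
    rw [← h3, ← h4, intervalIntegral.integral_add_adjacent_intervals] <;>
    exact (continuous_id.mul hfc).intervalIntegrable _ _
  have h6 : ∫ v in Metric.ball (0 : Plane) s, f ‖v‖ =
      Real.pi + 2 * Real.pi * Real.log (s * lam) := by
    rw [h1, integral_fun_norm_addHaar volume, h2, h5]
    simp [Measure.real, ENNReal.toReal_ofReal Real.pi_pos.le]
    ring
  exact h6.le

section Balls

variable {M : Type*} [MetricSpace M] [ChartedSpace Plane M] [IsManifold 𝓘(ℝ, Plane) ∞ M]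
  [RiemannianBundle (fun x : M => TangentSpace 𝓘(ℝ, Plane) x)]
  [IsContMDiffRiemannianBundle 𝓘(ℝ, Plane) ∞ Plane (fun x : M => TangentSpace 𝓘(ℝ, Plane) x)]
  [IsRiemannianManifold 𝓘(ℝ, Plane) M]
  [CompactSpace M] [Nonempty M] [MeasurableSpace M] [BorelSpace M]

/-- Integrals of decreasing functions of the distance over small balls are almost bounded by the
corresponding integrals in the plane. -/
theorem exists_lintegral_ball_le (ε : ℝ) (hε : 0 < ε) :
    ∃ δ > 0, ∀ x : M, ∀ s ≤ δ, ∀ f : ℝ → ℝ≥0∞, Measurable f → AntitoneOn f (Ioi 0) →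
      ∫⁻ z in Metric.ball x s, f (dist z x) ∂(riemannianVolume M) ≤
        ENNReal.ofReal (1 + ε) * ∫⁻ v in Metric.ball (0 : Plane) s, f ‖v‖ := by
  apply exists_uniform_scale (M := M) (P := fun δ x => ∀ s ≤ δ, ∀ f : ℝ → ℝ≥0∞, Measurable f →
      AntitoneOn f (Ioi 0) → ∫⁻ z in Metric.ball x s, f (dist z x) ∂(riemannianVolume M) ≤
        ENNReal.ofReal (1 + ε) * ∫⁻ v in Metric.ball (0 : Plane) s, f ‖v‖)
  · exact fun δ δ' x _ hle h s hs => h s (hs.trans hle)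
  intro q
  -- `t` is chosen such that `(1 + t) ^ 2 / (1 - t) ^ 2 ≤ 1 + ε`
  set t := min ε 1 / 16 with ht
  have ht0 : 0 < t := by positivity
  have ht1 : t ≤ 1 / 16 := by rw [ht]; linarith [min_le_right ε 1]
  have htε : 16 * t ≤ ε := by rw [ht]; linarith [min_le_left ε 1]
  obtain ⟨e, he, hq, r, hr0, hr, hiso, -, hδ⟩ :=
    exists_comparison_chart q ht0 (by linarith : t < 1)
  obtain ⟨δ, hδ0, hδ⟩ := hδ r hr0
  refine ⟨δ, hδ0, fun x hx s hs f hf hanti => ?_⟩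
  have hk : 0 < 1 - t := by linarith
  have hz : ∀ z ∈ Metric.ball x s, z ∈ e.source ∧ e z ∈ Metric.ball (e q) r ∧
      (1 - t) * ‖e z - e x‖ ≤ dist z x := by
    intro z hz
    rw [Metric.mem_ball, dist_comm] at hz
    obtain ⟨-, h1, -, h2, h3⟩ := hδ x z hx (hz.trans_le hs)
    rw [norm_sub_rev, dist_comm z x]
    exact ⟨h1, h2, h3⟩
  have hball : MeasurableSet (Metric.ball x s) := Metric.isOpen_ball.measurableSet
  set g : Plane → ℝ≥0∞ := (Metric.ball 0 s).indicator fun v => f ‖v‖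
  have hg : Measurable g := (hf.comp measurable_norm).indicator Metric.isOpen_ball.measurableSet
  have hF : Measurable fun z => f (dist z x) := hf.comp (measurable_id.dist measurable_const)
  calc ∫⁻ z in Metric.ball x s, f (dist z x) ∂(riemannianVolume M)
      = ∫⁻ z in e.source, (Metric.ball x s).indicator (fun z => f (dist z x)) z
          ∂(riemannianVolume M) := by
        rw [lintegral_indicator hball, Measure.restrict_restrict hball,
          inter_eq_left.2 fun z h => (hz z h).1]
    _ = ∫⁻ y in e.target, ENNReal.ofReal (Real.sqrt (metricMatrix e y).det) *
          (Metric.ball x s).indicator (fun z => f (dist z x)) (e.symm y) :=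
        setLIntegral_chart he (hF.indicator hball).aemeasurable
    _ ≤ ∫⁻ y in e.target, ENNReal.ofReal ((1 + t) ^ 2) * g ((1 - t) • (y - e x)) := by
        have hne : ∀ᵐ y ∂(volume.restrict e.target), y ≠ e x :=
          ae_restrict_of_ae (Measure.ae_ne volume (e x))
        refine lintegral_mono_ae ?_
        filter_upwards [hne, ae_restrict_mem e.open_target.measurableSet] with y hy hyt
        by_cases hmem : e.symm y ∈ Metric.ball x s
        swap
        · simp [indicator_of_notMem hmem]
        obtain ⟨-, h2, h3⟩ := hz _ hmem
        rw [e.right_inv hyt] at h2 h3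
        rw [indicator_of_mem hmem]
        have hpos : 0 < (1 - t) * ‖y - e x‖ :=
          mul_pos hk (norm_pos_iff.2 (sub_ne_zero.2 hy))
        have hnorm : ‖(1 - t) • (y - e x)‖ = (1 - t) * ‖y - e x‖ := by
          rw [norm_smul, Real.norm_of_nonneg hk.le]
        have hgmem : (1 - t) • (y - e x) ∈ Metric.ball (0 : Plane) s := by
          rw [mem_ball_zero_iff, hnorm]
          exact h3.trans_lt hmem
        have hgv : g ((1 - t) • (y - e x)) = f ((1 - t) * ‖y - e x‖) := by
          rw [← hnorm]
          exact indicator_of_mem hgmem _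
        rw [hgv]
        gcongr
        · rw [← Real.sqrt_sq (sq_nonneg (1 + t))]
          apply Real.sqrt_le_sqrt
          calc _ ≤ (1 + t) ^ 4 := det_metricMatrix_le_pow_four fun v => (hiso y h2 v).2
            _ = ((1 + t) ^ 2) ^ 2 := by ring
        · exact hanti hpos (hpos.trans_le h3) h3
    _ ≤ ∫⁻ y, ENNReal.ofReal ((1 + t) ^ 2) * g ((1 - t) • (y - e x)) :=
        setLIntegral_le_lintegral _ _
    _ = ENNReal.ofReal ((1 + t) ^ 2) * (ENNReal.ofReal ((1 - t) ^ 2)⁻¹ * ∫⁻ v, g v) := by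
        rw [lintegral_const_mul' _ _ ENNReal.ofReal_ne_top, plane_lintegral_comp_smul_sub hg hk]
    _ ≤ ENNReal.ofReal (1 + ε) * ∫⁻ v in Metric.ball (0 : Plane) s, f ‖v‖ := by
        rw [← mul_assoc, ← ENNReal.ofReal_mul (sq_nonneg _),
          lintegral_indicator Metric.isOpen_ball.measurableSet]
        gcongr
        rw [← div_eq_mul_inv, div_le_iff₀ (by positivity)]
        nlinarith [mul_nonneg ht0.le (mul_nonneg ht0.le ht0.le), mul_nonneg (sub_nonneg.2 htε)
          (sq_nonneg (1 - t))]

theorem exists_measure_ball_le :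
    ∃ δ > 0, ∀ x : M, ∀ s ≤ δ,
      riemannianVolume M (Metric.ball x s) ≤ ENNReal.ofReal (2 * Real.pi * s ^ 2) := by
  obtain ⟨δ, hδ, h⟩ := exists_lintegral_ball_le (M := M) 1 one_pos
  refine ⟨δ, hδ, fun x s hs => ?_⟩
  have := h x s hs (fun _ => 1) measurable_const (fun _ _ _ _ _ => le_rfl)
  simp only [setLIntegral_const, one_mul] at this
  rcases le_or_gt s 0 with h0 | h0
  · simp [Metric.ball_eq_empty.2 h0]
  · refine this.trans_eq ?_
    rw [EuclideanSpace.volume_ball_fin_two, ← ENNReal.ofReal_pow h0.le,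
      ← ENNReal.ofReal_mul (by positivity),
      ← ENNReal.ofReal_mul (by norm_num)]
    congr 1
    ring

instance isFiniteMeasure_riemannianVolume : IsFiniteMeasure (riemannianVolume M) := by
  obtain ⟨δ, hδ, h⟩ := exists_measure_ball_le (M := M)
  refine ⟨isCompact_univ.measure_lt_top_of_nhdsWithin fun x _ => ⟨Metric.ball x δ,
    mem_nhdsWithin_of_mem_nhds (Metric.ball_mem_nhds x hδ), (h x δ le_rfl).trans_lt ?_⟩⟩
  exact ENNReal.ofReal_lt_top

/-- Small balls have area at least of the order of the square of the radius. The constant is that of a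
chart with distortion at most `2`. -/
theorem exists_le_measure_ball :
    ∃ δ > 0, ∀ x : M, ∀ s, 0 < s → s ≤ δ →
      ENNReal.ofReal (s ^ 2 / 16) ≤ riemannianVolume M (Metric.ball x s) := by
  apply exists_uniform_scale (M := M) (P := fun δ x => ∀ s, 0 < s → s ≤ δ →
      ENNReal.ofReal (s ^ 2 / 16) ≤ riemannianVolume M (Metric.ball x s))
  · exact fun δ δ' x _ hle h s h0 hs => h s h0 (hs.trans hle)
  intro q
  obtain ⟨e, he, hq, r, hr0, hr, hiso, hdist, hδ⟩ :=
    exists_comparison_chart q (by norm_num : (0 : ℝ) < 1 / 2) (by norm_num)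
  obtain ⟨δ, hδ0, hδ⟩ := hδ (r / 2) (by positivity)
  refine ⟨min δ r, lt_min hδ0 hr0, fun x hx s h0 hs => ?_⟩
  obtain ⟨hxs, -, hxq, -, -⟩ := hδ x x (hx.trans_le (min_le_left _ _)) (by simpa using hδ0)
  have hsr := hs.trans (min_le_right _ _)
  have hsub : Metric.ball (e x) (s / 2) ⊆ Metric.ball (e q) r := by
    intro y hy
    rw [Metric.mem_ball] at hy hxq ⊢
    linarith [dist_triangle y (e x) (e q)]
  have hxq' : e x ∈ Metric.ball (e q) r := Metric.ball_subset_ball (by linarith) hxq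
  have hsub2 : Metric.ball (e x) (s / 2) ⊆ e.symm ⁻¹' (Metric.ball x s ∩ e.source) ∩ e.target := by
    intro y hy
    refine ⟨⟨?_, e.map_target (hr (hsub hy))⟩, hr (hsub hy)⟩
    have := hdist y (hsub hy) (e x) hxq'
    rw [e.left_inv hxs, ← dist_eq_norm] at this
    rw [Metric.mem_ball] at hy ⊢
    linarith
  have hm : MeasurableSet (Metric.ball x s ∩ e.source) :=
    Metric.isOpen_ball.measurableSet.inter e.open_source.measurableSet
  calc ENNReal.ofReal (s ^ 2 / 16)
      ≤ ENNReal.ofReal (1 / 4) * volume (Metric.ball (e x) (s / 2)) := by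
        rw [EuclideanSpace.volume_ball_fin_two, ← ENNReal.ofReal_pow (by positivity),
          ← ENNReal.ofReal_mul (by positivity), ← ENNReal.ofReal_mul (by norm_num)]
        apply ENNReal.ofReal_le_ofReal
        nlinarith [Real.pi_gt_three, sq_nonneg s]
    _ = ∫⁻ _ in Metric.ball (e x) (s / 2), ENNReal.ofReal (1 / 4) := by
        rw [setLIntegral_const]
    _ ≤ ∫⁻ y in Metric.ball (e x) (s / 2), ENNReal.ofReal (Real.sqrt (metricMatrix e y).det) := by
        refine setLIntegral_mono' Metric.isOpen_ball.measurableSet fun y hy => ?_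
        apply ENNReal.ofReal_le_ofReal
        apply Real.le_sqrt_of_sq_le
        have := pow_four_le_det_metricMatrix (e := e) (y := y) (by norm_num : (0 : ℝ) ≤ 1 - 1 / 2)
          fun v => (hiso y (hsub hy) v).1
        norm_num at this ⊢
        exact this
    _ ≤ ∫⁻ y in e.symm ⁻¹' (Metric.ball x s ∩ e.source) ∩ e.target,
          ENNReal.ofReal (Real.sqrt (metricMatrix e y).det) := lintegral_mono_set hsub2
    _ = riemannianVolume M (Metric.ball x s ∩ e.source) := by
        rw [riemannianVolume_apply he hm inter_subset_right, chartVolume_apply e hm]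
    _ ≤ riemannianVolume M (Metric.ball x s) := measure_mono inter_subset_left

theorem area_pos : 0 < area M := by
  obtain ⟨δ, hδ, h⟩ := exists_le_measure_ball (M := M)
  obtain ⟨x⟩ := (inferInstance : Nonempty M)
  have h1 : 0 < riemannianVolume M univ :=
    ((ENNReal.ofReal_pos.2 (by positivity)).trans_le (h x δ hδ le_rfl)).trans_le
      (measure_mono (subset_univ _))
  exact ENNReal.toReal_pos h1.ne' (measure_ne_top _ _)

theorem ae_ne_riemannianVolume (p : M) : ∀ᵐ x ∂(riemannianVolume M), x ≠ p := by
  obtain ⟨δ, hδ, h⟩ := exists_measure_ball_le (M := M)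
  rw [ae_iff]
  have h1 : Tendsto (fun s : ℝ => ENNReal.ofReal (2 * Real.pi * s ^ 2)) (𝓝[>] 0) (𝓝 0) := by
    have : Tendsto (fun s : ℝ => ENNReal.ofReal (2 * Real.pi * s ^ 2)) (𝓝 0)
        (𝓝 (ENNReal.ofReal (2 * Real.pi * 0 ^ 2))) :=
      (ENNReal.continuous_ofReal.comp (by fun_prop : Continuous fun s : ℝ => 2 * Real.pi * s ^ 2)).tendsto 0
    simpa using this.mono_left nhdsWithin_le_nhds
  refine le_antisymm (ge_of_tendsto h1 ?_) zero_le
  filter_upwards [Ioc_mem_nhdsGT hδ] with s hs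
  refine (measure_mono ?_).trans (h p s hs.2)
  intro x hx
  have hx : x = p := by simpa using hx
  simpa [hx] using hs.1

/-- The kernel `d(z, x)^{-3/2}` is integrable, uniformly in `x`. -/
theorem exists_lintegral_rpow_dist_le :
    ∃ C : ℝ≥0∞, C ≠ ⊤ ∧ ∀ x : M,
      ∫⁻ z, ENNReal.ofReal (dist z x ^ (-(3 / 2) : ℝ)) ∂(riemannianVolume M) ≤ C := by
  obtain ⟨δ₀, hδ₀, h⟩ := exists_lintegral_ball_le (M := M) 1 one_pos
  set δ := min δ₀ 1
  have hδ : 0 < δ := lt_min hδ₀ one_pos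
  refine ⟨ENNReal.ofReal (1 + 1) *
    (∫⁻ v in Metric.ball (0 : Plane) 1, ENNReal.ofReal (‖v‖ ^ (-(3 / 2) : ℝ))) +
    ENNReal.ofReal (δ ^ (-(3 / 2) : ℝ)) * riemannianVolume M univ, ?_, fun x => ?_⟩
  · exact ENNReal.add_ne_top.2 ⟨ENNReal.mul_ne_top ENNReal.ofReal_ne_top
      plane_lintegral_rpow_norm_lt_top.ne, ENNReal.mul_ne_top ENNReal.ofReal_ne_top
      (measure_ne_top _ _)⟩
  rw [← lintegral_add_compl _ (Metric.isOpen_ball (x := x) (ε := δ)).measurableSet]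
  refine add_le_add ?_ ?_
  · refine (h x δ (min_le_left _ _) (fun t => ENNReal.ofReal (t ^ (-(3 / 2) : ℝ))) (by fun_prop)
      ?_).trans ?_
    · intro a ha b hb hab
      exact ENNReal.ofReal_le_ofReal (Real.rpow_le_rpow_of_nonpos ha hab (by norm_num))
    · gcongr
      exact min_le_right _ _
  · calc _ ≤ ∫⁻ _ in (Metric.ball x δ)ᶜ, ENNReal.ofReal (δ ^ (-(3 / 2) : ℝ)) ∂riemannianVolume M := by
          refine setLIntegral_mono' Metric.isOpen_ball.measurableSet.compl fun z hz => ?_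
          have hz : δ ≤ dist z x := by simpa using hz
          exact ENNReal.ofReal_le_ofReal (Real.rpow_le_rpow_of_nonpos hδ hz (by norm_num))
      _ ≤ _ := by
          rw [setLIntegral_const]
          gcongr
          exact subset_univ _

/-- The total mass of the kernel `min(λ², d(z, x)⁻²)` grows like `2π log λ`, uniformly in `x`. -/
theorem exists_lintegral_truncated_inv_sq_le (ε : ℝ) (hε : 0 < ε) :
    ∃ C Λ : ℝ, 1 ≤ Λ ∧ ∀ lam ≥ Λ, ∀ x : M,
      ∫⁻ z, ENNReal.ofReal ((max lam⁻¹ (dist z x) ^ 2)⁻¹) ∂(riemannianVolume M) ≤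
        ENNReal.ofReal ((1 + ε) * (2 * Real.pi) * Real.log lam + C) := by
  obtain ⟨δ₀, hδ₀, h⟩ := exists_lintegral_ball_le (M := M) ε hε
  set δ := min δ₀ 1
  have hδ : 0 < δ := lt_min hδ₀ one_pos
  have hδ1 : δ ≤ 1 := min_le_right _ _
  have hδi : 1 ≤ δ⁻¹ := (one_le_inv₀ hδ).2 hδ1
  have hA : 0 ≤ (δ ^ 2)⁻¹ * area M := by
    have := area_pos (M := M)
    positivity
  refine ⟨(1 + ε) * Real.pi + (δ ^ 2)⁻¹ * area M, δ⁻¹, hδi, fun lam hlam x => ?_⟩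
  have hlam0 : 0 < lam := (inv_pos.2 hδ).trans_le hlam
  have hli : lam⁻¹ ≤ δ := inv_le_of_inv_le₀ hδ hlam
  have hlog : 0 ≤ Real.log lam := Real.log_nonneg (hδi.trans hlam)
  rw [← lintegral_add_compl _ (Metric.isOpen_ball (x := x) (ε := δ)).measurableSet]
  have h1 : ∫⁻ z in Metric.ball x δ, ENNReal.ofReal ((max lam⁻¹ (dist z x) ^ 2)⁻¹)
      ∂(riemannianVolume M) ≤
      ENNReal.ofReal ((1 + ε) * (Real.pi + 2 * Real.pi * Real.log lam)) := by
    refine (h x δ (min_le_left _ _) (fun t => ENNReal.ofReal ((max lam⁻¹ t ^ 2)⁻¹)) (by fun_prop)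
      ?_).trans ?_
    · intro a _ b _ hab
      have : 0 < max lam⁻¹ a := lt_max_of_lt_left (inv_pos.2 hlam0)
      apply ENNReal.ofReal_le_ofReal
      gcongr
    · rw [ENNReal.ofReal_mul (by positivity)]
      gcongr
      refine (plane_lintegral_truncated_inv_sq_le hlam0 hli).trans (ENNReal.ofReal_le_ofReal ?_)
      have : Real.log (δ * lam) ≤ Real.log lam :=
        Real.log_le_log (by positivity) (by nlinarith)
      gcongr
  have h2 : ∫⁻ z in (Metric.ball x δ)ᶜ, ENNReal.ofReal ((max lam⁻¹ (dist z x) ^ 2)⁻¹)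
      ∂(riemannianVolume M) ≤ ENNReal.ofReal ((δ ^ 2)⁻¹ * area M) := by
    calc _ ≤ ∫⁻ _ in (Metric.ball x δ)ᶜ, ENNReal.ofReal ((δ ^ 2)⁻¹) ∂riemannianVolume M := by
          refine setLIntegral_mono' Metric.isOpen_ball.measurableSet.compl fun z hz => ?_
          have hz : δ ≤ dist z x := by simpa using hz
          apply ENNReal.ofReal_le_ofReal
          gcongr
          exact hz.trans (le_max_right _ _)
      _ ≤ _ := by
          rw [setLIntegral_const, ENNReal.ofReal_mul (by positivity), area,
            ofReal_measureReal]
          gcongr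
          exact subset_univ _
  refine (add_le_add h1 h2).trans ?_
  rw [← ENNReal.ofReal_add (by positivity) hA]
  apply ENNReal.ofReal_le_ofReal
  linarith

end Balls

/-! ### Gradients of Lipschitz functions -/

section Gradient

variable {M : Type*} [MetricSpace M] [ChartedSpace Plane M] [IsManifold 𝓘(ℝ, Plane) ∞ M]
  [RiemannianBundle (fun x : M => TangentSpace 𝓘(ℝ, Plane) x)]
  {e : OpenPartialHomeomorph M Plane} {u : M → ℝ}

theorem inner_gradient (u : M → ℝ) (x : M) (w : TangentSpace 𝓘(ℝ, Plane) x) :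
    inner ℝ (gradient u x) w = mfderiv 𝓘(ℝ, Plane) 𝓘(ℝ, ℝ) u x w := by
  have : FiniteDimensional ℝ (TangentSpace 𝓘(ℝ, Plane) x) :=
    inferInstanceAs (FiniteDimensional ℝ Plane)
  have : CompleteSpace (TangentSpace 𝓘(ℝ, Plane) x) := FiniteDimensional.complete ℝ _
  unfold gradient
  exact InnerProductSpace.toDual_symm_apply

/-- The inner products of the gradient with all vectors control its norm. -/
theorem norm_gradient_le {x : M} {L : ℝ} (hL0 : 0 ≤ L)
    (hL : ∀ w, inner ℝ (gradient u x) w ≤ L * ‖w‖) : ‖gradient u x‖ ≤ L := by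
  have h := hL (gradient u x)
  rw [real_inner_self_eq_norm_sq] at h
  rcases (norm_nonneg (gradient u x)).eq_or_lt with h0 | h0
  · rwa [← h0]
  · nlinarith

theorem mdifferentiableAt_of_comp_symm (he : e ∈ IsManifold.maximalAtlas 𝓘(ℝ, Plane) ∞ M) {x : M}
    (hx : x ∈ e.source) (hd : DifferentiableAt ℝ (fun y => u (e.symm y)) (e x)) :
    MDifferentiableAt 𝓘(ℝ, Plane) 𝓘(ℝ, ℝ) u x := by
  have h1 : MDifferentiableAt 𝓘(ℝ, Plane) 𝓘(ℝ, ℝ) ((fun y => u (e.symm y)) ∘ e) x :=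
    (mdifferentiableAt_iff_differentiableAt.2 hd).comp x (mdifferentiableAt_chart he hx)
  refine h1.congr_of_eventuallyEq ?_
  filter_upwards [e.open_source.mem_nhds hx] with z hz
  simp [e.left_inv hz]

theorem differentiableAt_comp_symm (he : e ∈ IsManifold.maximalAtlas 𝓘(ℝ, Plane) ∞ M) {y : Plane}
    (hy : y ∈ e.target) (hd : MDifferentiableAt 𝓘(ℝ, Plane) 𝓘(ℝ, ℝ) u (e.symm y)) :
    DifferentiableAt ℝ (fun y => u (e.symm y)) y :=
  mdifferentiableAt_iff_differentiableAt.1 (hd.comp y (mdifferentiableAt_symm he hy))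

/-- The differential of `u` on coordinate vectors is the differential of `u` in coordinates. -/
theorem mfderiv_coordVector (he : e ∈ IsManifold.maximalAtlas 𝓘(ℝ, Plane) ∞ M) {y : Plane}
    (hy : y ∈ e.target) (hd : DifferentiableAt ℝ (fun y => u (e.symm y)) y) (v : Plane) :
    mfderiv 𝓘(ℝ, Plane) 𝓘(ℝ, ℝ) u (e.symm y) (coordVector e y v) =
      fderiv ℝ (fun y => u (e.symm y)) y v := by
  have h1 : MDifferentiableAt 𝓘(ℝ, Plane) 𝓘(ℝ, ℝ) u (e.symm y) :=
    mdifferentiableAt_of_comp_symm he (e.map_target hy) (by rwa [e.right_inv hy])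
  have h2 : mfderiv 𝓘(ℝ, Plane) 𝓘(ℝ, ℝ) (u ∘ e.symm) y =
      (mfderiv 𝓘(ℝ, Plane) 𝓘(ℝ, ℝ) u (e.symm y)).comp
        (mfderiv 𝓘(ℝ, Plane) 𝓘(ℝ, Plane) e.symm y) :=
    mfderiv_comp y h1 (mdifferentiableAt_symm he hy)
  rw [mfderiv_eq_fderiv] at h2
  exact (congrArg (fun A => A v) h2).symm

variable [IsContMDiffRiemannianBundle 𝓘(ℝ, Plane) ∞ Plane
    (fun x : M => TangentSpace 𝓘(ℝ, Plane) x)]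

/-- The coordinate vectors of a chart are locally bounded. -/
theorem exists_norm_coordVector_le (he : e ∈ IsManifold.maximalAtlas 𝓘(ℝ, Plane) ∞ M) {y₀ : Plane}
    (hy₀ : y₀ ∈ e.target) : ∃ r > 0, ∃ C ≥ 0, Metric.ball y₀ r ⊆ e.target ∧
      ∀ y ∈ Metric.ball y₀ r, ∀ v : Plane, ‖coordVector e y v‖ ≤ C * ‖v‖ := by
  have hc : ContinuousAt (fun y => metricMatrix e y 0 0 + metricMatrix e y 1 1) y₀ :=
    ((contDiffOn_metricMatrix he 0 0).add (contDiffOn_metricMatrix he 1 1)).continuousOn.continuousAt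
      (e.open_target.mem_nhds hy₀)
  set B := metricMatrix e y₀ 0 0 + metricMatrix e y₀ 1 1 + 1
  have h1 : ∀ᶠ y in 𝓝 y₀, y ∈ e.target ∧ metricMatrix e y 0 0 + metricMatrix e y 1 1 < B :=
    Filter.Eventually.and (e.open_target.mem_nhds hy₀) (hc.eventually_lt_const (by simp [B]))
  obtain ⟨r, hr0, hr⟩ := Metric.eventually_nhds_iff_ball.1 h1
  have hdiag : ∀ y i, ‖coordVector e y (EuclideanSpace.single i 1)‖ ^ 2 = metricMatrix e y i i := by
    intro y i
    rw [← real_inner_self_eq_norm_sq]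
    rfl
  refine ⟨r, hr0, 2 * (1 + B), ?_, fun y hy => (hr y hy).1, fun y hy v => ?_⟩
  · have := sq_nonneg ‖coordVector e y₀ (EuclideanSpace.single 0 1)‖
    have := sq_nonneg ‖coordVector e y₀ (EuclideanSpace.single 1 1)‖
    simp only [hdiag] at *
    simp only [B]
    linarith
  · have hb : ∀ i, ‖coordVector e y (EuclideanSpace.single i 1)‖ ≤ 1 + B := by
      intro i
      have h2 := (hr y hy).2
      have h3 := sq_nonneg ‖coordVector e y (EuclideanSpace.single 0 1)‖
      have h4 := sq_nonneg ‖coordVector e y (EuclideanSpace.single 1 1)‖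
      have h5 := hdiag y i
      have h6 := sq_nonneg (‖coordVector e y (EuclideanSpace.single i 1)‖ - 1)
      simp only [hdiag] at h3 h4
      fin_cases i <;> simp only [Fin.zero_eta, Fin.mk_one] at * <;> nlinarith
    have hv : ∀ i, |v i| ≤ ‖v‖ := fun i => by simpa using PiLp.norm_apply_le v i
    have hB : 0 ≤ 1 + B := (norm_nonneg _).trans (hb 0)
    conv_lhs => rw [plane_eq v]
    rw [coordVector_add, coordVector_smul, coordVector_smul]
    refine (norm_add_le _ _).trans ?_
    rw [norm_smul, norm_smul, Real.norm_eq_abs, Real.norm_eq_abs]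
    have := mul_le_mul (hv 0) (hb 0) (norm_nonneg _) (norm_nonneg _)
    have := mul_le_mul (hv 1) (hb 1) (norm_nonneg _) (norm_nonneg _)
    linarith

variable [IsRiemannianManifold 𝓘(ℝ, Plane) M]

/-- The norm of the gradient is at most the local slope with respect to the distance. -/
theorem norm_gradient_le_of_slope {x : M} {L : ℝ} (hL0 : 0 ≤ L)
    (hL : ∀ᶠ z in 𝓝 x, |u z - u x| ≤ L * dist z x) : ‖gradient u x‖ ≤ L := by
  by_cases hd : MDifferentiableAt 𝓘(ℝ, Plane) 𝓘(ℝ, ℝ) u x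
  swap
  -- Where `u` is not differentiable, the gradient is `0` by convention.
  · refine norm_gradient_le hL0 fun w => ?_
    rw [inner_gradient, mfderiv_zero_of_not_mdifferentiableAt hd]
    exact (le_of_eq rfl).trans (by positivity : (0 : ℝ) ≤ L * ‖w‖)
  have key : ∀ ε, 0 < ε → ε < 1 → ‖gradient u x‖ * (1 - ε) ≤ L * (1 + ε) := by
    intro ε hε hε1
    obtain ⟨e, he, hxs, r, hr0, hr, hiso, hdist, -⟩ := exists_comparison_chart x hε hε1
    have hxt := e.map_source hxs
    have hε' : 0 < 1 - ε := by linarith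
    have hdy : DifferentiableAt ℝ (fun y => u (e.symm y)) (e x) :=
      differentiableAt_comp_symm he hxt (by rwa [e.left_inv hxs])
    have hnorm : ‖fderiv ℝ (fun y => u (e.symm y)) (e x)‖ ≤ L * (1 + ε) := by
      refine hdy.hasFDerivAt.le_of_lip' (by positivity) ?_
      have hL' : ∀ᶠ z in 𝓝 (e.symm (e x)), |u z - u x| ≤ L * dist z x := by
        rwa [e.left_inv hxs]
      filter_upwards [(e.continuousAt_symm hxt).eventually hL', Metric.ball_mem_nhds _ hr0]
        with y hy1 hy2
      have := hdist y hy2 (e x) (Metric.mem_ball_self hr0)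
      rw [e.left_inv hxs] at this ⊢
      rw [Real.norm_eq_abs, mul_assoc]
      exact hy1.trans (mul_le_mul_of_nonneg_left this hL0)
    have hcomp : mfderiv 𝓘(ℝ, Plane) 𝓘(ℝ, ℝ) u x =
        (fderiv ℝ (fun y => u (e.symm y)) (e x)).comp
          (mfderiv 𝓘(ℝ, Plane) 𝓘(ℝ, Plane) e x) := by
      have h1 : mfderiv 𝓘(ℝ, Plane) 𝓘(ℝ, ℝ) ((fun y => u (e.symm y)) ∘ e) x =
          (mfderiv 𝓘(ℝ, Plane) 𝓘(ℝ, ℝ) (fun y => u (e.symm y)) (e x)).comp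
            (mfderiv 𝓘(ℝ, Plane) 𝓘(ℝ, Plane) e x) :=
        mfderiv_comp x (mdifferentiableAt_iff_differentiableAt.2 hdy)
          (mdifferentiableAt_chart he hxs)
      have h2 : ((fun y => u (e.symm y)) ∘ e) =ᶠ[𝓝 x] u := by
        filter_upwards [e.open_source.mem_nhds hxs] with z hz
        simp [e.left_inv hz]
      rw [mfderiv_eq_fderiv, h2.mfderiv_eq] at h1
      have h3 : ((fun y => u (e.symm y)) ∘ e) x = u x := h2.self_of_nhds
      exact h1
    rw [← le_div_iff₀ hε']
    refine norm_gradient_le (by positivity) fun w => ?_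
    have h1 := mul_norm_mfderiv_chart_le he (fun y hy v => (hiso y hy v).1) hxs
      (Metric.mem_ball_self hr0) w
    have h2 : inner ℝ (gradient u x) w =
        fderiv ℝ (fun y => u (e.symm y)) (e x)
          (show Plane from mfderiv 𝓘(ℝ, Plane) 𝓘(ℝ, Plane) e x w) := by
      rw [inner_gradient, hcomp]; rfl
    rw [h2]
    refine (le_abs_self _).trans (((fderiv ℝ (fun y => u (e.symm y)) (e x)).le_opNorm _).trans ?_)
    rw [div_mul_eq_mul_div, le_div_iff₀ hε', mul_assoc]
    calc _ ≤ (L * (1 + ε)) * ‖w‖ := by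
          refine mul_le_mul hnorm ?_ (by positivity) (by positivity)
          linarith
      _ = _ := rfl
  -- The bound `‖∇u‖ (1 - ε) ≤ L (1 + ε)` for all `ε` excludes `‖∇u‖ > L`.
  by_contra hlt
  rw [not_le] at hlt
  set g := ‖gradient u x‖
  have hgL : 0 < g + L := by linarith
  have := key ((g - L) / (2 * (g + L))) (div_pos (by linarith) (by linarith))
    (by rw [div_lt_one (by linarith)]; linarith)
  have h2 : (g - L) / (2 * (g + L)) * (g + L) = (g - L) / 2 := by field_simp
  nlinarith

/-- By Rademacher's theorem, the pointwise gradient of a Lipschitz function is its weak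
gradient. -/
theorem isWeakGradient_gradient {K : NNReal} (hu : LipschitzWith K u) :
    IsWeakGradient u (gradient u) := by
  intro e he
  set U : Plane → ℝ := fun y => u (e.symm y) with hU
  have hball : ∀ y₀ ∈ e.target, ∃ r > 0, ∃ C : NNReal, Metric.ball y₀ r ⊆ e.target ∧
      LipschitzOnWith C U (Metric.ball y₀ r) := by
    intro y₀ hy₀
    obtain ⟨r, hr0, C, hC0, hr, hC⟩ := exists_norm_coordVector_le he hy₀
    lift C to NNReal using hC0
    refine ⟨r, hr0, K * C, hr, LipschitzOnWith.of_dist_le_mul fun y hy z hz => ?_⟩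
    refine (hu.dist_le_mul _ _).trans ?_
    rw [NNReal.coe_mul, mul_assoc, dist_eq_norm y z]
    exact mul_le_mul_of_nonneg_left (dist_symm_le he hr C.2 hC hy hz) K.2
  have hloc : ∀ s ⊆ e.target, LocallyLipschitzOn s U := by
    intro s hs y hy
    obtain ⟨r, hr0, C, -, hC⟩ := hball y (hs hy)
    exact ⟨C, _, mem_nhdsWithin_of_mem_nhds (Metric.ball_mem_nhds y hr0), hC⟩
  have hcont : ContinuousOn U e.target := hu.continuous.comp_continuousOn e.continuousOn_symm
  -- Rademacher's theorem on each small disc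
  have hdiff : ∀ᵐ y ∂(volume : Measure Plane), y ∈ e.target → DifferentiableAt ℝ U y := by
    have : ∀ y₀ ∈ e.target, ∃ t ∈ 𝓝[e.target] y₀,
        volume {y | y ∈ t ∧ ¬ DifferentiableAt ℝ U y} = 0 := by
      intro y₀ hy₀
      obtain ⟨r, hr0, C, -, hC⟩ := hball y₀ hy₀
      refine ⟨Metric.ball y₀ r, mem_nhdsWithin_of_mem_nhds (Metric.ball_mem_nhds y₀ hr0), ?_⟩
      have h1 := hC.ae_differentiableWithinAt_of_mem (μ := volume)
      rw [ae_iff] at h1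
      refine measure_mono_null ?_ h1
      rintro y ⟨hy1, hy2⟩
      simp only [mem_ofPred_eq, Classical.not_imp]
      exact ⟨hy1, fun h => hy2 (h.differentiableAt (Metric.isOpen_ball.mem_nhds hy1))⟩
    obtain ⟨T, hTc, hTU⟩ : ∃ T : Set (Set Plane), T.Countable ∧ (∀ t ∈ T,
        volume {y | y ∈ t ∧ ¬ DifferentiableAt ℝ U y} = 0) ∧ e.target ⊆ ⋃₀ T := by
      choose! t ht1 ht2 using this
      obtain ⟨D, hD, hDc, hDU⟩ := TopologicalSpace.countable_cover_nhdsWithin ht1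
      refine ⟨t '' D, hDc.image t, ?_, ?_⟩
      · rintro _ ⟨y, hy, rfl⟩
        exact ht2 y (hD hy)
      · rwa [sUnion_image]
    rw [ae_iff]
    refine measure_mono_null (t := ⋃ t ∈ T, {y | y ∈ t ∧ ¬ DifferentiableAt ℝ U y}) ?_
      ((measure_biUnion_null_iff hTc).2 hTU.1)
    intro y hy
    simp only [mem_ofPred_eq, Classical.not_imp] at hy
    obtain ⟨t, ht, hyt⟩ := hTU.2 hy.1
    exact mem_biUnion ht ⟨hyt, hy.2⟩
  have hinner : ∀ v : Plane, ∀ᵐ y ∂(volume.restrict e.target),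
      inner ℝ (gradient u (e.symm y)) (coordVector e y v) = fderiv ℝ U y v := by
    intro v
    filter_upwards [ae_restrict_of_ae hdiff, ae_restrict_mem e.open_target.measurableSet]
      with y hy hyt
    rw [inner_gradient]
    exact mfderiv_coordVector he hyt (hy hyt) v
  refine ⟨hcont.locallyIntegrableOn e.open_target.measurableSet, fun v => ⟨?_, ?_⟩⟩
  · intro y₀ hy₀
    obtain ⟨r, hr0, C, hr, hC⟩ := hball y₀ hy₀
    refine ⟨Metric.ball y₀ r, mem_nhdsWithin_of_mem_nhds (Metric.ball_mem_nhds y₀ hr0), ?_⟩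
    have h1 : IntegrableOn (fun y => fderiv ℝ U y v) (Metric.ball y₀ r) := by
      refine Measure.integrableOn_of_bounded (M := C * ‖v‖) measure_ball_lt_top.ne
        (measurable_fderiv_apply_const ℝ U v).aestronglyMeasurable ?_
      filter_upwards [ae_restrict_mem Metric.isOpen_ball.measurableSet] with y hy
      refine ((fderiv ℝ U y).le_opNorm v).trans ?_
      gcongr
      exact norm_fderiv_le_of_lipschitzOn ℝ (Metric.isOpen_ball.mem_nhds hy) hC
    refine h1.congr ?_
    filter_upwards [ae_restrict_of_ae_restrict_of_subset hr (hinner v)] with y hy using hy.symm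
  · intro ψ hψ hψc hψs
    -- On a compact neighbourhood of the support of `ψ`, `U` agrees with a globally Lipschitz function,
    -- to which integration by parts applies.
    obtain ⟨L, hLc, hψL, hLe⟩ := exists_compact_between hψc e.open_target hψs
    obtain ⟨C, hC⟩ := (hloc L hLe).exists_lipschitzOnWith_of_compact hLc
    obtain ⟨g, hg, hgU⟩ := hC.extend_real
    obtain ⟨D, hD⟩ := hψ.lipschitzWith_of_hasCompactSupport hψc (by simp)
    have hψ0 : ∀ y, y ∉ L → ψ y = 0 := fun y hy =>
      image_eq_zero_of_notMem_tsupport fun h => hy (interior_subset (hψL h))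
    have hψ0' : ∀ y, y ∉ L → fderiv ℝ ψ y v = 0 := fun y hy => by
      have : fderiv ℝ ψ y = 0 := image_eq_zero_of_notMem_tsupport
        fun h => hy (interior_subset (hψL (tsupport_fderiv_subset ℝ (f := ψ) h)))
      rw [this]; rfl
    have hibp := LipschitzWith.integral_lineDeriv_mul_eq (μ := (volume : Measure Plane)) hg hD hψc v
    have h1 : ∫ y in e.target, U y * fderiv ℝ ψ y v = ∫ y, g y * fderiv ℝ ψ y v := by
      rw [← setIntegral_eq_integral_of_forall_compl_eq_zero (s := e.target)
        (f := fun y => g y * fderiv ℝ ψ y v)]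
      · refine setIntegral_congr_fun e.open_target.measurableSet fun y _ => ?_
        by_cases hy : y ∈ L
        · simp only [hgU hy]
        · simp [hψ0' y hy]
      · intro y hy
        rw [hψ0' y fun h => hy (hLe h), mul_zero]
    have h2 : ∫ y in e.target, inner ℝ (gradient u (e.symm y)) (coordVector e y v) * ψ y =
        ∫ y, lineDeriv ℝ g y v * ψ y := by
      rw [← setIntegral_eq_integral_of_forall_compl_eq_zero (s := e.target)
        (f := fun y => lineDeriv ℝ g y v * ψ y)]
      · refine setIntegral_congr_ae e.open_target.measurableSet ?_
        have hi := (ae_restrict_iff' e.open_target.measurableSet).1 (hinner v)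
        filter_upwards [hi, hdiff] with y hy1 hy2 hyt
        by_cases hy : y ∈ tsupport ψ
        · have hgU' : g =ᶠ[𝓝 y] U := by
            filter_upwards [isOpen_interior.mem_nhds (hψL hy)] with z hz
            exact (hgU (interior_subset hz)).symm
          rw [hy1 hyt, hgU'.lineDeriv_eq, (hy2 hyt).lineDeriv_eq_fderiv]
        · rw [image_eq_zero_of_notMem_tsupport hy, mul_zero, mul_zero]
      · intro y hy
        rw [hψ0 y fun h => hy (hLe h), mul_zero]
    have h3 : ∫ y, lineDeriv ℝ ψ y (-v) * g y = -∫ y, g y * fderiv ℝ ψ y v := by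
      rw [← integral_neg]
      refine integral_congr_ae (Eventually.of_forall fun y => ?_)
      simp only
      rw [((hψ.differentiable (by simp)) y).lineDeriv_eq_fderiv, map_neg]
      ring
    change ∫ y in e.target, U y * fderiv ℝ ψ y v = _
    rw [h1, h2, hibp, h3, neg_neg]

end Gradient

/-! ### The Dirichlet energy of the test functions -/

section TestFunction

theorem rpow_div_one_add_rpow_le {b τ : ℝ} (hb : 1 ≤ b) (hτ : 0 ≤ τ) :
    τ ^ (b - 1) / (1 + τ ^ b) ≤ (max 1 τ)⁻¹ := by
  have hb0 : 0 ≤ τ ^ b := Real.rpow_nonneg hτ _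
  have hb1 : 0 ≤ τ ^ (b - 1) := Real.rpow_nonneg hτ _
  rw [inv_eq_one_div, div_le_div_iff₀ (by positivity) (by positivity)]
  rcases le_total τ 1 with h | h
  · rw [max_eq_left h]
    have := Real.rpow_le_one hτ h (by linarith : 0 ≤ b - 1)
    linarith
  · rw [max_eq_right h]
    have : τ ^ (b - 1) * τ = τ ^ b := by
      rw [← Real.rpow_add_one (by linarith)]; ring_nf
    linarith

/-- The radial profile of the test functions. -/
noncomputable def profile (α lam s : ℝ) : ℝ :=
  Real.log (lam ^ (1 + α) / (1 + (lam * s) ^ (2 * (1 + α))))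

/-- The derivative of the profile is at most `2 (1 + α) min(λ, 1 / s)` in absolute value. -/
theorem exists_hasDerivAt_profile {α lam : ℝ} (hα : 0 ≤ α) (hlam : 0 < lam) {s : ℝ} (hs : 0 ≤ s) :
    ∃ d, HasDerivAt (profile α lam) d s ∧ |d| ≤ 2 * (1 + α) * (max lam⁻¹ s)⁻¹ := by
  set b := 2 * (1 + α)
  have hb : 1 ≤ b := by simp only [b]; linarith
  have hτ : 0 ≤ lam * s := by positivity
  have hτb : 0 ≤ (lam * s) ^ b := Real.rpow_nonneg hτ _
  have h1 : HasDerivAt (fun s => lam * s) lam s := by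
    simpa using (hasDerivAt_id s).const_mul lam
  have h2 : HasDerivAt (fun s => 1 + (lam * s) ^ b) (lam * b * (lam * s) ^ (b - 1)) s :=
    (h1.rpow_const (Or.inr hb)).const_add 1
  have h3 := (((hasDerivAt_const s (lam ^ (1 + α))).fun_div h2 (by positivity)).log (by positivity))
  refine ⟨_, h3, ?_⟩
  have h4 : (0 * (1 + (lam * s) ^ b) - lam ^ (1 + α) * (lam * b * (lam * s) ^ (b - 1))) /
      (1 + (lam * s) ^ b) ^ 2 / (lam ^ (1 + α) / (1 + (lam * s) ^ b)) =
      -(b * (lam * ((lam * s) ^ (b - 1) / (1 + (lam * s) ^ b)))) := by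
    have : (0 : ℝ) < lam ^ (1 + α) := by positivity
    field_simp
    ring
  rw [h4, abs_neg, abs_of_nonneg (by positivity)]
  have h5 : (max lam⁻¹ s)⁻¹ = lam * (max 1 (lam * s))⁻¹ := by
    have : max 1 (lam * s) = lam * max lam⁻¹ s := by
      rw [mul_max_of_nonneg _ _ hlam.le, mul_inv_cancel₀ hlam.ne']
    rw [this, mul_inv, mul_inv_cancel_left₀ hlam.ne']
  rw [h5]
  gcongr
  exact rpow_div_one_add_rpow_le hb hτ

variable {M : Type*} [MetricSpace M] {α lam : ℝ}

theorem lipschitzWith_testFunction (hα : 0 ≤ α) (hlam : 0 < lam) (x : M) :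
    ∃ K, LipschitzWith K (testFunction α lam x) := by
  have hC : 0 ≤ 2 * (1 + α) * lam := by positivity
  obtain ⟨C, hC'⟩ : ∃ C : NNReal, (C : ℝ) = 2 * (1 + α) * lam := ⟨⟨_, hC⟩, rfl⟩
  have h1 : LipschitzOnWith C (profile α lam) (Ici 0) := by
    refine Convex.lipschitzOnWith_of_nnnorm_deriv_le (𝕜 := ℝ) (fun s hs => ?_) (fun s hs => ?_)
      (convex_Ici 0)
    · obtain ⟨d, hd, -⟩ := exists_hasDerivAt_profile hα hlam hs
      exact hd.differentiableAt
    · obtain ⟨d, hd, hd'⟩ := exists_hasDerivAt_profile hα hlam hs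
      rw [hd.deriv, ← NNReal.coe_le_coe, hC']
      refine hd'.trans ?_
      gcongr
      exact inv_le_of_inv_le₀ hlam (le_max_left _ _)
  refine ⟨C, LipschitzWith.of_dist_le_mul fun y z => ?_⟩
  refine (h1.dist_le_mul _ (dist_nonneg (x := y) (y := x)) _
    (dist_nonneg (x := z) (y := x))).trans ?_
  gcongr
  exact dist_dist_dist_le_left y z x

theorem eventually_slope_testFunction (hα : 0 ≤ α) (hlam : 0 < lam) (x z : M) {η : ℝ}
    (hη : 0 < η) : ∀ᶠ y in 𝓝 z, |testFunction α lam x y - testFunction α lam x z| ≤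
      (2 * (1 + α) * (max lam⁻¹ (dist z x))⁻¹ + η) * dist y z := by
  obtain ⟨d, hd, hd'⟩ := exists_hasDerivAt_profile hα hlam (dist_nonneg (x := z) (y := x))
  have h1 : ∀ᶠ s in 𝓝 (dist z x), |profile α lam s - profile α lam (dist z x)| ≤
      (2 * (1 + α) * (max lam⁻¹ (dist z x))⁻¹ + η) * |s - dist z x| := by
    filter_upwards [hd.isLittleO.def hη] with s hs
    rw [Real.norm_eq_abs, Real.norm_eq_abs, smul_eq_mul] at hs
    have h2 : |profile α lam s - profile α lam (dist z x)| ≤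
        |profile α lam s - profile α lam (dist z x) - (s - dist z x) * d| +
          |(s - dist z x) * d| := by
      simpa using abs_add_le (profile α lam s - profile α lam (dist z x) - (s - dist z x) * d)
        ((s - dist z x) * d)
    rw [abs_mul] at h2
    nlinarith [abs_nonneg (s - dist z x)]
  have h3 : Tendsto (fun y => dist y x) (𝓝 z) (𝓝 (dist z x)) :=
    (continuous_id.dist continuous_const).tendsto z
  filter_upwards [h3.eventually h1] with y hy
  refine hy.trans ?_
  gcongr
  exact abs_dist_sub_le y z x

variable [ChartedSpace Plane M] [IsManifold 𝓘(ℝ, Plane) ∞ M]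
  [RiemannianBundle (fun x : M => TangentSpace 𝓘(ℝ, Plane) x)]
  [IsContMDiffRiemannianBundle 𝓘(ℝ, Plane) ∞ Plane (fun x : M => TangentSpace 𝓘(ℝ, Plane) x)]
  [IsRiemannianManifold 𝓘(ℝ, Plane) M]

theorem norm_gradient_testFunction_le (hα : 0 ≤ α) (hlam : 0 < lam) (x z : M) :
    ‖gradient (testFunction α lam x) z‖ ≤ 2 * (1 + α) * (max lam⁻¹ (dist z x))⁻¹ := by
  have : 0 ≤ (max lam⁻¹ (dist z x))⁻¹ := inv_nonneg.2 (le_max_of_le_right dist_nonneg)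
  refine le_of_forall_pos_le_add fun η hη => ?_
  exact norm_gradient_le_of_slope (by positivity) (eventually_slope_testFunction hα hlam x z hη)

variable [CompactSpace M] [Nonempty M] [MeasurableSpace M] [BorelSpace M]

/-- The pointwise bound `|∇φ| ≤ 2 (1 + α) min(λ, 1 / d(·, x))`, integrated. -/
theorem dirichletEnergy_testFunction_le (hα : 0 ≤ α) (hlam : 0 < lam) (x : M) :
    dirichletEnergy (testFunction α lam x) ≤ ENNReal.ofReal (4 * (1 + α) ^ 2) *
      ∫⁻ z, ENNReal.ofReal ((max lam⁻¹ (dist z x) ^ 2)⁻¹) ∂(riemannianVolume M) := by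
  obtain ⟨K, hK⟩ := lipschitzWith_testFunction hα hlam x
  refine (iInf₂_le _ (isWeakGradient_gradient hK)).trans ?_
  rw [← lintegral_const_mul' _ _ ENNReal.ofReal_ne_top]
  refine lintegral_mono fun z => ?_
  rw [← ofReal_norm, ← ENNReal.ofReal_pow (norm_nonneg _),
    ← ENNReal.ofReal_mul (by positivity)]
  apply ENNReal.ofReal_le_ofReal
  refine (pow_le_pow_left₀ (norm_nonneg _) (norm_gradient_testFunction_le hα hlam x z) 2).trans_eq ?_
  rw [mul_pow, mul_pow, inv_pow]
  norm_num

theorem continuous_testFunction (hα : 0 ≤ α) (hlam : 0 < lam) (x : M) :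
    Continuous (testFunction α lam x) :=
  (lipschitzWith_testFunction hα hlam x).choose_spec.continuous

theorem memH1_testFunction (hα : 0 ≤ α) (hlam : 0 < lam) (x : M) :
    MemH1 (testFunction α lam x) := by
  have hc := continuous_testFunction hα hlam x
  obtain ⟨C, hC⟩ := isCompact_univ.exists_bound_of_continuousOn hc.continuousOn
  refine ⟨MemLp.of_bound hc.aestronglyMeasurable C
    (Eventually.of_forall fun y => hC y (mem_univ y)), ?_⟩
  refine (dirichletEnergy_testFunction_le hα hlam x).trans_lt ?_
  refine ENNReal.mul_lt_top ENNReal.ofReal_lt_top ?_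
  calc _ ≤ ∫⁻ _, ENNReal.ofReal ((lam⁻¹ ^ 2)⁻¹) ∂(riemannianVolume M) := by
        refine lintegral_mono fun z => ENNReal.ofReal_le_ofReal ?_
        gcongr
        exact le_max_left _ _
    _ < ⊤ := by
        rw [lintegral_const]
        exact ENNReal.mul_lt_top ENNReal.ofReal_lt_top (measure_lt_top _ _)

end TestFunction

/-! ### A regularised logarithm -/

section SoftLog

/-- A smooth function on the line which equals `log t / 2` for `t ≥ 1` and vanishes for
`t ≤ 1 / 2`. -/
noncomputable def softLog (t : ℝ) : ℝ := Real.smoothTransition (2 * t - 1) * Real.log t / 2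

/-- The Laplacian of `softLog (‖v‖ ^ 2)` on the plane, as a function of `t = ‖v‖ ^ 2`. -/
noncomputable def softDelta (t : ℝ) : ℝ :=
  4 * deriv softLog t + 4 * t * deriv (deriv softLog) t

theorem softLog_of_one_le {t : ℝ} (ht : 1 ≤ t) : softLog t = Real.log t / 2 := by
  rw [softLog, Real.smoothTransition.one_of_one_le (by linarith), one_mul]

theorem softLog_of_le_half {t : ℝ} (ht : t ≤ 1 / 2) : softLog t = 0 := by
  rw [softLog, Real.smoothTransition.zero_of_nonpos (by linarith), zero_mul, zero_div]

theorem contDiff_softLog : ContDiff ℝ ∞ softLog := by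
  rw [contDiff_iff_contDiffAt]
  intro t
  rcases eq_or_ne t 0 with rfl | ht
  · refine (contDiffAt_const (c := (0 : ℝ))).congr_of_eventuallyEq ?_
    filter_upwards [Iio_mem_nhds (by norm_num : (0 : ℝ) < 1 / 2)] with t ht
    exact softLog_of_le_half (le_of_lt ht)
  · have h1 : ContDiff ℝ ∞ fun t : ℝ => Real.smoothTransition (2 * t - 1) :=
      Real.smoothTransition.contDiff.comp (by fun_prop)
    exact (h1.contDiffAt.mul (Real.contDiffAt_log.2 ht)).div_const 2

theorem contDiff_deriv_softLog : ContDiff ℝ ∞ (deriv softLog) :=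
  (contDiff_infty_iff_deriv.1 contDiff_softLog).2

theorem contDiff_deriv_deriv_softLog : ContDiff ℝ ∞ (deriv (deriv softLog)) :=
  (contDiff_infty_iff_deriv.1 contDiff_deriv_softLog).2

theorem deriv_softLog_of_one_lt {t : ℝ} (ht : 1 < t) : deriv softLog t = t⁻¹ / 2 := by
  have h : softLog =ᶠ[𝓝 t] fun t => Real.log t / 2 := by
    filter_upwards [Ioi_mem_nhds ht] with s hs using softLog_of_one_le (le_of_lt hs)
  rw [h.deriv_eq, deriv_div_const, Real.deriv_log]

theorem deriv_deriv_softLog_of_one_lt {t : ℝ} (ht : 1 < t) :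
    deriv (deriv softLog) t = -(t ^ 2)⁻¹ / 2 := by
  have h : deriv softLog =ᶠ[𝓝 t] fun t => t⁻¹ / 2 := by
    filter_upwards [Ioi_mem_nhds ht] with s hs using deriv_softLog_of_one_lt hs
  rw [h.deriv_eq, deriv_div_const, deriv_inv]

theorem continuous_softDelta : Continuous softDelta := by
  have h1 := contDiff_deriv_softLog.continuous
  have h2 := contDiff_deriv_deriv_softLog.continuous
  unfold softDelta
  fun_prop

theorem softDelta_of_one_lt {t : ℝ} (ht : 1 < t) : softDelta t = 0 := by
  rw [softDelta, deriv_softLog_of_one_lt ht, deriv_deriv_softLog_of_one_lt ht]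
  have : t ≠ 0 := by linarith
  field_simp
  ring

theorem exists_softLog_bounds : ∃ C : ℝ, 0 ≤ C ∧ ∀ t : ℝ, 0 ≤ t →
    |t * deriv softLog t| ≤ C ∧ |t ^ 2 * deriv (deriv softLog) t| ≤ C ∧ |softDelta t| ≤ C ∧
      (t ≤ 1 → |softLog t| ≤ C) := by
  have hb : ∀ f : ℝ → ℝ, Continuous f → ∃ C, ∀ t ∈ Icc (0 : ℝ) 2, |f t| ≤ C := fun f hf =>
    isCompact_Icc.exists_bound_of_continuousOn hf.continuousOn
  obtain ⟨C1, h1⟩ := hb (fun t => t * deriv softLog t)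
    (continuous_id.mul contDiff_deriv_softLog.continuous)
  obtain ⟨C2, h2⟩ := hb (fun t => t ^ 2 * deriv (deriv softLog) t)
    ((continuous_id.pow 2).mul contDiff_deriv_deriv_softLog.continuous)
  obtain ⟨C3, h3⟩ := hb softDelta continuous_softDelta
  obtain ⟨C4, h4⟩ := hb softLog contDiff_softLog.continuous
  have h0 : (0 : ℝ) ∈ Icc (0 : ℝ) 2 := by norm_num
  have p1 := (abs_nonneg _).trans (h1 0 h0)
  have p2 := (abs_nonneg _).trans (h2 0 h0)
  have p3 := (abs_nonneg _).trans (h3 0 h0)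
  have p4 := (abs_nonneg _).trans (h4 0 h0)
  refine ⟨C1 + C2 + C3 + C4 + 1, by linarith, fun t ht => ?_⟩
  rcases le_or_gt t 2 with h | h
  · have hm : t ∈ Icc (0 : ℝ) 2 := ⟨ht, h⟩
    have := h1 t hm
    have := h2 t hm
    have := h3 t hm
    have := h4 t hm
    exact ⟨by linarith, by linarith, by linarith, fun _ => by linarith⟩
  · have ht1 : 1 < t := by linarith
    have ht0 : t ≠ 0 := by linarith
    rw [deriv_softLog_of_one_lt ht1, deriv_deriv_softLog_of_one_lt ht1, softDelta_of_one_lt ht1]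
    have e1 : t * (t⁻¹ / 2) = 1 / 2 := by field_simp
    have e2 : t ^ 2 * (-(t ^ 2)⁻¹ / 2) = -(1 / 2) := by field_simp
    rw [e1, e2, abs_neg, abs_zero, abs_of_pos (by norm_num : (0 : ℝ) < 1 / 2)]
    exact ⟨by linarith, by linarith, by linarith, fun h' => by linarith⟩

/-- The regularised logarithm has total Laplacian `2π`. -/
theorem integral_softDelta_norm_sq : ∫ v : Plane, softDelta (‖v‖ ^ 2) = 2 * Real.pi := by
  have h1 : ∫ r in Ioi (0 : ℝ), r ^ (Module.finrank ℝ Plane - 1) • softDelta (r ^ 2) = 1 := by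
    have h2 : ∫ r in Ioi (0 : ℝ), r ^ (Module.finrank ℝ Plane - 1) • softDelta (r ^ 2) =
        ∫ r in (0 : ℝ)..2, r * softDelta (r ^ 2) := by
      rw [intervalIntegral.integral_of_le zero_le_two]
      simp only [finrank_euclideanSpace, Fintype.card_fin, Nat.add_one_sub_one, pow_one,
        smul_eq_mul]
      refine (setIntegral_eq_of_subset_of_forall_sdiff_eq_zero measurableSet_Ioi
        Ioc_subset_Ioi_self fun r hr => ?_)
      have h3 : 2 < r := by
        by_contra h
        exact hr.2 ⟨hr.1, not_lt.1 h⟩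
      rw [softDelta_of_one_lt (by nlinarith), mul_zero]
    have h3 : ∀ r ∈ uIcc (0 : ℝ) 2,
        HasDerivAt (fun r => 2 * r ^ 2 * deriv softLog (r ^ 2)) (r * softDelta (r ^ 2)) r := by
      intro r _
      have hd : HasDerivAt (deriv softLog) (deriv (deriv softLog) (r ^ 2)) (r ^ 2) :=
        (contDiff_deriv_softLog.differentiable (by simp) _).hasDerivAt
      have hs : HasDerivAt (fun r : ℝ => r ^ 2) (2 * r) r := by simpa using hasDerivAt_pow 2 r
      have hc : HasDerivAt (fun r : ℝ => deriv softLog (r ^ 2))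
          (deriv (deriv softLog) (r ^ 2) * (2 * r)) r :=
        HasDerivAt.comp (h := fun r : ℝ => r ^ 2) (h₂ := deriv softLog) r hd hs
      refine ((hs.const_mul 2).fun_mul hc).congr_deriv ?_
      simp only [softDelta]
      ring
    rw [h2, intervalIntegral.integral_eq_sub_of_hasDerivAt h3
      ((continuous_id.mul (continuous_softDelta.comp
        (continuous_pow 2))).intervalIntegrable _ _),
      deriv_softLog_of_one_lt (by norm_num)]
    norm_num
  rw [integral_fun_norm_addHaar volume (fun r => softDelta (r ^ 2)), h1]
  simp [Measure.real, ENNReal.toReal_ofReal Real.pi_pos.le]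

end SoftLog

/-! ### Regularised point masses of quadratic forms -/

section QuadraticForm

/-- The quadratic form of a `2 × 2` matrix. -/
def quadForm (A : Matrix (Fin 2) (Fin 2) ℝ) (v : Plane) : ℝ := ∑ i, ∑ j, A i j * v i * v j

/-- The `i`-th coordinate of `A v`. -/
def matVec (A : Matrix (Fin 2) (Fin 2) ℝ) (i : Fin 2) (v : Plane) : ℝ := ∑ j, A i j * v j

theorem plane_integral_comp_linear {f : Plane → ℝ} (hf : Continuous f) (L : Plane →ₗ[ℝ] Plane)
    (hL : LinearMap.det L ≠ 0) :
    |LinearMap.det L| * ∫ v, f (L v) = ∫ v, f v := by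
  have hLc : Continuous L := L.continuous_of_finiteDimensional
  rw [← integral_map hLc.aemeasurable hf.aestronglyMeasurable,
    Measure.map_linearMap_addHaar_eq_smul_addHaar volume hL, integral_smul_measure,
    ENNReal.toReal_ofReal (abs_nonneg _), smul_eq_mul, ← mul_assoc, ← abs_mul,
    mul_inv_cancel₀ hL, abs_one, one_mul]

/-- A positive definite quadratic form is the Euclidean one after a linear change of variables. -/
theorem exists_linearMap_quadForm {A : Matrix (Fin 2) (Fin 2) ℝ} (hsymm : A 1 0 = A 0 1)
    (h0 : 0 < A 0 0) (hdet : 0 < A.det) :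
    ∃ L : Plane →ₗ[ℝ] Plane, LinearMap.det L = Real.sqrt A.det ∧
      ∀ v, quadForm A v = ‖L v‖ ^ 2 := by
  set s := Real.sqrt (A 0 0)
  set d := Real.sqrt A.det
  have hs : 0 < s := Real.sqrt_pos.2 h0
  have hs2 : s ^ 2 = A 0 0 := Real.sq_sqrt h0.le
  have hd2 : d ^ 2 = A.det := Real.sq_sqrt hdet.le
  refine ⟨{ toFun := fun v => !₂[s * v 0 + A 0 1 / s * v 1, d / s * v 1]
            map_add' := fun v w => by ext i; fin_cases i <;> simp <;> ring
            map_smul' := fun c v => by ext i; fin_cases i <;> simp <;> ring }, ?_, fun v => ?_⟩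
  · rw [plane_det_eq]
    simp
    field_simp
  · rw [plane_norm_sq]
    simp only [LinearMap.coe_mk, AddHom.coe_mk, quadForm, Fin.sum_univ_two]
    rw [Matrix.det_fin_two, hsymm] at hd2
    rw [hsymm]
    simp
    field_simp
    rw [hs2, hd2]
    ring

/-- The regularised point mass attached to a positive definite quadratic form has mass `2π`. -/
theorem integral_softDelta_quadForm {A : Matrix (Fin 2) (Fin 2) ℝ} (hsymm : A 1 0 = A 0 1)
    (h0 : 0 < A 0 0) (hdet : 0 < A.det) {ε : ℝ} (hε : 0 < ε) (y : Plane) :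
    ∫ z, Real.sqrt A.det * softDelta (quadForm A (z - y) / ε ^ 2) / ε ^ 2 = 2 * Real.pi := by
  obtain ⟨L, hL, hq⟩ := exists_linearMap_quadForm hsymm h0 hdet
  have hd : 0 < Real.sqrt A.det := Real.sqrt_pos.2 hdet
  have hdet' : LinearMap.det (ε⁻¹ • L) = Real.sqrt A.det / ε ^ 2 := by
    rw [LinearMap.det_smul, hL]
    simp
    field_simp
  have h1 := plane_integral_comp_linear (f := fun v => softDelta (‖v‖ ^ 2))
    (continuous_softDelta.comp (continuous_norm.pow 2)) (ε⁻¹ • L)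
    (by rw [hdet']; positivity)
  rw [integral_softDelta_norm_sq, hdet', abs_of_pos (by positivity)] at h1
  rw [← h1, ← integral_const_mul]
  rw [integral_sub_right_eq_self (fun z => Real.sqrt A.det * softDelta (quadForm A z / ε ^ 2) / ε ^ 2)
    y]
  refine integral_congr_ae (Eventually.of_forall fun v => ?_)
  simp only [LinearMap.smul_apply, norm_smul, mul_pow, norm_inv, Real.norm_of_nonneg hε.le, hq]
  rw [inv_pow, div_eq_inv_mul (‖L v‖ ^ 2)]
  ring

end QuadraticForm

/-! ### Divergence form operators in the plane -/

section PartialDerivatives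

/-- The partial derivative `∂ᵢ f`; it is `0` where `f` is not differentiable. -/
noncomputable def pd (i : Fin 2) (f : Plane → ℝ) (y : Plane) : ℝ :=
  fderiv ℝ f y (EuclideanSpace.single i 1)

/-- The divergence form operator `∑ ∂ᵢ (aᵢⱼ ∂ⱼ φ)`. -/
noncomputable def divForm (a : Plane → Matrix (Fin 2) (Fin 2) ℝ) (φ : Plane → ℝ) (y : Plane) : ℝ :=
  ∑ i, pd i (fun w => ∑ j, a w i j * pd j φ w) y

variable {f g φ ζ : Plane → ℝ} {S : Set Plane} {a : Plane → Matrix (Fin 2) (Fin 2) ℝ}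

theorem contDiff_pd (hf : ContDiff ℝ ∞ f) (i : Fin 2) : ContDiff ℝ ∞ (pd i f) :=
  (hf.fderiv_right (m := ∞) (by simp)).clm_apply contDiff_const

theorem contDiffOn_pd (hS : IsOpen S) (hf : ContDiffOn ℝ ∞ f S) (i : Fin 2) :
    ContDiffOn ℝ ∞ (pd i f) S :=
  (hf.fderiv_of_isOpen hS (m := ∞) (by simp)).clm_apply contDiffOn_const

theorem tsupport_pd_subset (f : Plane → ℝ) (i : Fin 2) : tsupport (pd i f) ⊆ tsupport f :=
  tsupport_fderiv_apply_subset ℝ _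

theorem pd_of_eventuallyEq {y : Plane} (h : f =ᶠ[𝓝 y] g) (i : Fin 2) : pd i f y = pd i g y := by
  rw [pd, pd, h.fderiv_eq]

theorem pd_mul {y : Plane} (hf : DifferentiableAt ℝ f y) (hg : DifferentiableAt ℝ g y)
    (i : Fin 2) : pd i (fun w => f w * g w) y = pd i f y * g y + f y * pd i g y := by
  simp only [pd]
  rw [fderiv_fun_mul hf hg]
  simp
  ring

theorem pd_sum {ι : Type*} {s : Finset ι} {F : ι → Plane → ℝ} {y : Plane}
    (hF : ∀ j ∈ s, DifferentiableAt ℝ (F j) y) (i : Fin 2) :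
    pd i (fun w => ∑ j ∈ s, F j w) y = ∑ j ∈ s, pd i (F j) y := by
  simp only [pd]
  rw [fderiv_fun_sum hF]
  simp

/-- A function that is smooth on `S` only becomes smooth everywhere when multiplied by a smooth
function supported in `S`. -/
theorem contDiff_mul_of_tsupport_subset (hS : IsOpen S) (hf : ContDiffOn ℝ ∞ f S)
    (hg : ContDiff ℝ ∞ g) (hgS : tsupport g ⊆ S) : ContDiff ℝ ∞ fun y => f y * g y := by
  rw [contDiff_iff_contDiffAt]
  intro y
  by_cases hy : y ∈ S
  · exact ((hf y hy).contDiffAt (hS.mem_nhds hy)).mul hg.contDiffAt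
  · refine (contDiffAt_const (c := (0 : ℝ))).congr_of_eventuallyEq ?_
    have : y ∉ tsupport g := fun h => hy (hgS h)
    filter_upwards [(isClosed_tsupport g).isOpen_compl.mem_nhds this] with z hz
    rw [image_eq_zero_of_notMem_tsupport hz, mul_zero]

theorem contDiff_flux (hS : IsOpen S) (ha : ∀ i j, ContDiffOn ℝ ∞ (fun y => a y i j) S)
    (hφ : ContDiff ℝ ∞ φ) (hφS : tsupport φ ⊆ S) (i : Fin 2) :
    ContDiff ℝ ∞ fun w => ∑ j, a w i j * pd j φ w :=
  ContDiff.sum fun j _ => contDiff_mul_of_tsupport_subset hS (ha i j) (contDiff_pd hφ j)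
    ((tsupport_pd_subset φ j).trans hφS)

theorem flux_eq_zero {y : Plane} (hy : y ∉ tsupport φ) (i : Fin 2) :
    ∑ j, a y i j * pd j φ y = 0 :=
  Finset.sum_eq_zero fun j _ => by
    rw [image_eq_zero_of_notMem_tsupport fun h => hy (tsupport_pd_subset φ j h), mul_zero]

theorem contDiff_divForm (hS : IsOpen S) (ha : ∀ i j, ContDiffOn ℝ ∞ (fun y => a y i j) S)
    (hφ : ContDiff ℝ ∞ φ) (hφS : tsupport φ ⊆ S) : ContDiff ℝ ∞ (divForm a φ) :=
  ContDiff.sum fun i _ => contDiff_pd (contDiff_flux hS ha hφ hφS i) i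

theorem divForm_eq_zero {y : Plane} (hy : y ∉ tsupport φ) : divForm a φ y = 0 := by
  refine Finset.sum_eq_zero fun i _ => ?_
  have : (fun w => ∑ j, a w i j * pd j φ w) =ᶠ[𝓝 y] fun _ => 0 := by
    filter_upwards [(isClosed_tsupport φ).isOpen_compl.mem_nhds hy] with z hz
    exact flux_eq_zero hz i
  rw [pd_of_eventuallyEq this]
  simp [pd]

theorem integral_pd_eq_zero (hf : ContDiff ℝ ∞ f) (hfc : HasCompactSupport f) (i : Fin 2) :
    ∫ y, pd i f y = 0 := by
  have h := integral_mul_fderiv_eq_neg_fderiv_mul_of_integrable (𝕜 := ℝ) (μ := (volume : Measure Plane))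
    (f := fun _ => (1 : ℝ)) (g := f) (v := EuclideanSpace.single i 1) (by simp) ?_ ?_
    (by simp) (fun x _ => hf.differentiable (by simp) x)
  · simpa [pd] using h
  · simp only [one_mul]
    exact (contDiff_pd hf i).continuous.integrable_of_hasCompactSupport
      (hfc.mono' (subset_tsupport _ |>.trans (tsupport_pd_subset f i)))
  · simpa using hf.continuous.integrable_of_hasCompactSupport hfc

/-- Integration by parts for a divergence form operator with coefficients on an open set. -/
theorem setIntegral_flux_mul_pd (hS : IsOpen S) (ha : ∀ i j, ContDiffOn ℝ ∞ (fun y => a y i j) S)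
    (hφ : ContDiff ℝ ∞ φ) (hφc : HasCompactSupport φ) (hφS : tsupport φ ⊆ S)
    (hζ : ContDiffOn ℝ ∞ ζ S) :
    ∫ y in S, ∑ i, (∑ j, a y i j * pd j φ y) * pd i ζ y = -∫ y in S, divForm a φ y * ζ y := by
  set W : Fin 2 → Plane → ℝ := fun i w => ∑ j, a w i j * pd j φ w with hW
  have hWs : ∀ i, ContDiff ℝ ∞ (W i) := contDiff_flux hS ha hφ hφS
  have hWt : ∀ i, tsupport (W i) ⊆ tsupport φ := fun i => by
    refine closure_minimal (fun y hy => ?_) (isClosed_tsupport φ)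
    by_contra h
    exact hy (flux_eq_zero h i)
  have hζW : ∀ i, ContDiff ℝ ∞ fun y => ζ y * W i y := fun i =>
    contDiff_mul_of_tsupport_subset hS hζ (hWs i) ((hWt i).trans hφS)
  have hsupp : ∀ i, HasCompactSupport fun y => ζ y * W i y := fun i =>
    HasCompactSupport.mul_left (HasCompactSupport.mono' hφc ((subset_tsupport _).trans (hWt i)))
  have hpt : ∀ y ∈ S, ∀ i, pd i (fun y => ζ y * W i y) y =
      W i y * pd i ζ y + pd i (W i) y * ζ y := by
    intro y hy i
    rw [pd_mul ((hζ.contDiffAt (hS.mem_nhds hy)).differentiableAt (by simp))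
      ((hWs i).differentiable (by simp) y)]
    ring
  have hout : ∀ y, y ∉ S → ∑ i, pd i (fun y => ζ y * W i y) y = 0 := by
    intro y hy
    refine Finset.sum_eq_zero fun i _ => image_eq_zero_of_notMem_tsupport fun h => hy (hφS ?_)
    refine (hWt i) ((closure_mono ?_) (tsupport_pd_subset _ i h))
    exact Function.support_mul_subset_right _ _
  have hint : ∀ i, Integrable (pd i fun y => ζ y * W i y) := fun i =>
    (contDiff_pd (hζW i) i).continuous.integrable_of_hasCompactSupport
      ((hsupp i).mono' (subset_tsupport _ |>.trans (tsupport_pd_subset _ i)))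
  have hsum : ∫ y in S, ∑ i, pd i (fun y => ζ y * W i y) y = 0 := by
    rw [setIntegral_eq_integral_of_forall_compl_eq_zero hout, integral_finsetSum _ fun i _ => hint i]
    exact Finset.sum_eq_zero fun i _ => integral_pd_eq_zero (hζW i) (hsupp i) i
  have hi2 : IntegrableOn (fun y => divForm a φ y * ζ y) S := by
    have h1 : Continuous fun y => ζ y * divForm a φ y :=
      (contDiff_mul_of_tsupport_subset hS hζ (contDiff_divForm hS ha hφ hφS)
        ((closure_minimal (fun y hy => by
          by_contra h; exact hy (divForm_eq_zero h)) (isClosed_tsupport φ)).trans hφS)).continuous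
    have h2 : HasCompactSupport fun y => ζ y * divForm a φ y := by
      refine HasCompactSupport.mul_left (hφc.mono' fun y hy => ?_)
      by_contra h
      exact hy (divForm_eq_zero h)
    simpa only [mul_comm] using (h1.integrable_of_hasCompactSupport h2).integrableOn
  have hsplit : ∀ y ∈ S, ∑ i, (∑ j, a y i j * pd j φ y) * pd i ζ y =
      ∑ i, pd i (fun y => ζ y * W i y) y - divForm a φ y * ζ y := by
    intro y hy
    rw [Finset.sum_congr rfl fun i _ => hpt y hy i, Finset.sum_add_distrib, divForm,
      Finset.sum_mul]
    exact (add_sub_cancel_right _ _).symm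
  rw [setIntegral_congr_fun hS.measurableSet hsplit, integral_sub _ hi2, hsum, zero_sub]
  exact (integrable_finsetSum _ fun i _ => hint i).integrableOn

end PartialDerivatives

/-! ### The Laplacian in a chart -/

section ChartLaplacian

variable {M : Type*} [MetricSpace M] [ChartedSpace Plane M]
  {e : OpenPartialHomeomorph M Plane}

/-- The function on `M` which is `φ` in the coordinates of the chart `e`, extended by zero outside
the domain of `e`. -/
noncomputable def chartExtend (e : OpenPartialHomeomorph M Plane) (φ : Plane → ℝ) : M → ℝ :=
  e.source.indicator fun x => φ (e x)

theorem chartExtend_of_mem {x : M} (hx : x ∈ e.source) (φ : Plane → ℝ) :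
    chartExtend e φ x = φ (e x) := indicator_of_mem hx _

theorem chartExtend_symm {y : Plane} (hy : y ∈ e.target) (φ : Plane → ℝ) :
    chartExtend e φ (e.symm y) = φ y := by
  rw [chartExtend_of_mem (e.map_target hy), e.right_inv hy]

theorem chartExtend_eventuallyEq {x : M} (hx : x ∈ e.source) (φ : Plane → ℝ) :
    chartExtend e φ =ᶠ[𝓝 x] fun x => φ (e x) := by
  filter_upwards [e.open_source.mem_nhds hx] with z hz using chartExtend_of_mem hz φ

/-- Near a point outside the chart the extension by zero vanishes: the image of the support of `φ` in
`M` is compact, hence closed. -/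
theorem chartExtend_eventuallyEq_zero {φ : Plane → ℝ} {K : Set Plane} (hK : IsCompact K)
    (hKe : K ⊆ e.target) (hφ : ∀ y, y ∉ K → φ y = 0) {x : M} (hx : x ∉ e.source) :
    chartExtend e φ =ᶠ[𝓝 x] fun _ => 0 := by
  have hcl : IsClosed (e.symm '' K) :=
    (hK.image_of_continuousOn (e.continuousOn_symm.mono hKe)).isClosed
  have hxK : x ∉ e.symm '' K := by
    rintro ⟨y, hy, rfl⟩
    exact hx (e.map_target (hKe hy))
  filter_upwards [hcl.isOpen_compl.mem_nhds hxK] with z hz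
  by_cases hzs : z ∈ e.source
  · rw [chartExtend_of_mem hzs]
    exact hφ _ fun h => hz ⟨e z, h, e.left_inv hzs⟩
  · exact indicator_of_notMem hzs _

theorem continuous_chartExtend {φ : Plane → ℝ} {K : Set Plane} (hK : IsCompact K)
    (hKe : K ⊆ e.target) (hφ : ∀ y, y ∉ K → φ y = 0) (hc : ContinuousOn φ e.target) :
    Continuous (chartExtend e φ) := by
  rw [continuous_iff_continuousAt]
  intro x
  by_cases hx : x ∈ e.source
  · refine ContinuousAt.congr ?_ (chartExtend_eventuallyEq hx φ).symm
    exact ContinuousAt.comp (hc.continuousAt (e.open_target.mem_nhds (e.map_source hx)))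
      (e.continuousAt hx)
  · exact continuousAt_const.congr (chartExtend_eventuallyEq_zero hK hKe hφ hx).symm

variable [IsManifold 𝓘(ℝ, Plane) ∞ M]

theorem contMDiff_chartExtend (he : e ∈ IsManifold.maximalAtlas 𝓘(ℝ, Plane) ∞ M) {φ : Plane → ℝ}
    (hφ : ContDiff ℝ ∞ φ) (hφc : HasCompactSupport φ) (hφe : tsupport φ ⊆ e.target) :
    ContMDiff 𝓘(ℝ, Plane) 𝓘(ℝ, ℝ) ∞ (chartExtend e φ) := by
  intro x
  by_cases hx : x ∈ e.source
  · refine ContMDiffAt.congr_of_eventuallyEq ?_ (chartExtend_eventuallyEq hx φ)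
    exact (contMDiff_iff_contDiff.2 hφ).contMDiffAt.comp x (contMDiffAt_of_mem_maximalAtlas he hx)
  · exact contMDiffAt_const.congr_of_eventuallyEq (chartExtend_eventuallyEq_zero hφc hφe
      (fun y hy => image_eq_zero_of_notMem_tsupport hy) hx)

variable [RiemannianBundle (fun x : M => TangentSpace 𝓘(ℝ, Plane) x)]

/-- The coefficients `√(det g) gⁱʲ` of the Laplacian in the chart `e`. The inverse matrix is written
as the adjugate divided by the determinant. -/
noncomputable def fluxCoeff (e : OpenPartialHomeomorph M Plane) (y : Plane) :
    Matrix (Fin 2) (Fin 2) ℝ :=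
  (Real.sqrt (metricMatrix e y).det)⁻¹ • (metricMatrix e y).adjugate

theorem fluxCoeff_apply (e : OpenPartialHomeomorph M Plane) (y : Plane) (i j : Fin 2) :
    fluxCoeff e y i j = (Real.sqrt (metricMatrix e y).det)⁻¹ * (metricMatrix e y).adjugate i j := rfl

theorem inner_gradient_coordVector (he : e ∈ IsManifold.maximalAtlas 𝓘(ℝ, Plane) ∞ M) {u : M → ℝ}
    {y : Plane} (hy : y ∈ e.target) (hu : MDifferentiableAt 𝓘(ℝ, Plane) 𝓘(ℝ, ℝ) u (e.symm y))
    (i : Fin 2) :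
    inner ℝ (gradient u (e.symm y)) (coordVector e y (EuclideanSpace.single i 1)) =
      pd i (fun z => u (e.symm z)) y := by
  rw [inner_gradient]
  exact mfderiv_coordVector he hy (differentiableAt_comp_symm he hy hu) _

/-- The inner product of two gradients in coordinates. -/
theorem sqrt_det_mul_inner_gradient (he : e ∈ IsManifold.maximalAtlas 𝓘(ℝ, Plane) ∞ M)
    {u w : M → ℝ} {y : Plane} (hy : y ∈ e.target)
    (hu : MDifferentiableAt 𝓘(ℝ, Plane) 𝓘(ℝ, ℝ) u (e.symm y))
    (hw : MDifferentiableAt 𝓘(ℝ, Plane) 𝓘(ℝ, ℝ) w (e.symm y)) :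
    Real.sqrt (metricMatrix e y).det *
        inner ℝ (gradient u (e.symm y)) (gradient w (e.symm y)) =
      ∑ i, (∑ j, fluxCoeff e y i j * pd j (fun z => u (e.symm z)) y) *
        pd i (fun z => w (e.symm z)) y := by
  have hdet := det_metricMatrix_pos he hy
  set D := (metricMatrix e y).det with hD
  have hs : 0 < Real.sqrt D := Real.sqrt_pos.2 hdet
  have hs2 : Real.sqrt D ^ 2 = D := Real.sq_sqrt hdet.le
  obtain ⟨b, hb⟩ : ∃ b : Plane, coordVector e y b = gradient u (e.symm y) :=
    ⟨_, coordVector_mfderiv_chart he hy _⟩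
  obtain ⟨c, hc⟩ : ∃ c : Plane, coordVector e y c = gradient w (e.symm y) :=
    ⟨_, coordVector_mfderiv_chart he hy _⟩
  have h1 : ∀ i, pd i (fun z => u (e.symm z)) y = ∑ j, metricMatrix e y j i * b j := by
    intro i
    rw [← inner_gradient_coordVector he hy hu, ← hb, inner_coordVector]
    simp
  have h2 : ∀ i, pd i (fun z => w (e.symm z)) y = ∑ j, metricMatrix e y j i * c j := by
    intro i
    rw [← inner_gradient_coordVector he hy hw, ← hc, inner_coordVector]
    simp
  have h3 : (metricMatrix e y 0 0 * metricMatrix e y 1 1 - metricMatrix e y 0 1 ^ 2) =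
      Real.sqrt D ^ 2 := by rw [hs2, hD, det_metricMatrix]
  rw [← hb, ← hc, inner_coordVector]
  simp only [h1, h2, fluxCoeff_apply, Matrix.adjugate_fin_two, Fin.sum_univ_two, Matrix.of_apply,
    Matrix.cons_val', Matrix.cons_val_zero, Matrix.cons_val_one, Matrix.cons_val_fin_one]
  rw [metricMatrix_comm e y 1 0, ← hD]
  field_simp
  linear_combination (-(metricMatrix e y 0 0 * b 0 * c 0 + metricMatrix e y 0 1 * b 0 * c 1 +
    metricMatrix e y 0 1 * b 1 * c 0 + metricMatrix e y 1 1 * b 1 * c 1)) * h3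

variable [IsContMDiffRiemannianBundle 𝓘(ℝ, Plane) ∞ Plane
    (fun x : M => TangentSpace 𝓘(ℝ, Plane) x)]

theorem contDiffOn_sqrt_det (he : e ∈ IsManifold.maximalAtlas 𝓘(ℝ, Plane) ∞ M) :
    ContDiffOn ℝ ∞ (fun y => Real.sqrt (metricMatrix e y).det) e.target :=
  (contDiffOn_det_metricMatrix he).sqrt fun _ hy => (det_metricMatrix_pos he hy).ne'

theorem sqrt_det_pos (he : e ∈ IsManifold.maximalAtlas 𝓘(ℝ, Plane) ∞ M) {y : Plane}
    (hy : y ∈ e.target) : 0 < Real.sqrt (metricMatrix e y).det :=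
  Real.sqrt_pos.2 (det_metricMatrix_pos he hy)

theorem contDiffOn_fluxCoeff (he : e ∈ IsManifold.maximalAtlas 𝓘(ℝ, Plane) ∞ M) (i j : Fin 2) :
    ContDiffOn ℝ ∞ (fun y => fluxCoeff e y i j) e.target := by
  simp only [fluxCoeff_apply]
  refine ((contDiffOn_sqrt_det he).inv fun y hy => (sqrt_det_pos he hy).ne').mul ?_
  have h := contDiffOn_metricMatrix he
  simp only [Matrix.adjugate_fin_two]
  fin_cases i <;> fin_cases j <;> simp
  · exact h 1 1
  · exact (h 0 1).neg
  · exact (h 1 0).neg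
  · exact h 0 0

variable [CompactSpace M] [Nonempty M] [MeasurableSpace M] [BorelSpace M]

/-- The Laplacian of a function supported in a chart. -/
theorem isLaplacian_chartExtend (he : e ∈ IsManifold.maximalAtlas 𝓘(ℝ, Plane) ∞ M) {φ : Plane → ℝ}
    (hφ : ContDiff ℝ ∞ φ) (hφc : HasCompactSupport φ) (hφe : tsupport φ ⊆ e.target) :
    IsLaplacian (chartExtend e φ) (chartExtend e fun y =>
      divForm (fluxCoeff e) φ y / Real.sqrt (metricMatrix e y).det) := by
  have ha := contDiffOn_fluxCoeff he
  have hcont : Continuous (chartExtend e fun y =>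
      divForm (fluxCoeff e) φ y / Real.sqrt (metricMatrix e y).det) := by
    refine continuous_chartExtend hφc hφe (fun y hy => ?_) ?_
    · rw [divForm_eq_zero hy, zero_div]
    · exact (contDiff_divForm e.open_target ha hφ hφe).continuous.continuousOn.div
        (contDiffOn_sqrt_det he).continuousOn fun y hy => (sqrt_det_pos he hy).ne'
  refine ⟨hcont, fun ζ hζ => ?_⟩
  have hη := contMDiff_chartExtend he hφ hφc hφe
  have hζ' : ContDiffOn ℝ ∞ (fun z => ζ (e.symm z)) e.target :=
    contMDiffOn_iff_contDiffOn.1 (hζ.comp_contMDiffOn (contMDiffOn_symm_of_mem_maximalAtlas he))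
  set h : Plane → ℝ := fun y =>
    ∑ i, (∑ j, fluxCoeff e y i j * pd j φ y) * pd i (fun z => ζ (e.symm z)) y
  have hgrad : ∀ y ∈ e.target, Real.sqrt (metricMatrix e y).det *
      inner ℝ (gradient (chartExtend e φ) (e.symm y)) (gradient ζ (e.symm y)) = h y := by
    intro y hy
    rw [sqrt_det_mul_inner_gradient he hy (hη.mdifferentiableAt (by simp))
      (hζ.mdifferentiableAt (by simp))]
    have : (fun z => chartExtend e φ (e.symm z)) =ᶠ[𝓝 y] φ := by
      filter_upwards [e.open_target.mem_nhds hy] with z hz using chartExtend_symm hz φ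
    simp only [h, pd_of_eventuallyEq this]
  have hh : ContinuousOn h e.target :=
    (ContDiffOn.sum fun i _ => (contDiff_flux e.open_target ha hφ hφe i).contDiffOn.mul
      (contDiffOn_pd e.open_target hζ' i)).continuousOn
  have hmeas : AEStronglyMeasurable
      (fun x => inner ℝ (gradient (chartExtend e φ) x) (gradient ζ x))
      ((riemannianVolume M).restrict e.source) := by
    have h1 : ContinuousOn (fun x => h (e x) / Real.sqrt (metricMatrix e (e x)).det) e.source :=
      (hh.div (contDiffOn_sqrt_det he).continuousOn fun y hy => (sqrt_det_pos he hy).ne').comp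
        e.continuousOn fun x hx => e.map_source hx
    refine (h1.aestronglyMeasurable e.open_source.measurableSet).congr ?_
    filter_upwards [ae_restrict_mem e.open_source.measurableSet] with x hx
    have h2 := hgrad (e x) (e.map_source hx)
    rw [e.left_inv hx] at h2
    rw [← h2]
    field_simp [(sqrt_det_pos he (e.map_source hx)).ne']
  have hzero : ∀ x, x ∉ e.source →
      inner ℝ (gradient (chartExtend e φ) x) (gradient ζ x) = 0 := by
    intro x hx
    rw [inner_gradient, (chartExtend_eventuallyEq_zero hφc hφe
      (fun y hy => image_eq_zero_of_notMem_tsupport hy) hx).mfderiv_eq, mfderiv_const]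
    rfl
  rw [← setIntegral_eq_integral_of_forall_compl_eq_zero hzero, setIntegral_chart he hmeas,
    setIntegral_congr_fun e.open_target.measurableSet hgrad,
    setIntegral_flux_mul_pd e.open_target ha hφ hφc hφe hζ',
    ← setIntegral_eq_integral_of_forall_compl_eq_zero (s := e.source),
    setIntegral_chart he (f := fun x => chartExtend e (fun y =>
      divForm (fluxCoeff e) φ y / Real.sqrt (metricMatrix e y).det) x * ζ x)
      (hcont.mul hζ.continuous).aestronglyMeasurable]
  · congr 1
    refine setIntegral_congr_fun e.open_target.measurableSet fun y hy => ?_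
    simp only [chartExtend_symm hy]
    field_simp [(sqrt_det_pos he hy).ne']
  · intro x hx
    rw [chartExtend, indicator_of_notMem hx, zero_mul]

end ChartLaplacian

/-! ### The parametrix estimate -/

section SoftPotential

/-- Symmetric matrices whose entries and whose quadratic form are of order one; the constants are
those of the metric in a chart with distortion at most `2`. -/
structure IsElliptic (A : Matrix (Fin 2) (Fin 2) ℝ) : Prop where
  symm : A 1 0 = A 0 1
  abs_le : ∀ i j, |A i j| ≤ 4
  le_quadForm : ∀ v, ‖v‖ ^ 2 / 4 ≤ quadForm A v
  quadForm_le : ∀ v, quadForm A v ≤ 4 * ‖v‖ ^ 2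

/-- The logarithm of the length of `z - y` in the metric `A`, smoothed out at the scale `ε`. -/
noncomputable def softPotential (A : Matrix (Fin 2) (Fin 2) ℝ) (ε : ℝ) (y z : Plane) : ℝ :=
  softLog (quadForm A (z - y) / ε ^ 2) + Real.log ε

variable {A : Matrix (Fin 2) (Fin 2) ℝ} {ε : ℝ} {y z : Plane}

theorem contDiff_quadForm (A : Matrix (Fin 2) (Fin 2) ℝ) : ContDiff ℝ ∞ (quadForm A) := by
  unfold quadForm
  fun_prop

theorem contDiff_matVec (A : Matrix (Fin 2) (Fin 2) ℝ) (i : Fin 2) : ContDiff ℝ ∞ (matVec A i) := by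
  unfold matVec
  fun_prop

theorem contDiff_quadForm_sub (A : Matrix (Fin 2) (Fin 2) ℝ) (y : Plane) :
    ContDiff ℝ ∞ fun z => quadForm A (z - y) :=
  (contDiff_quadForm A).comp (contDiff_id.sub contDiff_const)

theorem contDiff_matVec_sub (A : Matrix (Fin 2) (Fin 2) ℝ) (i : Fin 2) (y : Plane) :
    ContDiff ℝ ∞ fun z => matVec A i (z - y) :=
  (contDiff_matVec A i).comp (contDiff_id.sub contDiff_const)

theorem contDiff_softPotential (A : Matrix (Fin 2) (Fin 2) ℝ) (ε : ℝ) (y : Plane) :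
    ContDiff ℝ ∞ (softPotential A ε y) :=
  (contDiff_softLog.comp ((contDiff_quadForm_sub A y).div_const _)).add contDiff_const

theorem pd_eq_of_hasDerivAt {f : Plane → ℝ} {i : Fin 2} {d : ℝ} (hf : DifferentiableAt ℝ f z)
    (hd : HasDerivAt (fun t : ℝ => f (z + t • EuclideanSpace.single i 1)) d 0) :
    pd i f z = d := by
  rw [pd, ← hf.lineDeriv_eq_fderiv]
  exact hd.deriv

theorem pd_comp {g : ℝ → ℝ} {f : Plane → ℝ} (hg : DifferentiableAt ℝ g (f z))
    (hf : DifferentiableAt ℝ f z) (i : Fin 2) :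
    pd i (fun w => g (f w)) z = deriv g (f z) * pd i f z := by
  have h := hg.hasDerivAt.comp_hasFDerivAt z hf.hasFDerivAt
  have h' : fderiv ℝ (fun w => g (f w)) z = deriv g (f z) • fderiv ℝ f z := h.fderiv
  rw [pd, h']
  rfl

theorem pd_div_const {f : Plane → ℝ} (c : ℝ) (i : Fin 2) :
    pd i (fun w => f w / c) z = pd i f z / c := by
  simp only [pd, div_eq_mul_inv]
  by_cases hc : c = 0
  · simp [hc]
  · rw [show (fun w => f w * c⁻¹) = c⁻¹ • f from funext fun w => by simp [mul_comm],
      fderiv_const_smul_field]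
    simp [mul_comm]

theorem pd_quadForm_sub (hA : A 1 0 = A 0 1) (i : Fin 2) :
    pd i (fun z => quadForm A (z - y)) z = 2 * matVec A i (z - y) := by
  refine pd_eq_of_hasDerivAt ((contDiff_quadForm_sub A y).differentiable (by simp) z) ?_
  have h : (fun t : ℝ => quadForm A (z + t • EuclideanSpace.single i 1 - y)) =
      fun t => quadForm A (z - y) + t * (2 * matVec A i (z - y)) + t ^ 2 * A i i := by
    funext t
    fin_cases i <;> simp [quadForm, matVec, Fin.sum_univ_two, hA] <;> ring
  rw [h]
  have := ((hasDerivAt_id (0 : ℝ)).mul_const (2 * matVec A i (z - y))).const_add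
    (quadForm A (z - y)) |>.fun_add (((hasDerivAt_id (0 : ℝ)).fun_pow 2).mul_const (A i i))
  simpa using this

theorem pd_matVec_sub (i j : Fin 2) : pd i (fun z => matVec A j (z - y)) z = A j i := by
  refine pd_eq_of_hasDerivAt ((contDiff_matVec_sub A j y).differentiable (by simp) z) ?_
  have h : (fun t : ℝ => matVec A j (z + t • EuclideanSpace.single i 1 - y)) =
      fun t => matVec A j (z - y) + t * A j i := by
    funext t
    fin_cases i <;> simp [matVec, Fin.sum_univ_two] <;> ring
  rw [h]
  simpa using ((hasDerivAt_id (0 : ℝ)).mul_const (A j i)).const_add (matVec A j (z - y))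

theorem pd_softPotential (hA : A 1 0 = A 0 1) (j : Fin 2) :
    pd j (softPotential A ε y) z =
      deriv softLog (quadForm A (z - y) / ε ^ 2) * (2 * matVec A j (z - y) / ε ^ 2) := by
  have h1 : pd j (softPotential A ε y) z =
      pd j (fun z => softLog (quadForm A (z - y) / ε ^ 2)) z := by
    have : softPotential A ε y = fun z => softLog (quadForm A (z - y) / ε ^ 2) + Real.log ε := rfl
    rw [pd, pd, this, fderiv_add_const]
  rw [h1, pd_comp (g := softLog) (f := fun z => quadForm A (z - y) / ε ^ 2)
    (contDiff_softLog.differentiable (by simp) _)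
    (((contDiff_quadForm_sub A y).div_const _).differentiable (by simp) z), pd_div_const,
    pd_quadForm_sub hA]

theorem pd_pd_softPotential (hA : A 1 0 = A 0 1) (i j : Fin 2) :
    pd i (pd j (softPotential A ε y)) z =
      deriv (deriv softLog) (quadForm A (z - y) / ε ^ 2) *
        (2 * matVec A i (z - y) / ε ^ 2) * (2 * matVec A j (z - y) / ε ^ 2) +
      deriv softLog (quadForm A (z - y) / ε ^ 2) * (2 * A j i / ε ^ 2) := by
  have h1 : pd j (softPotential A ε y) = fun z =>
      deriv softLog (quadForm A (z - y) / ε ^ 2) * (2 * matVec A j (z - y) / ε ^ 2) :=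
    funext fun z => pd_softPotential hA j
  have hd1 : ContDiff ℝ ∞ fun z => quadForm A (z - y) / ε ^ 2 :=
    (contDiff_quadForm_sub A y).div_const _
  have hd2 : ContDiff ℝ ∞ fun z => deriv softLog (quadForm A (z - y) / ε ^ 2) :=
    contDiff_deriv_softLog.comp hd1
  have hd3 : ContDiff ℝ ∞ fun z => 2 * matVec A j (z - y) / ε ^ 2 :=
    (contDiff_const.mul (contDiff_matVec_sub A j y)).div_const _
  have h2 : pd i (fun z => 2 * matVec A j (z - y) / ε ^ 2) z = 2 * A j i / ε ^ 2 := by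
    rw [pd_div_const, pd_mul (differentiableAt_const _)
      ((contDiff_matVec_sub A j y).differentiable (by simp) z), pd_matVec_sub]
    simp [pd]
  rw [h1, pd_mul (hd2.differentiable (by simp) z) (hd3.differentiable (by simp) z), h2,
    pd_comp (g := deriv softLog) (f := fun z => quadForm A (z - y) / ε ^ 2)
      (contDiff_deriv_softLog.differentiable (by simp) _) (hd1.differentiable (by simp) z),
    pd_div_const, pd_quadForm_sub hA]

/-- For constant coefficients the divergence form operator of the metric `A`, applied to the soft
potential, is `softDelta` rescaled to the scale `ε`. -/
theorem sum_adjugate_pd_pd_softPotential (hA : A 1 0 = A 0 1) (hdet : 0 < A.det) (hε : 0 < ε) :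
    ∑ i, ∑ j, ((Real.sqrt A.det)⁻¹ * A.adjugate i j) * pd i (pd j (softPotential A ε y)) z =
      Real.sqrt A.det * softDelta (quadForm A (z - y) / ε ^ 2) / ε ^ 2 := by
  have hs : 0 < Real.sqrt A.det := Real.sqrt_pos.2 hdet
  have hs2 : Real.sqrt A.det ^ 2 = A 0 0 * A 1 1 - A 0 1 ^ 2 := by
    rw [Real.sq_sqrt hdet.le, Matrix.det_fin_two, hA]; ring
  simp only [pd_pd_softPotential hA, softDelta]
  set s := Real.sqrt A.det
  set F1 := deriv softLog (quadForm A (z - y) / ε ^ 2)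
  set F2 := deriv (deriv softLog) (quadForm A (z - y) / ε ^ 2)
  simp only [Matrix.adjugate_fin_two, Fin.sum_univ_two, Matrix.of_apply, Matrix.cons_val',
    Matrix.cons_val_zero, Matrix.cons_val_one, Matrix.cons_val_fin_one, matVec, quadForm, hA]
  field_simp
  rw [hs2]
  ring

/-- The singularity of the soft potential is that of the logarithm, uniformly in the scale. -/
theorem exists_softPotential_bounds (R : ℝ) : ∃ C : ℝ, 0 ≤ C ∧ ∀ A, IsElliptic A → ∀ ε, 0 < ε → ε ≤ 1 →
    ∀ y z : Plane, y ≠ z → ‖z - y‖ ≤ R →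
      |softPotential A ε y z| ≤ C / ‖z - y‖ ∧
      (∀ j, |pd j (softPotential A ε y) z| ≤ C / ‖z - y‖) ∧
      ∀ i j, |pd i (pd j (softPotential A ε y)) z| ≤ C / ‖z - y‖ ^ 2 := by
  obtain ⟨C, hC, hb⟩ := exists_softLog_bounds
  refine ⟨5000 * (C + 1) + 2 * |R| ^ 3, by positivity, fun A hA ε hε hε1 y z hyz hR => ?_⟩
  have hR3 : 0 ≤ |R| ^ 3 := by positivity
  set v := z - y with hv
  set N := ‖v‖ with hN
  have hN0 : 0 < N := norm_pos_iff.2 (sub_ne_zero.2 hyz.symm)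
  have hQ1 := hA.le_quadForm v
  have hQ2 := hA.quadForm_le v
  rw [← hN] at hQ1 hQ2
  set Q := quadForm A v
  have hQ0 : 0 < Q := lt_of_lt_of_le (by positivity) hQ1
  set t := Q / ε ^ 2 with ht
  have ht0 : 0 < t := by positivity
  obtain ⟨b1, b2, -, b4⟩ := hb t ht0.le
  have hεt : (ε ^ 2)⁻¹ = t / Q := by rw [ht]; field_simp
  have hm : ∀ i, |matVec A i v| ≤ 8 * N := by
    intro i
    have hc : ∀ j, |v j| ≤ N := fun j => PiLp.norm_apply_le v j
    have : ∀ j, |A i j * v j| ≤ 4 * N := fun j => by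
      rw [abs_mul]
      exact mul_le_mul (hA.abs_le i j) (hc j) (abs_nonneg _) (by norm_num)
    rw [matVec, Fin.sum_univ_two]
    linarith [abs_add_le (A i 0 * v 0) (A i 1 * v 1), this 0, this 1]
  have hquot : N ^ 2 / Q ≤ 4 := by rw [div_le_iff₀ hQ0]; linarith
  have hmQ : ∀ i, |2 * matVec A i v / Q| ≤ 64 / N := by
    intro i
    rw [abs_div, abs_of_pos hQ0, div_le_div_iff₀ hQ0 hN0, abs_mul, abs_two]
    nlinarith [hm i, hN0]
  have hAQ : ∀ i j, |2 * A j i / Q| ≤ 32 / N ^ 2 := by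
    intro i j
    rw [abs_div, abs_of_pos hQ0, div_le_div_iff₀ hQ0 (by positivity), abs_mul, abs_two]
    nlinarith [hA.abs_le j i, sq_nonneg N]
  refine ⟨?_, fun j => ?_, fun i j => ?_⟩
  · rw [softPotential, ← hv]
    rcases le_or_gt t 1 with h1 | h1
    · have h2 : Q ≤ ε ^ 2 := by rwa [ht, div_le_one (by positivity)] at h1
      have h3 : N ≤ 2 * ε := by nlinarith
      have h4 : |Real.log ε| ≤ 1 / ε := by
        rw [abs_of_nonpos (Real.log_nonpos hε.le hε1), ← Real.log_inv, one_div]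
        exact (Real.log_le_sub_one_of_pos (by positivity)).trans (by linarith)
      have h5 : 1 / ε ≤ 2 / N := by rw [div_le_div_iff₀ hε hN0]; linarith
      have h6 : C ≤ 2 * C / N := by rw [le_div_iff₀ hN0]; nlinarith
      calc |softLog t + Real.log ε| ≤ |softLog t| + |Real.log ε| := abs_add_le _ _
        _ ≤ 2 * C / N + 2 / N := add_le_add ((b4 h1).trans h6) (h4.trans h5)
        _ = (2 * C + 2) / N := by ring
        _ ≤ _ := div_le_div_of_nonneg_right (by linarith) hN0.le
    · have h2 : softLog t + Real.log ε = Real.log Q / 2 := by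
        rw [softLog_of_one_le h1.le, ht, Real.log_div hQ0.ne' (by positivity), Real.log_pow]
        push_cast
        ring
      rw [h2, le_div_iff₀ hN0]
      have h3 : Real.log Q ≤ 4 * N ^ 2 := (Real.log_le_sub_one_of_pos hQ0).trans (by linarith)
      have h4 : -Real.log Q ≤ 4 / N := by
        have h5 : Real.log (N / 2) ≤ Real.log Q / 2 := by
          have := Real.log_le_log (by positivity : 0 < (N / 2) ^ 2) (by linarith : (N / 2) ^ 2 ≤ Q)
          rw [Real.log_pow] at this
          push_cast at this
          linarith
        have h6 : -Real.log (N / 2) ≤ 2 / N := by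
          rw [← Real.log_inv, inv_div]
          exact (Real.log_le_sub_one_of_pos (by positivity)).trans (by linarith)
        have : 4 / N = 2 * (2 / N) := by ring
        linarith
      have h7 : |Real.log Q / 2| ≤ 2 * N ^ 2 + 2 / N := by
        have : 4 / N = 2 * (2 / N) := by ring
        have hp : 0 ≤ 2 / N := by positivity
        rw [abs_le]
        constructor <;> nlinarith [sq_nonneg N]
      have h8 : (2 * N ^ 2 + 2 / N) * N = 2 * N ^ 3 + 2 := by field_simp
      have h9 : N ^ 3 ≤ |R| ^ 3 := pow_le_pow_left₀ hN0.le (hR.trans (le_abs_self R)) 3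
      have h10 := mul_le_mul_of_nonneg_right h7 hN0.le
      linarith
  · rw [pd_softPotential hA.symm, ← hv]
    have : deriv softLog t * (2 * matVec A j v / ε ^ 2) =
        (t * deriv softLog t) * (2 * matVec A j v / Q) := by
      rw [div_eq_mul_inv _ (ε ^ 2), hεt]; ring
    rw [this, abs_mul]
    calc _ ≤ C * (64 / N) := mul_le_mul b1 (hmQ j) (abs_nonneg _) hC
      _ = (64 * C) / N := by ring
      _ ≤ _ := by gcongr; linarith
  · rw [pd_pd_softPotential hA.symm, ← hv]
    have : deriv (deriv softLog) t * (2 * matVec A i v / ε ^ 2) * (2 * matVec A j v / ε ^ 2) +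
        deriv softLog t * (2 * A j i / ε ^ 2) =
        (t ^ 2 * deriv (deriv softLog) t) * (2 * matVec A i v / Q) * (2 * matVec A j v / Q) +
        (t * deriv softLog t) * (2 * A j i / Q) := by
      rw [div_eq_mul_inv _ (ε ^ 2), div_eq_mul_inv _ (ε ^ 2), div_eq_mul_inv _ (ε ^ 2), hεt]; ring
    rw [this]
    have h1 : |(t ^ 2 * deriv (deriv softLog) t) * (2 * matVec A i v / Q) *
        (2 * matVec A j v / Q)| ≤ C * (64 / N) * (64 / N) := by
      rw [abs_mul, abs_mul]
      exact mul_le_mul (mul_le_mul b2 (hmQ i) (abs_nonneg _) hC) (hmQ j) (abs_nonneg _)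
        (by positivity)
    have h2 : |(t * deriv softLog t) * (2 * A j i / Q)| ≤ C * (32 / N ^ 2) := by
      rw [abs_mul]
      exact mul_le_mul b1 (hAQ i j) (abs_nonneg _) hC
    calc _ ≤ C * (64 / N) * (64 / N) + C * (32 / N ^ 2) := (abs_add_le _ _).trans (add_le_add h1 h2)
      _ = (4128 * C) / N ^ 2 := by field_simp; ring
      _ ≤ _ := by gcongr; linarith

theorem abs_pd_le {f : Plane → ℝ} (i : Fin 2) (z : Plane) : |pd i f z| ≤ ‖fderiv ℝ f z‖ := by
  simpa [pd] using (fderiv ℝ f z).le_opNorm (EuclideanSpace.single i 1)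

/-- The product rule for the divergence form operator. -/
theorem divForm_eq_sum {S : Set Plane} {a : Plane → Matrix (Fin 2) (Fin 2) ℝ} {φ : Plane → ℝ}
    (hS : IsOpen S) (ha : ∀ i j, ContDiffOn ℝ ∞ (fun y => a y i j) S) (hφ : ContDiff ℝ ∞ φ)
    (hz : z ∈ S) : divForm a φ z =
      ∑ i, ∑ j, (pd i (fun w => a w i j) z * pd j φ z + a z i j * pd i (pd j φ) z) := by
  have hd : ∀ i j, DifferentiableAt ℝ (fun w => a w i j) z := fun i j =>
    ((ha i j).contDiffAt (hS.mem_nhds hz)).differentiableAt (by simp)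
  have hd' : ∀ j, DifferentiableAt ℝ (pd j φ) z := fun j =>
    (contDiff_pd hφ j).differentiable (by simp) z
  refine Finset.sum_congr rfl fun i _ => ?_
  rw [pd_sum fun j _ => (hd i j).fun_mul (hd' j)]
  exact Finset.sum_congr rfl fun j _ => pd_mul (hd i j) (hd' j) i

theorem pd_pd_mul {χ Φ : Plane → ℝ} (hχ : ContDiff ℝ ∞ χ) (hΦ : ContDiff ℝ ∞ Φ) (i j : Fin 2) :
    pd i (pd j fun w => χ w * Φ w) z = pd i (pd j χ) z * Φ z + pd j χ z * pd i Φ z +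
      pd i χ z * pd j Φ z + χ z * pd i (pd j Φ) z := by
  have hd : ∀ {f : Plane → ℝ}, ContDiff ℝ ∞ f → ∀ w, DifferentiableAt ℝ f w := fun hf w =>
    hf.differentiable (by simp) w
  have h1 : (pd j fun w => χ w * Φ w) = fun w => pd j χ w * Φ w + χ w * pd j Φ w :=
    funext fun w => pd_mul (hd hχ w) (hd hΦ w) j
  have h2 : pd i (fun w => pd j χ w * Φ w + χ w * pd j Φ w) z =
      pd i (fun w => pd j χ w * Φ w) z + pd i (fun w => χ w * pd j Φ w) z := by
    simp only [pd]
    rw [fderiv_fun_add]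
    · rfl
    · exact (hd (contDiff_pd hχ j) z).fun_mul (hd hΦ z)
    · exact (hd hχ z).fun_mul (hd (contDiff_pd hΦ j) z)
  rw [h1, h2, pd_mul (hd (contDiff_pd hχ j) z) (hd hΦ z),
    pd_mul (hd hχ z) (hd (contDiff_pd hΦ j) z)]
  ring

/-- The parametrix estimate: the operator with variable coefficients, applied to the localised soft
potential whose metric is frozen at `y`, is an approximate delta function at `y` plus an error with
an integrable singularity, uniformly in the scale `ε` and in `y`. -/
theorem exists_parametrix_bound {S K U : Set Plane} {a B : Plane → Matrix (Fin 2) (Fin 2) ℝ}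
    {χ : Plane → ℝ} {ε₀ : ℝ} (hS : IsOpen S) (hK : IsCompact K) (hKc : Convex ℝ K) (hKS : K ⊆ S)
    (hUK : U ⊆ K) (ha : ∀ i j, ContDiffOn ℝ ∞ (fun y => a y i j) S) (hχ : ContDiff ℝ ∞ χ)
    (hB : ∀ y ∈ U, IsElliptic (B y)) (hdet : ∀ y ∈ U, 0 < (B y).det)
    (haB : ∀ y ∈ U, ∀ i j, a y i j = (Real.sqrt (B y).det)⁻¹ * (B y).adjugate i j)
    (hε₀ : ε₀ ≤ 1) (hχU : ∀ y ∈ U, ∀ z, ‖z - y‖ ≤ 2 * ε₀ → χ z = 1) :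
    ∃ C : ℝ, 0 ≤ C ∧ ∀ ε, 0 < ε → ε ≤ ε₀ → ∀ y ∈ U, ∀ z ∈ K, y ≠ z →
      |χ z * softPotential (B y) ε y z| ≤ C / ‖z - y‖ ∧
      |divForm a (fun w => χ w * softPotential (B y) ε y w) z -
        Real.sqrt (B y).det * softDelta (quadForm (B y) (z - y) / ε ^ 2) / ε ^ 2| ≤
        C / ‖z - y‖ := by
  obtain ⟨R, hR⟩ := hK.isBounded.subset_closedBall 0
  obtain ⟨C, hC, hbound⟩ := exists_softPotential_bounds (R + R)
  have hbd : ∀ f : Plane → ℝ, ContinuousOn f K → ∃ L, ∀ z ∈ K, |f z| ≤ L := fun f hf =>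
    hK.exists_bound_of_continuousOn hf
  have h1 : ∃ L, ∀ z ∈ K, |χ z| ≤ L := hbd _ hχ.continuous.continuousOn
  have h2 : ∀ i, ∃ L, ∀ z ∈ K, |pd i χ z| ≤ L := fun i =>
    hbd _ (contDiff_pd hχ i).continuous.continuousOn
  have h3 : ∀ i j, ∃ L, ∀ z ∈ K, |pd i (pd j χ) z| ≤ L := fun i j =>
    hbd _ (contDiff_pd (contDiff_pd hχ j) i).continuous.continuousOn
  have h4 : ∀ i j, ∃ L, ∀ z ∈ K, |a z i j| ≤ L := fun i j =>
    hbd _ ((ha i j).continuousOn.mono hKS)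
  have h5 : ∀ i j, ∃ L, ∀ z ∈ K, ‖fderiv ℝ (fun w => a w i j) z‖ ≤ L := fun i j =>
    hK.exists_bound_of_continuousOn
      (((ha i j).fderiv_of_isOpen hS (m := ∞) (by simp)).continuousOn.mono hKS)
  choose L1 h1 using h1
  choose L2 h2 using h2
  choose L3 h3 using h3
  choose L4 h4 using h4
  choose L5 h5 using h5
  set L := |L1| + ∑ i, |L2 i| + ∑ i, ∑ j, |L3 i j| + ∑ i, ∑ j, |L4 i j| + ∑ i, ∑ j, |L5 i j|
    with hL
  have hs2 : ∀ (F : Fin 2 → Fin 2 → ℝ) i j, |F i j| ≤ ∑ i, ∑ j, |F i j| := fun F i j =>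
    (Finset.single_le_sum (f := fun j => |F i j|) (fun _ _ => abs_nonneg _)
      (Finset.mem_univ j)).trans
      (Finset.single_le_sum (f := fun i => ∑ j, |F i j|)
        (fun _ _ => Finset.sum_nonneg fun _ _ => abs_nonneg _) (Finset.mem_univ i))
  have hs1 : ∀ (F : Fin 2 → ℝ) i, |F i| ≤ ∑ i, |F i| := fun F i =>
    Finset.single_le_sum (f := fun j => |F j|) (fun _ _ => abs_nonneg _) (Finset.mem_univ i)
  have p1 : 0 ≤ |L1| := abs_nonneg _
  have p2 : 0 ≤ ∑ i, |L2 i| := Finset.sum_nonneg fun _ _ => abs_nonneg _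
  have pp : ∀ F : Fin 2 → Fin 2 → ℝ, 0 ≤ ∑ i, ∑ j, |F i j| := fun F =>
    Finset.sum_nonneg fun _ _ => Finset.sum_nonneg fun _ _ => abs_nonneg _
  have p3 := pp L3
  have p4 := pp L4
  have p5 := pp L5
  have hL0 : 0 ≤ L := by positivity
  have g1 : ∀ z ∈ K, |χ z| ≤ L := fun z hz => by linarith [h1 z hz, le_abs_self L1]
  have g2 : ∀ i, ∀ z ∈ K, |pd i χ z| ≤ L := fun i z hz => by
    linarith [h2 i z hz, le_abs_self (L2 i), hs1 L2 i]
  have g3 : ∀ i j, ∀ z ∈ K, |pd i (pd j χ) z| ≤ L := fun i j z hz => by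
    linarith [h3 i j z hz, le_abs_self (L3 i j), hs2 L3 i j]
  have g4 : ∀ i j, ∀ z ∈ K, |a z i j| ≤ L := fun i j z hz => by
    linarith [h4 i j z hz, le_abs_self (L4 i j), hs2 L4 i j]
  have g5 : ∀ i j, ∀ z ∈ K, ‖fderiv ℝ (fun w => a w i j) z‖ ≤ L := fun i j z hz => by
    linarith [h5 i j z hz, le_abs_self (L5 i j), hs2 L5 i j]
  have g6 : ∀ i j, ∀ y ∈ K, ∀ z ∈ K, |a z i j - a y i j| ≤ L * ‖z - y‖ := fun i j y hy z hz =>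
    hKc.norm_image_sub_le_of_norm_fderiv_le (f := fun w => a w i j)
      (fun w hw => ((ha i j).contDiffAt (hS.mem_nhds (hKS hw))).differentiableAt (by simp))
      (g5 i j) hy hz
  clear_value L
  refine ⟨L * C + 24 * L ^ 2 * C, by positivity, fun ε hε hεε y hy z hz hyz => ?_⟩
  have hN0 : 0 < ‖z - y‖ := norm_pos_iff.2 (sub_ne_zero.2 hyz.symm)
  have hNR : ‖z - y‖ ≤ R + R := by
    have e1 := hR hz
    have e2 := hR (hUK hy)
    rw [mem_closedBall_zero_iff] at e1 e2
    exact (norm_sub_le _ _).trans (add_le_add e1 e2)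
  obtain ⟨k1, k2, k3⟩ := hbound (B y) (hB y hy) ε hε (hεε.trans hε₀) y z hyz hNR
  have hsm := contDiff_softPotential (B y) ε y
  have hlap := sum_adjugate_pd_pd_softPotential (y := y) (z := z) (hB y hy).symm (hdet y hy) hε
  -- Where the frozen Laplacian does not vanish, `z` is so close to `y` that `χ z = 1`.
  have hcut : (χ z - 1) * (Real.sqrt (B y).det *
      softDelta (quadForm (B y) (z - y) / ε ^ 2) / ε ^ 2) = 0 := by
    rcases le_or_gt (quadForm (B y) (z - y) / ε ^ 2) 1 with h | h
    · rw [div_le_one (by positivity)] at h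
      have := (hB y hy).le_quadForm (z - y)
      rw [hχU y hy z (by nlinarith), sub_self, zero_mul]
    · rw [softDelta_of_one_lt h]; simp
  set Φ := softPotential (B y) ε y
  set N := ‖z - y‖ with hN
  have hCN : 0 ≤ C / N := by positivity
  constructor
  · rw [abs_mul]
    calc _ ≤ L * (C / N) := mul_le_mul (g1 z hz) k1 (abs_nonneg _) hL0
      _ = (L * C) / N := by ring
      _ ≤ _ := div_le_div_of_nonneg_right (by nlinarith [mul_nonneg (sq_nonneg L) hC]) hN0.le
  · set E : Fin 2 → Fin 2 → ℝ := fun i j =>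
      pd i (fun w => a w i j) z * (pd j χ z * Φ z + χ z * pd j Φ z) +
      a z i j * (pd i (pd j χ) z * Φ z + pd j χ z * pd i Φ z + pd i χ z * pd j Φ z) +
      χ z * (a z i j - a y i j) * pd i (pd j Φ) z with hE
    have hdiff : divForm a (fun w => χ w * Φ w) z -
        Real.sqrt (B y).det * softDelta (quadForm (B y) (z - y) / ε ^ 2) / ε ^ 2 =
        ∑ i, ∑ j, E i j := by
      have e1 : χ z * ∑ i, ∑ j, a y i j * pd i (pd j Φ) z = Real.sqrt (B y).det *
          softDelta (quadForm (B y) (z - y) / ε ^ 2) / ε ^ 2 := by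
        simp only [haB y hy, hlap]
        linarith
      rw [← e1, divForm_eq_sum hS ha (hχ.mul hsm) (hKS hz), Finset.mul_sum,
        ← Finset.sum_sub_distrib]
      refine Finset.sum_congr rfl fun i _ => ?_
      rw [Finset.mul_sum, ← Finset.sum_sub_distrib]
      refine Finset.sum_congr rfl fun j _ => ?_
      rw [pd_pd_mul hχ hsm, pd_mul (hχ.differentiable (by simp) z) (hsm.differentiable (by simp) z)]
      simp only [hE]
      ring
    have hEb : ∀ i j, |E i j| ≤ 6 * (L * (L * (C / N))) := by
      intro i j
      have m2 : ∀ {s t : ℝ}, |s| ≤ L → |t| ≤ C / N → |s * t| ≤ L * (C / N) := fun h h' => by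
        rw [abs_mul]; exact mul_le_mul h h' (abs_nonneg _) hL0
      have m3 : ∀ {s t u : ℝ}, |s| ≤ L → |t| ≤ u → |s * t| ≤ L * u := fun h h' => by
        rw [abs_mul]; exact mul_le_mul h h' (abs_nonneg _) hL0
      have n1 : |pd i (fun w => a w i j) z| ≤ L := (abs_pd_le i z).trans (g5 i j z hz)
      have t1 : |pd j χ z * Φ z + χ z * pd j Φ z| ≤ 2 * (L * (C / N)) := by
        linarith [abs_add_le (pd j χ z * Φ z) (χ z * pd j Φ z), m2 (g2 j z hz) k1,
          m2 (g1 z hz) (k2 j)]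
      have t2 : |pd i (pd j χ) z * Φ z + pd j χ z * pd i Φ z + pd i χ z * pd j Φ z| ≤
          3 * (L * (C / N)) := by
        linarith [abs_add_three (pd i (pd j χ) z * Φ z) (pd j χ z * pd i Φ z)
          (pd i χ z * pd j Φ z), m2 (g3 i j z hz) k1, m2 (g2 j z hz) (k2 i), m2 (g2 i z hz) (k2 j)]
      -- The second derivatives are of order `N ^ (-2)`, but the coefficients are Lipschitz.
      have t3 : |(a z i j - a y i j) * pd i (pd j Φ) z| ≤ L * (C / N) := by
        rw [abs_mul]
        calc _ ≤ (L * N) * (C / N ^ 2) := mul_le_mul (g6 i j y (hUK hy) z hz) (k3 i j)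
              (abs_nonneg _) (by positivity)
          _ = _ := by field_simp
      have q1 := m3 n1 t1
      have q2 := m3 (g4 i j z hz) t2
      have q3 := m3 (g1 z hz) t3
      simp only [hE, mul_assoc (χ z)]
      refine (abs_add_three _ _ _).trans ?_
      linarith
    rw [hdiff]
    calc |∑ i, ∑ j, E i j| ≤ ∑ i, ∑ j, |E i j| := (Finset.abs_sum_le_sum_abs _ _).trans
          (Finset.sum_le_sum fun i _ => Finset.abs_sum_le_sum_abs _ _)
      _ ≤ ∑ _i : Fin 2, ∑ _j : Fin 2, 6 * (L * (L * (C / N))) :=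
          Finset.sum_le_sum fun i _ => Finset.sum_le_sum fun j _ => hEb i j
      _ = (24 * L ^ 2 * C) / N := by simp; ring
      _ ≤ _ := div_le_div_of_nonneg_right (by nlinarith [mul_nonneg hL0 hC]) hN0.le

end SoftPotential

/-! ### Convergence to the point mass -/

section ApproximateDelta

/-- The divergence form operator with coefficients frozen at `y`, applied to the soft potential: an
approximate delta function at `y`, of mass `2π`. -/
noncomputable def approxDelta (A : Matrix (Fin 2) (Fin 2) ℝ) (ε : ℝ) (y z : Plane) : ℝ :=
  Real.sqrt A.det * softDelta (quadForm A (z - y) / ε ^ 2) / ε ^ 2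

theorem continuous_approxDelta (A : Matrix (Fin 2) (Fin 2) ℝ) (ε : ℝ) (y : Plane) :
    Continuous (approxDelta A ε y) :=
  (continuous_const.mul (continuous_softDelta.comp
    ((contDiff_quadForm_sub A y).continuous.div_const _))).div_const _

theorem approxDelta_eq_zero {A : Matrix (Fin 2) (Fin 2) ℝ} (hA : IsElliptic A) {ε : ℝ} (hε : 0 < ε)
    {y z : Plane} (h : 2 * ε < ‖z - y‖) : approxDelta A ε y z = 0 := by
  have h1 := hA.le_quadForm (z - y)
  rw [approxDelta, softDelta_of_one_lt]
  · simp
  · rw [lt_div_iff₀ (by positivity)]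
    nlinarith

/-- Since `approxDelta` has mass `2π` and is of size `ε ^ (-2)` on a disc of radius `2 ε`, it converges
to `2π` times a point mass at every Lebesgue point. -/
theorem tendsto_integral_approxDelta {H : Plane → ℝ} (hH : Integrable H) :
    ∀ᵐ y : Plane, ∀ A, IsElliptic A → 0 < A.det →
      Tendsto (fun ε => ∫ z, H z * approxDelta A ε y z) (𝓝[>] 0) (𝓝 (2 * Real.pi * H y)) := by
  obtain ⟨C, hC, hb⟩ := exists_softLog_bounds
  filter_upwards [IsUnifLocDoublingMeasure.ae_tendsto_average_norm_sub (volume : Measure Plane)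
    hH.locallyIntegrable 1] with y hy A hA hdet
  have hδ : Tendsto (fun ε : ℝ => 2 * ε) (𝓝[>] 0) (𝓝[>] 0) := by
    refine tendsto_nhdsWithin_iff.2 ⟨?_, ?_⟩
    · have : Tendsto (fun ε : ℝ => 2 * ε) (𝓝 0) (𝓝 (2 * 0)) := tendsto_id.const_mul 2
      rw [mul_zero] at this
      exact this.mono_left nhdsWithin_le_nhds
    · filter_upwards [self_mem_nhdsWithin] with ε hε
      exact mul_pos two_pos (mem_Ioi.1 hε)
  have hav := hy (fun _ : ℝ => y) (fun ε => 2 * ε) hδ (by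
    filter_upwards [self_mem_nhdsWithin] with ε hε
    exact Metric.mem_closedBall_self (by have : 0 < ε := hε; positivity))
  rw [tendsto_iff_norm_sub_tendsto_zero]
  have hlim := hav.const_mul (Real.sqrt A.det * C * (4 * Real.pi))
  rw [mul_zero] at hlim
  refine squeeze_zero' (Eventually.of_forall fun _ => norm_nonneg _) ?_ hlim
  filter_upwards [self_mem_nhdsWithin] with ε hε
  replace hε : 0 < ε := hε
  have h00 : 0 < A 0 0 := by
    have h1 := hA.le_quadForm (EuclideanSpace.single 0 1)
    simp [quadForm] at h1
    linarith
  have hint : ∫ z, approxDelta A ε y z = 2 * Real.pi :=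
    integral_softDelta_quadForm hA.symm h00 hdet hε y
  have hwi : Integrable (approxDelta A ε y) :=
    Integrable.of_integral_ne_zero (by rw [hint]; positivity)
  have hwb : ∀ z, |approxDelta A ε y z| ≤ Real.sqrt A.det * C / ε ^ 2 := by
    intro z
    have h2 : 0 ≤ quadForm A (z - y) / ε ^ 2 :=
      div_nonneg ((by positivity : (0 : ℝ) ≤ ‖z - y‖ ^ 2 / 4).trans (hA.le_quadForm _))
        (by positivity)
    rw [approxDelta, abs_div, abs_mul, abs_of_nonneg (Real.sqrt_nonneg _),
      abs_of_pos (by positivity : 0 < ε ^ 2)]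
    exact div_le_div_of_nonneg_right (mul_le_mul_of_nonneg_left (hb _ h2).2.2.1
      (Real.sqrt_nonneg _)) (by positivity)
  have hHw : Integrable fun z => H z * approxDelta A ε y z :=
    hH.mul_bdd (c := Real.sqrt A.det * C / ε ^ 2)
      (continuous_approxDelta A ε y).aestronglyMeasurable (Eventually.of_forall hwb)
  have heq : (∫ z, H z * approxDelta A ε y z) - 2 * Real.pi * H y =
      ∫ z in Metric.closedBall y (2 * ε), (H z - H y) * approxDelta A ε y z := by
    rw [setIntegral_eq_integral_of_forall_compl_eq_zero, ← hint, mul_comm _ (H y),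
      ← integral_const_mul, ← integral_sub hHw (hwi.const_mul _)]
    · simp only [sub_mul]
    · intro z hz
      rw [Metric.mem_closedBall, dist_eq_norm, not_le] at hz
      rw [approxDelta_eq_zero hA hε hz, mul_zero]
  have hfin : volume (Metric.closedBall y (2 * ε)) ≠ ⊤ :=
    measure_closedBall_lt_top.ne
  have hvol : (volume : Measure Plane).real (Metric.closedBall y (2 * ε)) =
      4 * Real.pi * ε ^ 2 := by
    rw [Measure.real, EuclideanSpace.volume_closedBall_fin_two, ENNReal.toReal_mul,
      ENNReal.toReal_pow, ENNReal.toReal_ofReal (by positivity)]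
    rw [ENNReal.toReal_ofReal Real.pi_pos.le]
    ring
  have hHi : IntegrableOn (fun z => H z - H y) (Metric.closedBall y (2 * ε)) :=
    hH.integrableOn.sub (integrableOn_const hfin)
  rw [heq]
  calc ‖∫ z in Metric.closedBall y (2 * ε), (H z - H y) * approxDelta A ε y z‖
      ≤ ∫ z in Metric.closedBall y (2 * ε), ‖(H z - H y) * approxDelta A ε y z‖ :=
        norm_integral_le_integral_norm _
    _ ≤ ∫ z in Metric.closedBall y (2 * ε), (Real.sqrt A.det * C / ε ^ 2) * ‖H z - H y‖ := by
        refine integral_mono_of_nonneg (Eventually.of_forall fun _ => norm_nonneg _)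
          (hHi.norm.const_mul _) (Eventually.of_forall fun z => ?_)
        simp only [norm_mul]
        rw [mul_comm]
        exact mul_le_mul_of_nonneg_right (hwb z) (norm_nonneg _)
    _ = Real.sqrt A.det * C * (4 * Real.pi) * ⨍ z in Metric.closedBall y (2 * ε), ‖H z - H y‖ := by
        rw [integral_const_mul, setAverage_eq, hvol, smul_eq_mul]
        field_simp

end ApproximateDelta

/-! ### The parametrix on the surface -/

section LocalParametrix

variable {M : Type*} [MetricSpace M] [ChartedSpace Plane M] [IsManifold 𝓘(ℝ, Plane) ∞ M]
  [RiemannianBundle (fun x : M => TangentSpace 𝓘(ℝ, Plane) x)]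
  [IsContMDiffRiemannianBundle 𝓘(ℝ, Plane) ∞ Plane (fun x : M => TangentSpace 𝓘(ℝ, Plane) x)]
  [IsRiemannianManifold 𝓘(ℝ, Plane) M]
  [CompactSpace M] [Nonempty M] [MeasurableSpace M] [BorelSpace M]
  {e : OpenPartialHomeomorph M Plane}

/-- In a chart with distortion at most `2` the matrix of the metric is of order one. -/
theorem isElliptic_metricMatrix {y : Plane} (h1 : ∀ v : Plane, (1 / 2) * ‖v‖ ≤ ‖coordVector e y v‖)
    (h2 : ∀ v : Plane, ‖coordVector e y v‖ ≤ (3 / 2) * ‖v‖) : IsElliptic (metricMatrix e y) where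
  symm := metricMatrix_comm e y 1 0
  abs_le i j := (abs_metricMatrix_le h2 i j).trans (by norm_num)
  le_quadForm v := by
    rw [quadForm, ← norm_sq_coordVector]
    have := pow_le_pow_left₀ (by positivity) (h1 v) 2
    linarith
  quadForm_le v := by
    rw [quadForm, ← norm_sq_coordVector]
    have := pow_le_pow_left₀ (norm_nonneg _) (h2 v) 2
    nlinarith [sq_nonneg ‖v‖]

theorem abs_half_log_sub_log_le {Q d : ℝ} (hd : 0 < d) (h1 : d ^ 2 / 16 ≤ Q) (h2 : Q ≤ 16 * d ^ 2) :
    |Real.log Q / 2 - Real.log d| ≤ 2 := by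
  have hQ : 0 < Q := lt_of_lt_of_le (by positivity) h1
  have h16 : Real.log 16 ≤ 4 := by
    rw [show (16 : ℝ) = 2 ^ 4 by norm_num, Real.log_pow]
    have := Real.log_two_lt_d9
    push_cast
    linarith
  have l1 := Real.log_le_log (by positivity) h1
  have l2 := Real.log_le_log hQ h2
  rw [Real.log_div (by positivity) (by norm_num), Real.log_pow] at l1
  rw [Real.log_mul (by norm_num) (by positivity), Real.log_pow] at l2
  push_cast at l1 l2
  rw [abs_le]
  constructor <;> linarith

/-- Near every point there are smooth functions `η x ε` with a logarithmic singularity at `x`,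
smoothed out at the scale `ε`, whose Laplacians `f x ε` are approximate delta functions `k x ε` up to
an error of the order of the inverse distance to `x`. -/
theorem exists_local_parametrix (q : M) : ∃ C : ℝ, 0 ≤ C ∧ ∃ δ > 0, ∃ η f k : M → ℝ → M → ℝ,
    (∀ x, dist x q < δ → (∀ᶠ ε in 𝓝[>] (0 : ℝ),
      ContMDiff 𝓘(ℝ, Plane) 𝓘(ℝ, ℝ) ∞ (η x ε) ∧ IsLaplacian (η x ε) (f x ε) ∧
      Continuous (k x ε) ∧
      ∀ z, z ≠ x → |η x ε z| ≤ C / dist z x ∧ |f x ε z - k x ε z| ≤ C / dist z x) ∧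
      ∀ z, z ≠ x → ∀ᶠ ε in 𝓝[>] (0 : ℝ), |η x ε z - Real.log (dist z x)| ≤ C) ∧
    ∀ G : M → ℝ, Integrable G (riemannianVolume M) → ∀ᵐ x ∂(riemannianVolume M), dist x q < δ →
      Tendsto (fun ε => ∫ z, G z * k x ε z ∂(riemannianVolume M)) (𝓝[>] 0)
        (𝓝 (2 * Real.pi * G x)) := by
  obtain ⟨e, he, hq, r, hr, hre, hell, hsymm, hcomp⟩ :=
    exists_comparison_chart (M := M) q (ε := 1 / 2) (by norm_num) (by norm_num)
  set c := e q with hc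
  have hell' : ∀ y ∈ Metric.ball c r, IsElliptic (metricMatrix e y) := fun y hy =>
    isElliptic_metricMatrix (fun v => by have := (hell y hy v).1; norm_num at this ⊢; exact this)
      (fun v => by have := (hell y hy v).2; norm_num at this ⊢; exact this)
  obtain ⟨δ, hδ, hδc⟩ := hcomp (r / 8) (by positivity)
  set χ : ContDiffBump c := ⟨r / 4, r / 2, by positivity, by linarith⟩ with hχ
  have hχs : tsupport χ = Metric.closedBall c (r / 2) := χ.tsupport_eq
  have hχ1 : ∀ y ∈ Metric.ball c (r / 4), χ y = 1 := fun y hy =>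
    χ.one_of_mem_closedBall (Metric.ball_subset_closedBall hy)
  set K := Metric.closedBall c (r / 2)
  have hKr : K ⊆ Metric.ball c r := Metric.closedBall_subset_ball (by linarith)
  have hKe : K ⊆ e.target := hKr.trans hre
  have hKc : IsCompact K := isCompact_closedBall _ _
  set U := Metric.ball c (r / 8)
  have hUK : U ⊆ K := Metric.ball_subset_closedBall.trans
    (Metric.closedBall_subset_closedBall (by linarith))
  set ε₀ := min 1 (r / 32) with hε₀
  have hε₀p : 0 < ε₀ := lt_min one_pos (by positivity)
  have hε₀r : ε₀ ≤ r / 32 := min_le_right _ _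
  have hUnear : ∀ y ∈ U, ∀ z, ‖z - y‖ ≤ 2 * ε₀ → z ∈ Metric.ball c (r / 4) := by
    intro y hy z hz
    rw [Metric.mem_ball, dist_eq_norm] at hy ⊢
    have : z - c = (z - y) + (y - c) := by abel
    rw [this]
    linarith [norm_add_le (z - y) (y - c)]
  obtain ⟨C, hC, hpar⟩ := exists_parametrix_bound (S := e.target) (K := K) (U := U)
    (a := fluxCoeff e) (B := metricMatrix e) (χ := χ) (ε₀ := ε₀) e.open_target hKc
    (convex_closedBall _ _) hKe hUK (contDiffOn_fluxCoeff he) χ.contDiff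
    (fun y hy => hell' y (hKr (hUK hy))) (fun y hy => det_metricMatrix_pos he (hKe (hUK hy)))
    (fun y _ i j => rfl) (min_le_left _ _) (fun y hy z hz => hχ1 z (hUnear y hy z hz))
  set φ : M → ℝ → Plane → ℝ := fun x ε w => χ w * softPotential (metricMatrix e (e x)) ε (e x) w
    with hφ
  have hφs : ∀ x ε, ContDiff ℝ ∞ (φ x ε) := fun x ε =>
    χ.contDiff.mul (contDiff_softPotential _ _ _)
  have hφt : ∀ x ε, tsupport (φ x ε) ⊆ K := fun x ε =>
    (closure_mono (Function.support_mul_subset_left _ _)).trans hχs.le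
  have hφc : ∀ x ε, HasCompactSupport (φ x ε) := fun x ε =>
    hKc.of_isClosed_subset (isClosed_tsupport _) (hφt x ε)
  have hsd : ∀ w ∈ K, 1 / 4 ≤ Real.sqrt (metricMatrix e w).det := by
    intro w hw
    refine Real.le_sqrt_of_sq_le ?_
    have := pow_four_le_det_metricMatrix (e := e) (y := w) (k := 1 / 2) (by norm_num)
      (fun v => by have := (hell w (hKr hw) v).1; norm_num at this ⊢; exact this)
    norm_num at this ⊢
    exact this
  set k : M → ℝ → M → ℝ := fun x ε => chartExtend e fun w =>
    approxDelta (metricMatrix e (e x)) ε (e x) w / Real.sqrt (metricMatrix e w).det with hk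
  set D := Metric.diam (univ : Set M)
  have hD : ∀ x z : M, dist x z ≤ D := fun x z =>
    Metric.dist_le_diam_of_mem isCompact_univ.isBounded (mem_univ _) (mem_univ _)
  have hxU : ∀ x, dist x q < δ → x ∈ e.source ∧ e x ∈ U := fun x hx =>
    have h := hδc x x hx (by rwa [dist_self])
    ⟨h.1, h.2.2.1⟩
  have hdist : ∀ x, dist x q < δ → ∀ z ∈ e.source, e z ∈ K → z ≠ x →
      e x ≠ e z ∧ (‖e z - e x‖)⁻¹ ≤ 2 * (dist z x)⁻¹ ∧ dist z x ≤ 2 * ‖e z - e x‖ := by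
    intro x hx z hz hzK hzx
    obtain ⟨hxs, hxu⟩ := hxU x hx
    have hne : e x ≠ e z := fun h => hzx (e.injOn hz hxs h.symm)
    have h1 := hsymm (e z) (hKr hzK) (e x) (hKr (hUK hxu))
    rw [e.left_inv hz, e.left_inv hxs] at h1
    have hN : 0 < ‖e z - e x‖ := norm_pos_iff.2 (sub_ne_zero.2 hne.symm)
    have hd : 0 < dist z x := dist_pos.2 hzx
    have h2 : dist z x ≤ 2 * ‖e z - e x‖ := by linarith
    refine ⟨hne, ?_, h2⟩
    rw [inv_le_comm₀ hN (by positivity), mul_inv, inv_inv]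
    linarith
  have hη : ∀ x, dist x q < δ → ∀ ε, 0 < ε → ε ≤ ε₀ → ∀ z, z ≠ x →
      |chartExtend e (φ x ε) z| ≤ 2 * C / dist z x := by
    intro x hx ε hε hεε z hzx
    have hp : 0 ≤ 2 * C / dist z x := by positivity
    by_cases hz : z ∈ e.source
    · rw [chartExtend_of_mem hz]
      by_cases hzK : e z ∈ K
      · obtain ⟨hne, h1, -⟩ := hdist x hx z hz hzK hzx
        refine ((hpar ε hε hεε (e x) (hxU x hx).2 (e z) hzK hne).1).trans ?_
        rw [div_eq_mul_inv, div_eq_mul_inv]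
        nlinarith
      · rwa [image_eq_zero_of_notMem_tsupport fun h => hzK (hφt x ε h), abs_zero]
    · rwa [chartExtend, indicator_of_notMem hz, abs_zero]
  have hfar : ∀ x, dist x q < δ → ∀ ε, 0 < ε → ε ≤ ε₀ → ∀ w, w ∉ K →
      approxDelta (metricMatrix e (e x)) ε (e x) w = 0 := by
    intro x hx ε hε hεε w hw
    refine approxDelta_eq_zero (hell' _ (hKr (hUK (hxU x hx).2))) hε (not_le.1 fun h => hw ?_)
    exact Metric.closedBall_subset_closedBall (by linarith) (Metric.ball_subset_closedBall
      (hUnear (e x) (hxU x hx).2 w (by linarith)))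
  have hkc : ∀ x, dist x q < δ → ∀ ε, 0 < ε → ε ≤ ε₀ → Continuous (k x ε) := by
    intro x hx ε hε hεε
    refine continuous_chartExtend hKc hKe (fun w hw => ?_) ?_
    · rw [hfar x hx ε hε hεε w hw, zero_div]
    · exact (continuous_approxDelta _ _ _).continuousOn.div (contDiffOn_sqrt_det he).continuousOn
        fun w hw => (sqrt_det_pos he hw).ne'
  have hsmall : ∀ᶠ ε in 𝓝[>] (0 : ℝ), 0 < ε ∧ ε ≤ ε₀ := by
    filter_upwards [Ioc_mem_nhdsGT hε₀p] with ε hε using hε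
  refine ⟨8 * C + 2 + 2 * C / δ + |Real.log δ| + |Real.log D|, by positivity, δ, hδ,
    fun x ε => chartExtend e (φ x ε), fun x ε => chartExtend e fun w =>
      divForm (fluxCoeff e) (φ x ε) w / Real.sqrt (metricMatrix e w).det, k,
    fun x hx => ⟨?_, ?_⟩, ?_⟩
  · filter_upwards [hsmall] with ε ⟨hε, hεε⟩
    refine ⟨contMDiff_chartExtend he (hφs x ε) (hφc x ε) ((hφt x ε).trans hKe),
      isLaplacian_chartExtend he (hφs x ε) (hφc x ε) ((hφt x ε).trans hKe),
      hkc x hx ε hε hεε, fun z hzx => ?_⟩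
    have hd : 0 < dist z x := dist_pos.2 hzx
    have hp : 0 ≤ 2 * C / δ + |Real.log δ| + |Real.log D| := by positivity
    have hle : 8 * C / dist z x ≤
        (8 * C + 2 + 2 * C / δ + |Real.log δ| + |Real.log D|) / dist z x :=
      div_le_div_of_nonneg_right (by linarith) hd.le
    refine ⟨(hη x hx ε hε hεε z hzx).trans
      ((div_le_div_of_nonneg_right (by linarith) hd.le).trans hle), le_trans ?_ hle⟩
    have hp : 0 ≤ 8 * C / dist z x := by positivity
    by_cases hz : z ∈ e.source
    · simp only [hk, chartExtend_of_mem hz]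
      by_cases hzK : e z ∈ K
      · obtain ⟨hne, h1, -⟩ := hdist x hx z hz hzK hzx
        have h2 := (hpar ε hε hεε (e x) (hxU x hx).2 (e z) hzK hne).2
        have h3 := hsd (e z) hzK
        rw [← sub_div, abs_div, abs_of_nonneg (Real.sqrt_nonneg _), div_le_iff₀ (by linarith)]
        have h4 : C / ‖e z - e x‖ ≤ 2 * C / dist z x := by
          rw [div_eq_mul_inv, div_eq_mul_inv]
          nlinarith
        have h5 : 2 * C / dist z x ≤ 8 * C / dist z x * Real.sqrt (metricMatrix e (e z)).det := by
          have : 8 * C / dist z x * (1 / 4) = 2 * C / dist z x := by ring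
          nlinarith
        exact h2.trans (h4.trans h5)
      · rw [divForm_eq_zero fun h => hzK (hφt x ε h), hfar x hx ε hε hεε _ hzK]
        simpa using hp
    · simp only [hk, chartExtend, indicator_of_notMem hz]
      simpa using hp
  · intro z hzx
    have hd : 0 < dist z x := dist_pos.2 hzx
    have hp1 : 0 ≤ 2 * C / δ := by positivity
    have hp2 := abs_nonneg (Real.log δ)
    have hp3 := abs_nonneg (Real.log D)
    rcases lt_or_ge (dist z x) δ with h | h
    · obtain ⟨hxs, hzs, hxu, hzu, hNd⟩ := hδc x z hx (by rwa [dist_comm])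
      obtain ⟨hne, -, hdN⟩ := hdist x hx z hzs (hUK hzu) hzx
      have hell1 := hell' _ (hKr (hUK hxu))
      have hQ1 := hell1.le_quadForm (e z - e x)
      have hQ2 := hell1.quadForm_le (e z - e x)
      rw [norm_sub_rev, dist_comm x z] at hNd
      have hN : 0 < ‖e z - e x‖ := norm_pos_iff.2 (sub_ne_zero.2 hne.symm)
      filter_upwards [hsmall, Ioc_mem_nhdsGT (show 0 < ‖e z - e x‖ / 2 by positivity)]
        with ε ⟨hε, hεε⟩ hεN
      have hχz : χ (e z) = 1 := hχ1 _ (Metric.ball_subset_ball (by linarith) hzu)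
      simp only [chartExtend_of_mem hzs, hφ, hχz, one_mul, softPotential]
      set Q := quadForm (metricMatrix e (e x)) (e z - e x)
      have hQ0 : 0 < Q := lt_of_lt_of_le (by positivity) hQ1
      have hQε : 1 ≤ Q / ε ^ 2 := by
        rw [le_div_iff₀ (by positivity), one_mul]
        nlinarith [hεN.2]
      have hval : softLog (Q / ε ^ 2) + Real.log ε = Real.log Q / 2 := by
        rw [softLog_of_one_le hQε, Real.log_div hQ0.ne' (by positivity), Real.log_pow]
        push_cast
        ring
      rw [hval]
      refine (abs_half_log_sub_log_le hd (by nlinarith) (by nlinarith)).trans ?_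
      linarith
    · filter_upwards [hsmall] with ε ⟨hε, hεε⟩
      have h1 := hη x hx ε hε hεε z hzx
      have h2 : 2 * C / dist z x ≤ 2 * C / δ := div_le_div_of_nonneg_left (by positivity) hδ h
      have h3 : |Real.log (dist z x)| ≤ |Real.log δ| + |Real.log D| := by
        have l1 := Real.log_le_log hδ h
        have l2 := Real.log_le_log hd (hD z x)
        rw [abs_le]
        constructor
        · linarith [neg_abs_le (Real.log δ)]
        · linarith [le_abs_self (Real.log D)]
      refine (abs_sub _ _).trans ?_
      linarith
  · intro G hG
    set H : Plane → ℝ := K.indicator fun w => G (e.symm w)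
    have hHi : Integrable H := by
      refine (integrable_indicator_iff hKc.measurableSet).2 ?_
      have h1 := ((integrableOn_chart he hG.integrableOn).mono_set hKe).continuousOn_mul
        (g := fun w => (Real.sqrt (metricMatrix e w).det)⁻¹)
        (((contDiffOn_sqrt_det he).continuousOn.inv₀ fun w hw => (sqrt_det_pos he hw).ne').mono hKe)
        hKc
      refine h1.congr_fun (fun w hw => ?_) hKc.measurableSet
      have := sqrt_det_pos he (hKe hw)
      simp only
      field_simp
    have hae : ∀ᵐ x ∂((riemannianVolume M).restrict e.source), dist x q < δ →
        Tendsto (fun ε => ∫ z, G z * k x ε z ∂(riemannianVolume M)) (𝓝[>] 0)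
          (𝓝 (2 * Real.pi * G x)) := by
      refine ae_chart_of_ae he ?_
      filter_upwards [ae_restrict_of_ae (tendsto_integral_approxDelta hHi),
        ae_restrict_mem e.open_target.measurableSet] with y hy hyt hx
      obtain ⟨-, hyU⟩ := hxU _ hx
      rw [e.right_inv hyt] at hyU
      have hyK := hUK hyU
      have h1 := hy (metricMatrix e y) (hell' _ (hKr hyK)) (det_metricMatrix_pos he hyt)
      rw [show H y = G (e.symm y) from indicator_of_mem hyK _] at h1
      refine h1.congr' ?_
      filter_upwards [hsmall] with ε ⟨hε, hεε⟩
      have hk0 : ∀ z, z ∉ e.source → G z * k (e.symm y) ε z = 0 := fun z hz => by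
        simp only [hk, chartExtend, indicator_of_notMem hz, mul_zero]
      have hH0 : ∀ w, w ∉ e.target → H w * approxDelta (metricMatrix e y) ε y w = 0 := fun w hw => by
        rw [show H w = 0 from indicator_of_notMem (fun h => hw (hKe h)) _, zero_mul]
      rw [← setIntegral_eq_integral_of_forall_compl_eq_zero hk0,
        ← setIntegral_eq_integral_of_forall_compl_eq_zero hH0,
        setIntegral_chart he (f := fun z => G z * k (e.symm y) ε z)
          (hG.aestronglyMeasurable.restrict.mul
            (hkc _ hx ε hε hεε).aestronglyMeasurable)]
      refine setIntegral_congr_fun e.open_target.measurableSet fun w hw => ?_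
      simp only [hk, chartExtend_symm hw, e.right_inv hyt]
      have := sqrt_det_pos he hw
      by_cases hwK : w ∈ K
      · rw [show H w = G (e.symm w) from indicator_of_mem hwK _]
        field_simp
      · have := hfar _ hx ε hε hεε w hwK
        rw [e.right_inv hyt] at this
        rw [this]
        simp
    filter_upwards [(ae_restrict_iff' e.open_source.measurableSet).1 hae] with x hx hxq
    exact hx (hxU x hxq).1 hxq

end LocalParametrix

/-! ### Elementary inequalities for singular kernels -/

section RealInequalities

theorem rpow_neg_three_half {d : ℝ} (hd : 0 < d) :
    d ^ (-(3 / 2) : ℝ) = (Real.sqrt d)⁻¹ ^ 3 := by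
  rw [Real.sqrt_eq_rpow, ← Real.rpow_neg hd.le, ← Real.rpow_mul_natCast hd.le]
  norm_num

theorem inv_eq_inv_sqrt_sq {d : ℝ} (hd : 0 < d) : d⁻¹ = (Real.sqrt d)⁻¹ ^ 2 := by
  rw [inv_pow, Real.sq_sqrt hd.le]

theorem mul_sq_le_cube_add_cube {A B : ℝ} (hA : 0 ≤ A) (hB : 0 ≤ B) :
    A * B ^ 2 ≤ A ^ 3 + B ^ 3 := by
  rcases le_total A B with h | h
  · nlinarith [mul_le_mul_of_nonneg_right h (sq_nonneg B), pow_nonneg hA 3]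
  · nlinarith [mul_le_mul_of_nonneg_left (pow_le_pow_left₀ hB h 2) hA, pow_nonneg hB 3]

/-- The composition of two kernels `1 / d` is of the order `d ^ (-1/2)`, up to integrable factors: the
larger of `a` and `b` is at least `d / 2`. -/
theorem inv_mul_inv_le {a b d : ℝ} (ha : 0 < a) (hb : 0 < b) (hd : 0 < d) (hdab : d ≤ a + b) :
    a⁻¹ * b⁻¹ ≤ 2 * (Real.sqrt d)⁻¹ * (a ^ (-(3 / 2) : ℝ) + b ^ (-(3 / 2) : ℝ)) := by
  have key : ∀ {a b : ℝ}, 0 < a → 0 < b → d ≤ a + b → b ≤ a →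
      a⁻¹ * b⁻¹ ≤ 2 * (Real.sqrt d)⁻¹ * (a ^ (-(3 / 2) : ℝ) + b ^ (-(3 / 2) : ℝ)) := by
    intro a b ha hb hdab hba
    rw [rpow_neg_three_half ha, rpow_neg_three_half hb, inv_eq_inv_sqrt_sq ha,
      inv_eq_inv_sqrt_sq hb]
    have h1 : (Real.sqrt a)⁻¹ ≤ 2 * (Real.sqrt d)⁻¹ := by
      have hs := Real.sqrt_pos.2 ha
      have hs' := Real.sqrt_pos.2 hd
      rw [← div_eq_mul_inv, inv_eq_one_div, div_le_div_iff₀ hs hs', one_mul]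
      rw [show 2 * Real.sqrt a = Real.sqrt (4 * a) by
        rw [Real.sqrt_mul (by norm_num), show (4 : ℝ) = 2 ^ 2 by norm_num,
          Real.sqrt_sq (by norm_num)]]
      exact Real.sqrt_le_sqrt (by linarith)
    have h2 : (Real.sqrt a)⁻¹ ≤ (Real.sqrt b)⁻¹ :=
      inv_anti₀ (Real.sqrt_pos.2 hb) (Real.sqrt_le_sqrt hba)
    have hA : 0 ≤ (Real.sqrt a)⁻¹ := by positivity
    have hE : 0 ≤ (Real.sqrt d)⁻¹ := by positivity
    set A := (Real.sqrt a)⁻¹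
    set B := (Real.sqrt b)⁻¹
    have hB : 0 ≤ B := hA.trans h2
    calc A ^ 2 * B ^ 2 = A * (A * B ^ 2) := by ring
      _ ≤ (2 * (Real.sqrt d)⁻¹) * (A ^ 3 + B ^ 3) :=
        mul_le_mul h1 (mul_sq_le_cube_add_cube hA hB) (by positivity) (by positivity)
  rcases le_total b a with h | h
  · exact key ha hb hdab h
  · have := key hb ha (by linarith) h
    rwa [mul_comm, add_comm (a ^ (-(3 / 2) : ℝ))]

theorem abs_log_le_mul_inv_sqrt {d D : ℝ} (hd : 0 < d) (hD : d ≤ D) :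
    |Real.log d| ≤ 2 * (1 + D) * (Real.sqrt d)⁻¹ := by
  have hs := Real.sqrt_pos.2 hd
  have h1 : Real.log d = 2 * Real.log (Real.sqrt d) := by
    rw [Real.log_sqrt hd.le]; ring
  have h2 : Real.log (Real.sqrt d) ≤ D * (Real.sqrt d)⁻¹ := by
    refine (Real.log_le_self hs.le).trans ?_
    rw [← div_eq_mul_inv, le_div_iff₀ hs, Real.mul_self_sqrt hd.le]
    exact hD
  have h3 : -Real.log (Real.sqrt d) ≤ (Real.sqrt d)⁻¹ := by
    rw [← Real.log_inv]
    exact Real.log_le_self (by positivity)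
  have hp : 0 ≤ (Real.sqrt d)⁻¹ := by positivity
  have hp2 : 0 ≤ D * (Real.sqrt d)⁻¹ := mul_nonneg (hd.le.trans hD) hp
  rw [h1, abs_le]
  constructor <;> nlinarith

end RealInequalities

/-! ### Logarithmic asymptotics of the Green's function -/

section Green

variable {M : Type*} [MetricSpace M] [ChartedSpace Plane M] [IsManifold 𝓘(ℝ, Plane) ∞ M]
  [RiemannianBundle (fun x : M => TangentSpace 𝓘(ℝ, Plane) x)]
  [IsContMDiffRiemannianBundle 𝓘(ℝ, Plane) ∞ Plane (fun x : M => TangentSpace 𝓘(ℝ, Plane) x)]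
  [IsRiemannianManifold 𝓘(ℝ, Plane) M]
  [CompactSpace M] [Nonempty M] [MeasurableSpace M] [BorelSpace M]

theorem exists_lintegral_inv_dist_le :
    ∃ C : ℝ≥0∞, C ≠ ⊤ ∧ ∀ x : M,
      ∫⁻ z, ENNReal.ofReal (dist z x)⁻¹ ∂(riemannianVolume M) ≤ C := by
  obtain ⟨C, hC, h⟩ := exists_lintegral_rpow_dist_le (M := M)
  refine ⟨riemannianVolume M univ + C, ENNReal.add_ne_top.2 ⟨measure_ne_top _ _, hC⟩, fun x => ?_⟩
  calc ∫⁻ z, ENNReal.ofReal (dist z x)⁻¹ ∂(riemannianVolume M)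
      ≤ ∫⁻ z, (1 + ENNReal.ofReal (dist z x ^ (-(3 / 2) : ℝ))) ∂(riemannianVolume M) := by
        refine lintegral_mono_ae ?_
        filter_upwards [ae_ne_riemannianVolume x] with z hz
        have hd := dist_pos.2 hz
        rw [← ENNReal.ofReal_one, ← ENNReal.ofReal_add zero_le_one (by positivity)]
        refine ENNReal.ofReal_le_ofReal ?_
        rw [rpow_neg_three_half hd, inv_eq_inv_sqrt_sq hd]
        have := mul_sq_le_cube_add_cube zero_le_one
          (by positivity : 0 ≤ (Real.sqrt (dist z x))⁻¹)
        linarith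
    _ = riemannianVolume M univ + ∫⁻ z, ENNReal.ofReal (dist z x ^ (-(3 / 2) : ℝ))
          ∂(riemannianVolume M) := by
        rw [lintegral_add_left measurable_const, lintegral_one]
    _ ≤ _ := add_le_add le_rfl (h x)

theorem integrable_mul_continuous {G k : M → ℝ} (hG : Integrable G (riemannianVolume M))
    (hk : Continuous k) : Integrable (fun z => G z * k z) (riemannianVolume M) := by
  obtain ⟨C, hC⟩ := isCompact_univ.exists_bound_of_continuousOn (f := k) hk.continuousOn
  exact hG.mul_bdd (c := C) hk.aestronglyMeasurable (Eventually.of_forall fun z => hC z (mem_univ z))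

/-- Representation of the Green's function near a point: testing against the parametrix bounds the
regular part of `G` by a potential of `|G|`. -/
theorem exists_local_green_bound {p : M} {G : M → ℝ} (hG : IsGreenFunction p G) (q : M) :
    ∃ C : ℝ≥0∞, C ≠ ⊤ ∧ ∃ δ > 0, ∀ᵐ x ∂(riemannianVolume M), dist x q < δ →
      ‖2 * Real.pi * G x + Real.log (dist x p)‖ₑ ≤
        C * (1 + ∫⁻ z, ‖G z‖ₑ * ENNReal.ofReal (dist z x)⁻¹ ∂(riemannianVolume M)) := by
  obtain ⟨C₁, hC₁, hS⟩ := exists_lintegral_inv_dist_le (M := M)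
  obtain ⟨C, hC, δ, hδ, η, f, k, hloc, hlim⟩ := exists_local_parametrix q
  obtain ⟨hGi, -, hGreen⟩ := hG
  refine ⟨ENNReal.ofReal C + ENNReal.ofReal (area M)⁻¹ * (ENNReal.ofReal C * C₁),
    ENNReal.add_ne_top.2 ⟨ENNReal.ofReal_ne_top, ENNReal.mul_ne_top ENNReal.ofReal_ne_top
      (ENNReal.mul_ne_top ENNReal.ofReal_ne_top hC₁)⟩, δ, hδ, ?_⟩
  filter_upwards [hlim G hGi, ae_ne_riemannianVolume p] with x hx hxp hxq
  obtain ⟨h1, h2⟩ := hloc x hxq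
  set I := ∫⁻ z, ‖G z‖ₑ * ENNReal.ofReal (dist z x)⁻¹ ∂(riemannianVolume M)
  have hle : ∀ s : ℝ, ∀ z, |s| ≤ C / dist z x →
      ‖s‖ₑ ≤ ENNReal.ofReal C * ENNReal.ofReal (dist z x)⁻¹ := fun s z h => by
    rw [← ENNReal.ofReal_mul hC, ← ofReal_norm]
    exact ENNReal.ofReal_le_ofReal h
  -- The defining identity of the Green's function, tested with `η x ε`.
  have hbound : ∀ᶠ ε in 𝓝[>] (0 : ℝ),
      ‖(∫ z, G z * k x ε z ∂(riemannianVolume M)) + Real.log (dist x p)‖ₑ ≤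
        ENNReal.ofReal (area M)⁻¹ * (ENNReal.ofReal C * C₁) + ENNReal.ofReal C * I +
          ENNReal.ofReal C := by
    filter_upwards [h1, h2 p hxp.symm] with ε ⟨hηs, hηL, hkc, hb⟩ hlog
    have hG1 := hGreen (η x ε) (f x ε) hηs hηL
    have hf := integrable_mul_continuous hGi hηL.1
    have hk := integrable_mul_continuous hGi hkc
    have hsub : ∫ z, G z * (f x ε z - k x ε z) ∂(riemannianVolume M) =
        (∫ z, G z * f x ε z ∂(riemannianVolume M)) - ∫ z, G z * k x ε z ∂(riemannianVolume M) := by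
      rw [← integral_sub hf hk]
      simp only [mul_sub]
    have heq : (∫ z, G z * k x ε z ∂(riemannianVolume M)) + Real.log (dist x p) =
        (area M)⁻¹ * (∫ z, η x ε z ∂(riemannianVolume M)) +
        -(∫ z, G z * (f x ε z - k x ε z) ∂(riemannianVolume M)) +
        -(η x ε p - Real.log (dist p x)) := by
      rw [hsub, dist_comm p x]
      linarith
    rw [heq]
    refine (enorm_add_le _ _).trans (add_le_add ((enorm_add_le _ _).trans (add_le_add ?_ ?_)) ?_)
    · rw [enorm_mul, Real.enorm_eq_ofReal (inv_nonneg.2 (area_pos (M := M)).le)]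
      refine mul_le_mul_right ((enorm_integral_le_lintegral_enorm _).trans ?_) _
      calc ∫⁻ z, ‖η x ε z‖ₑ ∂(riemannianVolume M)
          ≤ ∫⁻ z, ENNReal.ofReal C * ENNReal.ofReal (dist z x)⁻¹ ∂(riemannianVolume M) := by
            refine lintegral_mono_ae ?_
            filter_upwards [ae_ne_riemannianVolume x] with z hz using hle _ z (hb z hz).1
        _ = ENNReal.ofReal C * ∫⁻ z, ENNReal.ofReal (dist z x)⁻¹ ∂(riemannianVolume M) :=
            lintegral_const_mul' _ _ ENNReal.ofReal_ne_top
        _ ≤ _ := mul_le_mul_right (hS x) _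
    · rw [enorm_neg]
      refine (enorm_integral_le_lintegral_enorm _).trans ?_
      rw [← lintegral_const_mul' _ _ ENNReal.ofReal_ne_top]
      refine lintegral_mono_ae ?_
      filter_upwards [ae_ne_riemannianVolume x] with z hz
      rw [enorm_mul, mul_left_comm]
      exact mul_le_mul_right (hle _ z (hb z hz).2) _
    · rw [enorm_neg, ← ofReal_norm]
      exact ENNReal.ofReal_le_ofReal hlog
  have hcont := (continuous_enorm.tendsto _).comp ((hx hxq).add_const (Real.log (dist x p)))
  refine (le_of_tendsto hcont hbound).trans ?_
  rw [mul_add, mul_one, add_mul]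
  calc _ = ENNReal.ofReal C + ENNReal.ofReal (area M)⁻¹ * (ENNReal.ofReal C * C₁) +
        (ENNReal.ofReal C * I + 0) := by ring
    _ ≤ _ := by gcongr; exact zero_le

/-- The local bounds for the regular part of the Green's function, put together by compactness. -/
theorem exists_green_bound {p : M} {G : M → ℝ} (hG : IsGreenFunction p G) :
    ∃ C : ℝ≥0∞, C ≠ ⊤ ∧ ∀ᵐ x ∂(riemannianVolume M),
      ‖2 * Real.pi * G x + Real.log (dist x p)‖ₑ ≤
        C * (1 + ∫⁻ z, ‖G z‖ₑ * ENNReal.ofReal (dist z x)⁻¹ ∂(riemannianVolume M)) := by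
  choose C hC δ hδ h using exists_local_green_bound hG
  obtain ⟨s, -, hs⟩ := (isCompact_univ (X := M)).elim_nhds_subcover
    (fun q => Metric.ball q (δ q)) fun q _ => Metric.ball_mem_nhds q (hδ q)
  refine ⟨∑ q ∈ s, C q, ENNReal.sum_ne_top.2 fun q _ => hC q, ?_⟩
  filter_upwards [(eventually_all_finset s).2 fun q _ => h q] with x hx
  obtain ⟨q, hq, hxq⟩ := mem_iUnion₂.1 (hs (mem_univ x))
  exact (hx q hq hxq).trans (mul_le_mul_left (Finset.single_le_sum (f := C) (fun _ _ => zero_le) hq) _)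

/-- Two integral operators are composed by composing their kernels (Tonelli). -/
theorem lintegral_kernel_comp_le {K₁ K₂ K₃ : M → M → ℝ≥0∞} (h₁ : Measurable (Function.uncurry K₁))
    (h₂ : Measurable (Function.uncurry K₂)) {w : M → ℝ≥0∞} (hw : AEMeasurable w (riemannianVolume M))
    {x : M} (h : ∀ z, z ≠ x → ∫⁻ y, K₁ y x * K₂ z y ∂(riemannianVolume M) ≤ K₃ z x) :
    ∫⁻ y, (∫⁻ z, w z * K₂ z y ∂(riemannianVolume M)) * K₁ y x ∂(riemannianVolume M) ≤
      ∫⁻ z, w z * K₃ z x ∂(riemannianVolume M) := by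
  have hK₁ : Measurable fun y => K₁ y x := h₁.comp (measurable_id.prodMk measurable_const)
  have hK₂ : ∀ y, Measurable fun z => K₂ z y := fun y =>
    h₂.comp (measurable_id.prodMk measurable_const)
  have hK₂' : ∀ z, Measurable fun y => K₂ z y := fun z =>
    h₂.comp (measurable_const.prodMk measurable_id)
  calc ∫⁻ y, (∫⁻ z, w z * K₂ z y ∂(riemannianVolume M)) * K₁ y x ∂(riemannianVolume M)
      = ∫⁻ y, ∫⁻ z, w z * K₂ z y * K₁ y x ∂(riemannianVolume M) ∂(riemannianVolume M) := by
        refine lintegral_congr fun y => ?_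
        exact (lintegral_mul_const'' _ (hw.mul (hK₂ y).aemeasurable)).symm
    _ = ∫⁻ z, ∫⁻ y, w z * K₂ z y * K₁ y x ∂(riemannianVolume M) ∂(riemannianVolume M) := by
        refine lintegral_lintegral_swap ?_
        have e1 : AEMeasurable (fun q : M × M => w q.2)
            ((riemannianVolume M).prod (riemannianVolume M)) :=
          hw.comp_quasiMeasurePreserving Measure.quasiMeasurePreserving_snd
        have e2 : Measurable fun q : M × M => K₂ q.2 q.1 := h₂.comp measurable_swap
        have e3 : Measurable fun q : M × M => K₁ q.1 x := hK₁.comp measurable_fst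
        exact (e1.mul e2.aemeasurable).mul e3.aemeasurable
    _ ≤ ∫⁻ z, w z * K₃ z x ∂(riemannianVolume M) := by
        refine lintegral_mono_ae ?_
        filter_upwards [ae_ne_riemannianVolume x] with z hz
        calc ∫⁻ y, w z * K₂ z y * K₁ y x ∂(riemannianVolume M)
            = w z * ∫⁻ y, K₁ y x * K₂ z y ∂(riemannianVolume M) := by
              refine Eq.trans ?_ (lintegral_const_mul _ (hK₁.mul (hK₂' z)))
              exact lintegral_congr fun y => by ring
          _ ≤ _ := mul_le_mul_right (h z hz) _

/-- If `s(a) b ^ (-1/2)` is controlled by the integrable powers `a ^ (-3/2)` and `b ^ (-3/2)`, then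
the product of `s(d(z, x))` and `d(z, p) ^ (-1/2)` has an integral in `z` bounded uniformly in `x` and
`p`. -/
theorem exists_lintegral_mul_inv_sqrt_dist_le {s : ℝ → ℝ}
    (hs : ∀ {a b : ℝ}, 0 < a → 0 < b →
      s a * (Real.sqrt b)⁻¹ ≤ 2 + a ^ (-(3 / 2) : ℝ) + b ^ (-(3 / 2) : ℝ))
    (hs0 : ∀ a, 0 ≤ s a) :
    ∃ C : ℝ≥0∞, C ≠ ⊤ ∧ ∀ x p : M,
      ∫⁻ z, ENNReal.ofReal (s (dist z x)) * ENNReal.ofReal (Real.sqrt (dist z p))⁻¹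
        ∂(riemannianVolume M) ≤ C := by
  obtain ⟨C, hC, h⟩ := exists_lintegral_rpow_dist_le (M := M)
  have hm : ∀ x : M, Measurable fun z => ENNReal.ofReal (dist z x ^ (-(3 / 2) : ℝ)) := fun x =>
    by fun_prop
  refine ⟨2 * riemannianVolume M univ + C + C, ENNReal.add_ne_top.2 ⟨ENNReal.add_ne_top.2
    ⟨ENNReal.mul_ne_top (by simp) (measure_ne_top _ _), hC⟩, hC⟩, fun x p => ?_⟩
  calc _ ≤ ∫⁻ z, (2 + ENNReal.ofReal (dist z x ^ (-(3 / 2) : ℝ)) +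
          ENNReal.ofReal (dist z p ^ (-(3 / 2) : ℝ))) ∂(riemannianVolume M) := by
        refine lintegral_mono_ae ?_
        filter_upwards [ae_ne_riemannianVolume x, ae_ne_riemannianVolume p] with z hz hzp
        rw [← ENNReal.ofReal_mul (hs0 _), ← ENNReal.ofReal_ofNat 2,
          ← ENNReal.ofReal_add zero_le_two (by positivity),
          ← ENNReal.ofReal_add (by positivity) (by positivity)]
        exact ENNReal.ofReal_le_ofReal (hs (dist_pos.2 hz) (dist_pos.2 hzp))
    _ = 2 * riemannianVolume M univ +
        ∫⁻ z, ENNReal.ofReal (dist z x ^ (-(3 / 2) : ℝ)) ∂(riemannianVolume M) +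
        ∫⁻ z, ENNReal.ofReal (dist z p ^ (-(3 / 2) : ℝ)) ∂(riemannianVolume M) := by
        rw [lintegral_add_right _ (hm p), lintegral_add_right _ (hm x), lintegral_const]
    _ ≤ _ := add_le_add (add_le_add le_rfl (h x)) (h p)

/-- The Green's function is `-(2π)⁻¹ log d(·, p)` up to a bounded function. The bound by a potential
of `|G|` is iterated until the kernel is bounded. -/
theorem exists_abs_green_add_log_le {p : M} {G : M → ℝ} (hG : IsGreenFunction p G) :
    ∃ C : ℝ, ∀ᵐ x ∂(riemannianVolume M), |2 * Real.pi * G x + Real.log (dist x p)| ≤ C := by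
  obtain ⟨C₀, hC₀, hbound⟩ := exists_green_bound hG
  obtain ⟨C₁, hC₁, hone⟩ := exists_lintegral_inv_dist_le (M := M)
  have hmix : ∀ {a b : ℝ}, 0 < a → 0 < b →
      a⁻¹ * (Real.sqrt b)⁻¹ ≤ a ^ (-(3 / 2) : ℝ) + b ^ (-(3 / 2) : ℝ) := fun {a b} ha hb => by
    rw [rpow_neg_three_half ha, rpow_neg_three_half hb, inv_eq_inv_sqrt_sq ha, mul_comm,
      add_comm]
    exact mul_sq_le_cube_add_cube (by positivity) (by positivity)
  obtain ⟨C₂, hC₂, hsing⟩ : ∃ C : ℝ≥0∞, C ≠ ⊤ ∧ ∀ x p : M, ∫⁻ z, ENNReal.ofReal (dist z x)⁻¹ *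
      ENNReal.ofReal (Real.sqrt (dist z p))⁻¹ ∂(riemannianVolume M) ≤ C := by
    refine exists_lintegral_mul_inv_sqrt_dist_le (M := M) (s := fun a => |a|⁻¹) (fun {a b} ha hb => ?_)
      (fun a => by positivity) |>.imp fun C h => ⟨h.1, fun x p => ?_⟩
    · have := hmix ha hb
      rw [abs_of_pos ha]
      linarith
    · simpa only [abs_of_nonneg dist_nonneg] using h.2 x p
  obtain ⟨C₃, hC₃, hsqrt⟩ := exists_lintegral_mul_inv_sqrt_dist_le (M := M)
    (s := fun a => (Real.sqrt a)⁻¹) (fun {a b} ha hb => by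
      rw [rpow_neg_three_half ha, rpow_neg_three_half hb]
      have h1 : 0 ≤ (Real.sqrt a)⁻¹ := by positivity
      have h2 : 0 ≤ (Real.sqrt b)⁻¹ := by positivity
      have h3 := mul_sq_le_cube_add_cube zero_le_one h1
      have h4 := mul_sq_le_cube_add_cube zero_le_one h2
      nlinarith [sq_nonneg ((Real.sqrt a)⁻¹ - (Real.sqrt b)⁻¹), pow_nonneg h1 3, pow_nonneg h2 3])
    fun a => by positivity
  obtain ⟨C₄, hC₄, hrpow⟩ := exists_lintegral_rpow_dist_le (M := M)
  obtain ⟨C₅, hC₅, hhalf⟩ := exists_lintegral_mul_inv_sqrt_dist_le (M := M)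
    (s := fun _ => 1) (fun {a b} ha hb => by
      rw [rpow_neg_three_half hb]
      have h2 : 0 ≤ (Real.sqrt b)⁻¹ := by positivity
      have h4 := mul_sq_le_cube_add_cube zero_le_one h2
      have h5 : 0 ≤ a ^ (-(3 / 2) : ℝ) := by positivity
      nlinarith [sq_nonneg ((Real.sqrt b)⁻¹ - 1)]) fun a => zero_le_one
  set μ := riemannianVolume M
  set w : M → ℝ≥0∞ := fun z => ‖G z‖ₑ with hwdef
  have hw : AEMeasurable w μ := hG.1.aestronglyMeasurable.enorm
  have hwi : ∫⁻ z, w z ∂μ ≠ ⊤ := hG.1.hasFiniteIntegral.ne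
  set S : M → ℝ≥0∞ := fun x => ∫⁻ z, w z * ENNReal.ofReal (dist z x)⁻¹ ∂μ
  set T : M → ℝ≥0∞ := fun x => ∫⁻ z, w z * ENNReal.ofReal (Real.sqrt (dist z x))⁻¹ ∂μ
  set g : M → ℝ≥0∞ := fun z => ENNReal.ofReal (Real.sqrt (dist z p))⁻¹
  have hg : Measurable g := by fun_prop
  set D := Metric.diam (univ : Set M)
  set B := C₀ + ENNReal.ofReal (2 * (1 + D))
  have hB : B ≠ ⊤ := ENNReal.add_ne_top.2 ⟨hC₀, ENNReal.ofReal_ne_top⟩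
  have hwS : ∀ᵐ x ∂μ, w x ≤ B * (1 + g x + S x) := by
    filter_upwards [hbound, ae_ne_riemannianVolume p] with x hx hxp
    have h1 : ‖Real.log (dist x p)‖ₑ ≤ ENNReal.ofReal (2 * (1 + D)) * g x := by
      rw [← ofReal_norm, ← ENNReal.ofReal_mul (by have := Metric.diam_nonneg (s := (univ : Set M)); positivity)]
      exact ENNReal.ofReal_le_ofReal (abs_log_le_mul_inv_sqrt (dist_pos.2 hxp)
        (Metric.dist_le_diam_of_mem isCompact_univ.isBounded (mem_univ _) (mem_univ _)))
    have h2 : w x ≤ ‖2 * Real.pi * G x‖ₑ := by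
      simp only [hwdef]
      rw [← ofReal_norm, ← ofReal_norm, norm_mul (2 * Real.pi),
        Real.norm_of_nonneg (by positivity : 0 ≤ 2 * Real.pi)]
      exact ENNReal.ofReal_le_ofReal (le_mul_of_one_le_left (norm_nonneg _)
        (by linarith [Real.pi_gt_three]))
    have h3 : 2 * Real.pi * G x = (2 * Real.pi * G x + Real.log (dist x p)) +
        -Real.log (dist x p) := by ring
    calc w x ≤ ‖2 * Real.pi * G x‖ₑ := h2
      _ ≤ ‖2 * Real.pi * G x + Real.log (dist x p)‖ₑ + ‖Real.log (dist x p)‖ₑ := by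
          conv_lhs => rw [h3]
          exact (enorm_add_le _ _).trans (by rw [enorm_neg])
      _ ≤ C₀ * (1 + S x) + ENNReal.ofReal (2 * (1 + D)) * g x := add_le_add hx h1
      _ ≤ B * (1 + S x) + B * g x := by gcongr <;> simp [B]
      _ = B * (1 + g x + S x) := by ring
  -- The potential bound for `w`, integrated against a kernel `κ`.
  have hexpand : ∀ κ : M → ℝ≥0∞, Measurable κ → ∫⁻ y, w y * κ y ∂μ ≤
      B * (∫⁻ y, κ y ∂μ + ∫⁻ y, κ y * g y ∂μ + ∫⁻ y, S y * κ y ∂μ) := by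
    intro κ hκ
    have hm : Measurable fun y => κ y + κ y * g y := hκ.add (hκ.mul hg)
    rw [← lintegral_add_left hκ, ← lintegral_add_left hm,
      ← lintegral_const_mul' _ _ hB]
    refine lintegral_mono_ae ?_
    filter_upwards [hwS] with y hy
    calc w y * κ y ≤ B * (1 + g y + S y) * κ y := mul_le_mul_left hy _
      _ = _ := by ring
  have hK1 : Measurable (Function.uncurry fun z x : M => ENNReal.ofReal (dist z x)⁻¹) :=
    ENNReal.measurable_ofReal.comp (measurable_dist.inv)
  have hK2 : Measurable (Function.uncurry fun z x : M => ENNReal.ofReal (Real.sqrt (dist z x))⁻¹) :=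
    ENNReal.measurable_ofReal.comp (measurable_dist.sqrt.inv)
  -- The composed kernel `T ∘ S` is bounded.
  have hST : ∀ x, ∫⁻ y, S y * ENNReal.ofReal (Real.sqrt (dist y x))⁻¹ ∂μ ≤ (∫⁻ z, w z ∂μ) * C₂ := by
    intro x
    refine (lintegral_kernel_comp_le (K₁ := fun z x => ENNReal.ofReal (Real.sqrt (dist z x))⁻¹)
      (K₂ := fun z x => ENNReal.ofReal (dist z x)⁻¹) (K₃ := fun _ _ => C₂) hK2 hK1 hw
      fun z _ => ?_).trans_eq (lintegral_mul_const' _ _ hC₂)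
    refine le_trans (le_of_eq ?_) (hsing z x)
    exact lintegral_congr fun y => by rw [mul_comm, dist_comm z y]
  -- The composed kernel `S ∘ S` is bounded by the kernel of `T`.
  have hSS : ∀ x, ∫⁻ y, S y * ENNReal.ofReal (dist y x)⁻¹ ∂μ ≤ (2 * (C₄ + C₄)) * T x := by
    intro x
    refine (lintegral_kernel_comp_le (K₁ := fun z x => ENNReal.ofReal (dist z x)⁻¹)
      (K₂ := fun z x => ENNReal.ofReal (dist z x)⁻¹)
      (K₃ := fun z x => (2 * (C₄ + C₄)) * ENNReal.ofReal (Real.sqrt (dist z x))⁻¹) hK1 hK1 hw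
      fun z hz => ?_).trans_eq ?_
    · have hm : Measurable fun y => ENNReal.ofReal (dist y x ^ (-(3 / 2) : ℝ)) := by fun_prop
      calc ∫⁻ y, ENNReal.ofReal (dist y x)⁻¹ * ENNReal.ofReal (dist z y)⁻¹ ∂μ
          ≤ ∫⁻ y, ENNReal.ofReal (2 * (Real.sqrt (dist z x))⁻¹) *
            (ENNReal.ofReal (dist y x ^ (-(3 / 2) : ℝ)) +
              ENNReal.ofReal (dist y z ^ (-(3 / 2) : ℝ))) ∂μ := by
            refine lintegral_mono_ae ?_
            filter_upwards [ae_ne_riemannianVolume x, ae_ne_riemannianVolume z] with y hyx hyz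
            rw [← ENNReal.ofReal_mul (by positivity), ← ENNReal.ofReal_add (by positivity)
              (by positivity), ← ENNReal.ofReal_mul (by positivity), dist_comm z y]
            exact ENNReal.ofReal_le_ofReal (inv_mul_inv_le (dist_pos.2 hyx) (dist_pos.2 hyz)
              (dist_pos.2 hz) (by linarith [dist_triangle_left z x y]))
        _ = ENNReal.ofReal (2 * (Real.sqrt (dist z x))⁻¹) *
            (∫⁻ y, ENNReal.ofReal (dist y x ^ (-(3 / 2) : ℝ)) ∂μ +
              ∫⁻ y, ENNReal.ofReal (dist y z ^ (-(3 / 2) : ℝ)) ∂μ) := by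
            rw [lintegral_const_mul' _ _ ENNReal.ofReal_ne_top, lintegral_add_left hm]
        _ ≤ ENNReal.ofReal (2 * (Real.sqrt (dist z x))⁻¹) * (C₄ + C₄) :=
            mul_le_mul_right (add_le_add (hrpow x) (hrpow z)) _
        _ = _ := by
            rw [ENNReal.ofReal_mul zero_le_two, ENNReal.ofReal_ofNat]
            ring
    · rw [← lintegral_const_mul' _ _ (ENNReal.mul_ne_top (by simp)
        (ENNReal.add_ne_top.2 ⟨hC₄, hC₄⟩))]
      exact lintegral_congr fun z => by ring
  have hT : ∀ x, T x ≤ B * (C₅ + C₃ + (∫⁻ z, w z ∂μ) * C₂) := fun x =>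
    (hexpand _ (hK2.comp (measurable_id.prodMk measurable_const))).trans
      (mul_le_mul_right (add_le_add (add_le_add
        (by simpa using hhalf x x) (hsqrt x p)) (hST x)) _)
  have hS : ∀ x, S x ≤ B * (C₁ + C₂ +
      (2 * (C₄ + C₄)) * (B * (C₅ + C₃ + (∫⁻ z, w z ∂μ) * C₂))) := fun x =>
    (hexpand _ (hK1.comp (measurable_id.prodMk measurable_const))).trans
      (mul_le_mul_right (add_le_add (add_le_add (hone x) (hsing x p))
        ((hSS x).trans (mul_le_mul_right (hT x) _))) _)
  set E := C₀ * (1 + B * (C₁ + C₂ + (2 * (C₄ + C₄)) * (B * (C₅ + C₃ + (∫⁻ z, w z ∂μ) * C₂))))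
  have hE : E ≠ ⊤ := by finiteness
  refine ⟨E.toReal, ?_⟩
  filter_upwards [hbound] with x hx
  have h1 := hx.trans (mul_le_mul_right (add_le_add le_rfl (hS x)) _)
  rw [← ofReal_norm] at h1
  exact (ENNReal.ofReal_le_iff_le_toReal hE).1 h1

end Green

/-! ### Exponents and products of distances -/

section Exponents

variable {m : ℕ} {ρ : ℝ} {a : Fin m → ℝ}

theorem alphaTilde_nonneg (ha : ∀ j, 0 ≤ a j) : 0 ≤ alphaTilde ρ a :=
  Real.iSup_nonneg fun j => ha j

theorem le_alphaTilde {j : Fin m} (hj : j ∉ indexJ ρ a) : a j ≤ alphaTilde ρ a :=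
  le_ciSup (f := fun j : {j : Fin m // j ∉ indexJ ρ a} => a j) (Set.finite_range _).bddAbove ⟨j, hj⟩

theorem exists_le_dist_of_injective {M : Type*} [MetricSpace M] {p : Fin m → M}
    (hp : Function.Injective p) : ∃ r > 0, ∀ i j, i ≠ j → r ≤ dist (p i) (p j) := by
  have h : ∀ s : Finset (Fin m × Fin m), ∃ r > 0, ∀ q ∈ s, q.1 ≠ q.2 → r ≤ dist (p q.1) (p q.2) := by
    intro s
    induction s using Finset.induction with
    | empty => exact ⟨1, one_pos, by simp⟩
    | insert q s _ ih =>
      obtain ⟨r, hr, h⟩ := ih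
      by_cases hq : q.1 = q.2
      · refine ⟨r, hr, fun q' hq' hne => ?_⟩
        rcases Finset.mem_insert.1 hq' with rfl | h'
        · exact absurd hq hne
        · exact h q' h' hne
      · refine ⟨min r (dist (p q.1) (p q.2)), lt_min hr (dist_pos.2 (hp.ne hq)),
          fun q' hq' hne => ?_⟩
        rcases Finset.mem_insert.1 hq' with rfl | h'
        · exact min_le_right _ _
        · exact (min_le_left _ _).trans (h q' h' hne)
  obtain ⟨r, hr, h⟩ := h Finset.univ
  exact ⟨r, hr, fun i j hij => h (i, j) (Finset.mem_univ _) hij⟩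

/-- Let `y` have distance at least `t` from each of the separated points `p j`, and let `b` bound
the exponents of the points near `y`. Since at most one of the points is near `y`, the product of the
`d(y, p j) ^ (2 a j)` is at least of the order `t ^ (2 b)`. -/
theorem le_prod_rpow_dist {M : Type*} [MetricSpace M] {p : Fin m → M} {y : M} {r t b : ℝ}
    (ha : ∀ j, 0 ≤ a j ∧ a j ≤ 1) (hr : 0 < r) (hr1 : r ≤ 1)
    (hsep : ∀ i j, i ≠ j → 2 * r ≤ dist (p i) (p j)) (ht : 0 < t) (ht1 : t ≤ 1)
    (hty : ∀ j, t ≤ dist y (p j)) (hb0 : 0 ≤ b) (hb : ∀ j, dist y (p j) < r → a j ≤ b) :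
    (r ^ 2) ^ m * t ^ (2 * b) ≤ ∏ j, dist y (p j) ^ (2 * a j) := by
  have hs0 : 0 < t ^ (2 * b) := Real.rpow_pos_of_pos ht _
  have hs1 : t ^ (2 * b) ≤ 1 := Real.rpow_le_one ht.le ht1 (by linarith)
  have h1 : ∀ j, r ^ 2 * (if dist y (p j) < r then t ^ (2 * b) else 1) ≤
      dist y (p j) ^ (2 * a j) := by
    intro j
    obtain ⟨hj0, hj1⟩ := ha j
    split_ifs with h
    · calc r ^ 2 * t ^ (2 * b) ≤ 1 * t ^ (2 * b) :=
            mul_le_mul_of_nonneg_right (pow_le_one₀ hr.le hr1) hs0.le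
        _ = t ^ (2 * b) := one_mul _
        _ ≤ t ^ (2 * a j) := Real.rpow_le_rpow_of_exponent_ge ht ht1 (by linarith [hb j h])
        _ ≤ _ := Real.rpow_le_rpow ht.le (hty j) (by linarith)
    · rw [mul_one, ← Real.rpow_natCast]
      calc r ^ ((2 : ℕ) : ℝ) ≤ r ^ (2 * a j) :=
            Real.rpow_le_rpow_of_exponent_ge hr hr1 (by push_cast; linarith)
        _ ≤ _ := Real.rpow_le_rpow hr.le (not_lt.1 h) (by linarith)
  have h2 : t ^ (2 * b) ≤ ∏ j, (if dist y (p j) < r then t ^ (2 * b) else 1) := by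
    rw [Finset.prod_ite, Finset.prod_const, Finset.prod_const_one, mul_one]
    have hc : (Finset.univ.filter fun j => dist y (p j) < r).card ≤ 1 := by
      refine Finset.card_le_one.2 fun i hi j hj => ?_
      by_contra hij
      have h1 := (Finset.mem_filter.1 hi).2
      have h2 := (Finset.mem_filter.1 hj).2
      linarith [hsep i j hij, dist_triangle_left (p i) (p j) y]
    calc t ^ (2 * b) = (t ^ (2 * b)) ^ 1 := (pow_one _).symm
      _ ≤ _ := pow_le_pow_of_le_one hs0.le hs1 hc
  calc (r ^ 2) ^ m * t ^ (2 * b)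
      ≤ (r ^ 2) ^ m * ∏ j, (if dist y (p j) < r then t ^ (2 * b) else 1) :=
        mul_le_mul_of_nonneg_left h2 (by positivity)
    _ = ∏ j, r ^ 2 * (if dist y (p j) < r then t ^ (2 * b) else 1) := by
        rw [Finset.prod_mul_distrib, Finset.prod_const, Finset.card_univ, Fintype.card_fin]
    _ ≤ _ := Finset.prod_le_prod (fun j _ => by positivity) fun j _ => h1 j

end Exponents

/-! ### Pointwise bounds for the test functions -/

section TestFunctionBounds

variable {M : Type*} [MetricSpace M] {α lam : ℝ} {x y : M}

theorem testFunction_le (hlam : 0 < lam) :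
    testFunction α lam x y ≤ (1 + α) * Real.log lam := by
  have h : 0 ≤ (lam * dist y x) ^ (2 * (1 + α)) := Real.rpow_nonneg (by positivity) _
  have h2 : 0 < lam ^ (1 + α) := Real.rpow_pos_of_pos hlam _
  rw [testFunction, ← Real.log_rpow hlam]
  exact Real.log_le_log (by positivity) (div_le_self h2.le (by linarith))

/-- Away from its centre the test function is very negative. -/
theorem testFunction_le_of_le_dist (hα : 0 ≤ α) (hlam : 0 < lam) {δ : ℝ} (hδ : 0 < δ)
    (h : δ ≤ dist y x) :
    testFunction α lam x y ≤ -((1 + α) * Real.log lam) - 2 * (1 + α) * Real.log δ := by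
  have h1 : (lam * δ) ^ (2 * (1 + α)) ≤ 1 + (lam * dist y x) ^ (2 * (1 + α)) := by
    have := Real.rpow_le_rpow (by positivity) (mul_le_mul_of_nonneg_left h hlam.le)
      (by linarith : 0 ≤ 2 * (1 + α))
    linarith
  have h2 : 0 < (lam * δ) ^ (2 * (1 + α)) := Real.rpow_pos_of_pos (by positivity) _
  rw [testFunction, Real.log_div (Real.rpow_pos_of_pos hlam _).ne' (by linarith),
    Real.log_rpow hlam]
  have h3 := Real.log_le_log h2 h1
  rw [Real.log_rpow (by positivity), Real.log_mul hlam.ne' hδ.ne'] at h3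
  linarith

/-- In the ball of radius `1 / λ` about its centre the test function is within a constant of its
maximum. -/
theorem le_exp_testFunction (hα : 0 ≤ α) (hlam : 0 < lam) (h : dist y x ≤ lam⁻¹) :
    lam ^ (2 * (1 + α)) / 4 ≤ Real.exp (2 * testFunction α lam x y) := by
  have h1 : (lam * dist y x) ^ (2 * (1 + α)) ≤ 1 := by
    refine Real.rpow_le_one (by positivity) ?_ (by linarith)
    calc lam * dist y x ≤ lam * lam⁻¹ := mul_le_mul_of_nonneg_left h hlam.le
      _ = 1 := mul_inv_cancel₀ hlam.ne'
  have h0 : 0 ≤ (lam * dist y x) ^ (2 * (1 + α)) := Real.rpow_nonneg (by positivity) _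
  have h2 : 0 < lam ^ (1 + α) := Real.rpow_pos_of_pos hlam _
  have h3 : lam ^ (2 * (1 + α)) = (lam ^ (1 + α)) ^ 2 := by
    rw [← Real.rpow_mul_natCast hlam.le]
    congr 1
    push_cast
    ring
  rw [testFunction, two_mul (Real.log _), Real.exp_add, Real.exp_log (by positivity), h3]
  have h4 : lam ^ (1 + α) / 2 ≤ lam ^ (1 + α) / (1 + (lam * dist y x) ^ (2 * (1 + α))) :=
    div_le_div_of_nonneg_left h2.le (by linarith) (by linarith)
  calc (lam ^ (1 + α)) ^ 2 / 4 = (lam ^ (1 + α) / 2) * (lam ^ (1 + α) / 2) := by ring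
    _ ≤ _ := mul_le_mul h4 h4 (by positivity) (by positivity)

end TestFunctionBounds

/-! ### The weight, the mean and the mass -/

section Asymptotics

variable {M : Type*} [MetricSpace M] [ChartedSpace Plane M] [IsManifold 𝓘(ℝ, Plane) ∞ M]
  [RiemannianBundle (fun x : M => TangentSpace 𝓘(ℝ, Plane) x)]
  [IsContMDiffRiemannianBundle 𝓘(ℝ, Plane) ∞ Plane (fun x : M => TangentSpace 𝓘(ℝ, Plane) x)]
  [IsRiemannianManifold 𝓘(ℝ, Plane) M]
  [CompactSpace M] [Nonempty M] [MeasurableSpace M] [BorelSpace M]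
  {h : M → ℝ} {m : ℕ} {p : Fin m → M} {a : Fin m → ℝ} {G : Fin m → M → ℝ}

/-- By the asymptotics of the Green's functions, the weight is comparable to the product of the
powers `d(·, p j) ^ (2 a j)`. -/
theorem exists_singularWeight_bounds (hc : Continuous h) (h_pos : ∀ x, 0 < h x)
    (hG : ∀ j, IsGreenFunction (p j) (G j)) :
    ∃ c C : ℝ, 0 < c ∧ 0 < C ∧ ∀ᵐ x ∂(riemannianVolume M),
      c * ∏ j, dist x (p j) ^ (2 * a j) ≤ singularWeight h a G x ∧
      singularWeight h a G x ≤ C * ∏ j, dist x (p j) ^ (2 * a j) := by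
  choose B hB using fun j => exists_abs_green_add_log_le (hG j)
  obtain ⟨x₁, -, h₁⟩ := isCompact_univ.exists_isMinOn univ_nonempty hc.continuousOn
  obtain ⟨x₂, -, h₂⟩ := isCompact_univ.exists_isMaxOn univ_nonempty hc.continuousOn
  set b := ∑ j, 2 * |a j| * B j
  refine ⟨h x₁ * Real.exp (-b), h x₂ * Real.exp b, mul_pos (h_pos _) (Real.exp_pos _),
    mul_pos (h_pos _) (Real.exp_pos _), ?_⟩
  filter_upwards [ae_all_iff.2 hB, ae_all_iff.2 fun j => ae_ne_riemannianVolume (p j)] with x hx hxp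
  have hprod : ∏ j, dist x (p j) ^ (2 * a j) =
      Real.exp (∑ j, 2 * a j * Real.log (dist x (p j))) := by
    rw [Real.exp_sum]
    exact Finset.prod_congr rfl fun j _ => by
      rw [Real.rpow_def_of_pos (dist_pos.2 (hxp j)), mul_comm]
  have hsum : |-(4 * Real.pi * ∑ j, a j * G j x) - ∑ j, 2 * a j * Real.log (dist x (p j))| ≤ b := by
    rw [Finset.mul_sum, ← Finset.sum_neg_distrib, ← Finset.sum_sub_distrib]
    refine (Finset.abs_sum_le_sum_abs _ _).trans (Finset.sum_le_sum fun j _ => ?_)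
    rw [show -(4 * Real.pi * (a j * G j x)) - 2 * a j * Real.log (dist x (p j)) =
      -(2 * a j * (2 * Real.pi * G j x + Real.log (dist x (p j)))) by ring, abs_neg, abs_mul,
      abs_mul, abs_two]
    exact mul_le_mul_of_nonneg_left (hx j) (by positivity)
  rw [abs_le] at hsum
  rw [hprod, singularWeight, mul_assoc (h x₁), mul_assoc (h x₂), ← Real.exp_add, ← Real.exp_add]
  exact ⟨mul_le_mul (h₁ (mem_univ x)) (Real.exp_le_exp.2 (by linarith)) (Real.exp_pos _).le
      (h_pos x).le,
    mul_le_mul (h₂ (mem_univ x)) (Real.exp_le_exp.2 (by linarith)) (Real.exp_pos _).le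
      (h_pos _).le⟩

theorem integrable_singularWeight (hc : Continuous h) (h_pos : ∀ x, 0 < h x)
    (ha : ∀ j, 0 ≤ a j ∧ a j ≤ 1) (hG : ∀ j, IsGreenFunction (p j) (G j)) :
    Integrable (singularWeight h a G) (riemannianVolume M) := by
  obtain ⟨_, C, _, hC, hb⟩ := exists_singularWeight_bounds (a := a) hc h_pos hG
  set D := max 1 (Metric.diam (univ : Set M))
  have hm : AEStronglyMeasurable (singularWeight h a G) (riemannianVolume M) := by
    refine hc.aestronglyMeasurable.mul (Real.continuous_exp.comp_aestronglyMeasurable ?_)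
    refine (AEStronglyMeasurable.const_mul ?_ _).neg
    exact Finset.aestronglyMeasurable_fun_sum _ fun j _ => (hG j).1.aestronglyMeasurable.const_mul _
  refine Integrable.of_bound hm (C * ∏ j, D ^ (2 * a j)) ?_
  filter_upwards [hb] with x hx
  have h0 : 0 ≤ singularWeight h a G x := mul_nonneg (h_pos x).le (Real.exp_pos _).le
  rw [Real.norm_of_nonneg h0]
  refine hx.2.trans (mul_le_mul_of_nonneg_left ?_ hC.le)
  refine Finset.prod_le_prod (fun j _ => by positivity) fun j _ => ?_
  exact Real.rpow_le_rpow dist_nonneg ((Metric.dist_le_diam_of_mem isCompact_univ.isBounded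
    (mem_univ _) (mem_univ _)).trans (le_max_right _ _)) (by linarith [ha j])

/-- The mean of the test function is `-(1 + α) log λ`, up to the contribution of a small ball about its
centre and up to a constant. -/
theorem exists_integral_testFunction_le {α δ : ℝ} (hα : 0 ≤ α) (hδ : 0 < δ) (hδ1 : ∀ x : M,
      riemannianVolume M (Metric.ball x δ) ≤ ENNReal.ofReal (2 * Real.pi * δ ^ 2)) :
    ∃ C : ℝ, ∀ lam : ℝ, 1 ≤ lam → ∀ x : M,
      ∫ y, testFunction α lam x y ∂(riemannianVolume M) ≤
        -((1 + α) * Real.log lam * area M) + 2 * (1 + α) * Real.log lam * (2 * Real.pi * δ ^ 2) +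
          C := by
  refine ⟨2 * (1 + α) * |Real.log δ| * area M, fun lam hlam x => ?_⟩
  have hlog := Real.log_nonneg hlam
  have hlam0 : 0 < lam := by linarith
  set μ := riemannianVolume M
  have hball : μ.real (Metric.ball x δ) ≤ 2 * Real.pi * δ ^ 2 :=
    ENNReal.toReal_le_of_le_ofReal (by positivity) (hδ1 x)
  have hφ : Integrable (testFunction α lam x) μ := by
    simpa using integrable_mul_continuous (integrable_const (1 : ℝ))
      (continuous_testFunction hα hlam0 x)
  have hind : Integrable ((Metric.ball x δ).indicator fun _ => 2 * (1 + α) * Real.log lam) μ :=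
    (integrable_const _).indicator Metric.isOpen_ball.measurableSet
  calc ∫ y, testFunction α lam x y ∂μ
      ≤ ∫ y, ((-((1 + α) * Real.log lam) + 2 * (1 + α) * |Real.log δ|) +
          (Metric.ball x δ).indicator (fun _ => 2 * (1 + α) * Real.log lam) y) ∂μ := by
        refine integral_mono hφ ((integrable_const _).add hind) fun y => ?_
        have hp : 0 ≤ 2 * (1 + α) * |Real.log δ| := by positivity
        by_cases hy : y ∈ Metric.ball x δ
        · simp only [indicator_of_mem hy]
          linarith [testFunction_le (α := α) (x := x) (y := y) hlam0]
        · simp only [indicator_of_notMem hy]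
          have := testFunction_le_of_le_dist hα hlam0 hδ (x := x) (y := y)
            (by simpa using hy)
          nlinarith [neg_abs_le (Real.log δ)]
    _ = (-((1 + α) * Real.log lam) + 2 * (1 + α) * |Real.log δ|) * area M +
        2 * (1 + α) * Real.log lam * μ.real (Metric.ball x δ) := by
        rw [integral_add (integrable_const _) hind, integral_const,
          integral_indicator_const _ Metric.isOpen_ball.measurableSet, smul_eq_mul, smul_eq_mul,
          area, mul_comm, mul_comm (μ.real (Metric.ball x δ))]
    _ ≤ _ := by
        have := mul_le_mul_of_nonneg_left hball
          (by positivity : 0 ≤ 2 * (1 + α) * Real.log lam)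
        linarith

/-- The mass `∫ h̃ e^{2φ}` stays away from zero: it is collected in a ball of radius `1 / λ` about
`x`, off the much smaller balls about the singular points. -/
theorem exists_le_integral_singularWeight {ρ θ α : ℝ} (hc : Continuous h) (h_pos : ∀ x, 0 < h x)
    (hp : Function.Injective p) (ha : ∀ j, 0 ≤ a j ∧ a j ≤ 1)
    (hG : ∀ j, IsGreenFunction (p j) (G j)) (hθ : 0 < θ) (hα : alphaTilde ρ a ≤ α) :
    ∃ c > 0, ∃ Λ : ℝ, ∀ lam, Λ ≤ lam → 0 < lam → ∀ x ∈ thetaSet ρ θ a p,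
      c ≤ ∫ y, singularWeight h a G y * Real.exp (2 * testFunction α lam x y)
        ∂(riemannianVolume M) := by
  obtain ⟨c, _, hc0, _, hb⟩ := exists_singularWeight_bounds (a := a) hc h_pos hG
  have hint := integrable_singularWeight hc h_pos ha hG
  obtain ⟨δ₁, hδ₁, hup⟩ := exists_measure_ball_le (M := M)
  obtain ⟨δ₂, hδ₂, hlow⟩ := exists_le_measure_ball (M := M)
  obtain ⟨r₀, hr₀, hsep⟩ := exists_le_dist_of_injective hp
  have hα0 : 0 ≤ alphaTilde ρ a := alphaTilde_nonneg fun j => (ha j).1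
  have hαp : 0 ≤ α := hα0.trans hα
  set b := alphaTilde ρ a
  set μ := riemannianVolume M
  set r := min 1 (min (r₀ / 2) (θ / 2))
  have hr : 0 < r := by positivity
  have hr1 : r ≤ 1 := min_le_left _ _
  have hr2 : r ≤ r₀ / 2 := (min_le_right _ _).trans (min_le_left _ _)
  have hr3 : r ≤ θ / 2 := (min_le_right _ _).trans (min_le_right _ _)
  -- With this `κ` the small balls together carry at most half of the area of the big one.
  set κ : ℝ := 1 / (16 * (m + 1)) with hκ
  have hκ0 : 0 < κ := by positivity
  have hκ1 : κ ≤ 1 := by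
    rw [hκ, div_le_one (by positivity)]
    have : (0 : ℝ) ≤ m := m.cast_nonneg
    linarith
  have hκm : m * (2 * Real.pi * κ ^ 2) ≤ 1 / 32 := by
    have hm : (0 : ℝ) ≤ m := m.cast_nonneg
    have hpi := Real.pi_lt_d2
    rw [hκ, div_pow, one_pow, mul_one_div, mul_div_assoc', div_le_div_iff₀ (by positivity)
      (by norm_num)]
    nlinarith [mul_nonneg hm hm, mul_le_mul_of_nonneg_left hpi.le hm]
  refine ⟨c * ((r ^ 2) ^ m * κ ^ (2 * b)) / 128, by positivity,
    max 1 (max (2 / θ) (max δ₁⁻¹ δ₂⁻¹)), fun lam hlam hlam0 x hx => ?_⟩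
  have hl1 : 1 ≤ lam := (le_max_left _ _).trans hlam
  have hl2 : 2 / θ ≤ lam := ((le_max_left _ _).trans (le_max_right _ _)).trans hlam
  have hl3 : δ₁⁻¹ ≤ lam :=
    (((le_max_left _ _).trans (le_max_right _ _)).trans (le_max_right _ _)).trans hlam
  have hl4 : δ₂⁻¹ ≤ lam :=
    (((le_max_right _ _).trans (le_max_right _ _)).trans (le_max_right _ _)).trans hlam
  have hs1 : lam⁻¹ ≤ 1 := inv_le_one_of_one_le₀ hl1
  have hs2 : lam⁻¹ ≤ θ / 2 := by
    rw [inv_le_comm₀ hlam0 (by positivity), inv_div]; exact hl2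
  have hs3 : lam⁻¹ ≤ δ₁ := by rwa [inv_le_comm₀ hlam0 hδ₁]
  have hs4 : lam⁻¹ ≤ δ₂ := by rwa [inv_le_comm₀ hlam0 hδ₂]
  have hs0 : 0 < lam⁻¹ := inv_pos.2 hlam0
  set s := lam⁻¹ with hs
  set A : Set M := Metric.ball x s \ ⋃ j, Metric.ball (p j) (κ * s)
  have hAm : MeasurableSet A := Metric.isOpen_ball.measurableSet.diff
    (MeasurableSet.iUnion fun j => Metric.isOpen_ball.measurableSet)
  have hA : s ^ 2 / 32 ≤ μ.real A := by
    have h1 : s ^ 2 / 16 ≤ μ.real (Metric.ball x s) :=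
      (ENNReal.ofReal_le_iff_le_toReal (measure_ne_top _ _)).1 (hlow x s hs0 hs4)
    have h2 : μ.real (⋃ j, Metric.ball (p j) (κ * s)) ≤ ∑ _j : Fin m, 2 * Real.pi * (κ * s) ^ 2 := by
      refine (measureReal_iUnion_fintype_le _).trans (Finset.sum_le_sum fun j _ => ?_)
      exact ENNReal.toReal_le_of_le_ofReal (by positivity) (hup (p j) (κ * s)
        ((mul_le_of_le_one_left hs0.le hκ1).trans hs3))
    have h3 := le_measureReal_sdiff (μ := μ) (s₁ := Metric.ball x s)
      (s₂ := ⋃ j, Metric.ball (p j) (κ * s))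
    rw [Finset.sum_const, Finset.card_univ, Fintype.card_fin, nsmul_eq_mul] at h2
    have h4 := mul_le_mul_of_nonneg_right hκm (sq_nonneg s)
    nlinarith
  have hnn : ∀ y, 0 ≤ singularWeight h a G y * Real.exp (2 * testFunction α lam x y) := fun y =>
    mul_nonneg (mul_nonneg (h_pos y).le (Real.exp_pos _).le) (Real.exp_pos _).le
  have hI : Integrable (fun y => singularWeight h a G y * Real.exp (2 * testFunction α lam x y)) μ :=
    integrable_mul_continuous hint
      (Real.continuous_exp.comp ((continuous_testFunction hαp hlam0 x).const_mul 2))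
  have hpt : ∀ᵐ y ∂(μ.restrict A), c * ((r ^ 2) ^ m * (κ * s) ^ (2 * b)) *
      (lam ^ (2 * (1 + α)) / 4) ≤
      singularWeight h a G y * Real.exp (2 * testFunction α lam x y) := by
    filter_upwards [ae_restrict_of_ae hb, ae_restrict_mem hAm] with y hy hyA
    have hyx : dist y x < s := hyA.1
    have hyp : ∀ j, κ * s ≤ dist y (p j) := fun j => by
      by_contra hlt
      exact hyA.2 (mem_iUnion.2 ⟨j, not_le.1 hlt⟩)
    have hprod := le_prod_rpow_dist (a := a) (p := p) (y := y) (r := r) (t := κ * s) (b := b) ha hr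
      hr1 (fun i j hij => by linarith [hsep i j hij]) (by positivity)
      (mul_le_one₀ hκ1 hs0.le hs1) hyp hα0 fun j hj => by
        refine le_alphaTilde fun hJ => ?_
        have hxj : θ ≤ dist x (p j) := by
          by_contra hlt
          exact hx.2 (mem_biUnion hJ (not_le.1 hlt))
        linarith [dist_triangle_left x (p j) y]
    have hexp := le_exp_testFunction (x := x) (y := y) hαp hlam0 hyx.le
    exact mul_le_mul ((mul_le_mul_of_nonneg_left hprod hc0.le).trans hy.1) hexp (by positivity)
      (mul_nonneg (h_pos y).le (Real.exp_pos _).le)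
  -- The powers of `λ` combine to `λ ^ (2 α - 2 b)`, where `b = α̃ ≤ α`.
  have hpow : 1 ≤ s ^ (2 * b) * lam ^ (2 * (1 + α)) * s ^ 2 := by
    rw [hs, Real.inv_rpow hlam0.le, ← Real.rpow_neg hlam0.le, inv_pow, ← Real.rpow_natCast lam 2,
      ← Real.rpow_neg hlam0.le, ← Real.rpow_add hlam0, ← Real.rpow_add hlam0]
    exact Real.one_le_rpow hl1 (by push_cast; linarith)
  have hκs : (κ * s) ^ (2 * b) = κ ^ (2 * b) * s ^ (2 * b) := Real.mul_rpow hκ0.le hs0.le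
  set w := c * ((r ^ 2) ^ m * (κ * s) ^ (2 * b)) * (lam ^ (2 * (1 + α)) / 4) with hw
  have hw0 : 0 ≤ w := by positivity
  calc c * ((r ^ 2) ^ m * κ ^ (2 * b)) / 128
      ≤ c * ((r ^ 2) ^ m * κ ^ (2 * b)) / 128 * (s ^ (2 * b) * lam ^ (2 * (1 + α)) * s ^ 2) :=
        le_mul_of_one_le_right (by positivity) hpow
    _ = s ^ 2 / 32 * w := by rw [hw, hκs]; ring
    _ ≤ μ.real A * w := mul_le_mul_of_nonneg_right hA hw0
    _ = ∫ _y in A, w ∂μ := by rw [setIntegral_const, smul_eq_mul]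
    _ ≤ ∫ y in A, singularWeight h a G y * Real.exp (2 * testFunction α lam x y) ∂μ :=
        setIntegral_mono_ae_restrict (integrableOn_const (measure_ne_top _ _)) hI.integrableOn hpt
    _ ≤ _ := setIntegral_le_integral hI (Eventually.of_forall hnn)

end Asymptotics

end SingularLiouville

/-! ### Conclusion -/

open SingularLiouville in
theorem lemmal {M : Type*} [MetricSpace M] [ChartedSpace Plane M]
    [IsManifold 𝓘(ℝ, Plane) ∞ M]
    [RiemannianBundle (fun x : M => TangentSpace 𝓘(ℝ, Plane) x)]
    [IsContMDiffRiemannianBundle 𝓘(ℝ, Plane) ∞ Plane (fun x : M => TangentSpace 𝓘(ℝ, Plane) x)]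
    [IsRiemannianManifold 𝓘(ℝ, Plane) M]
    [CompactSpace M] [ConnectedSpace M] [MeasurableSpace M] [BorelSpace M]
    (h : M → ℝ) (h_smooth : ContMDiff 𝓘(ℝ, Plane) 𝓘(ℝ, ℝ) ∞ h) (h_pos : ∀ x, 0 < h x)
    (m : ℕ) (p : Fin m → M) (p_inj : Function.Injective p)
    (a : Fin m → ℝ) (ha : ∀ j, a j ∈ Set.Ioc (0 : ℝ) 1)
    (G : Fin m → M → ℝ) (hG : ∀ j, IsGreenFunction (p j) (G j))
    (ρ : ℝ) (hρ : ρ ∈ Set.Ioo (4 * Real.pi) (8 * Real.pi))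
    (hρ_ne : ∀ j, ρ ≠ 4 * Real.pi * (1 + a j))
    (θ : ℝ) (hθ : 0 < θ)
    (α : ℝ) (hα : α ∈ Set.Ioo (alphaTilde ρ a) (ρ / (4 * Real.pi) - 1)) :
    (∀ lam : ℝ, 0 < lam → ∀ x : M,
      MemH1 (testFunction α lam x) ∧
      Integrable (fun y => singularWeight h a G y * Real.exp (2 * testFunction α lam x y))
        (riemannianVolume M)) ∧
    ∀ K : ℝ, ∃ Λ : ℝ, 0 < Λ ∧ ∀ lam : ℝ, Λ ≤ lam → ∀ x ∈ thetaSet ρ θ a p,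
      energyFunctional ρ (singularWeight h a G) (testFunction α lam x) ≤ K := by
  have ha' : ∀ j, 0 ≤ a j ∧ a j ≤ 1 := fun j => ⟨(ha j).1.le, (ha j).2⟩
  have hα0 : 0 ≤ α := (alphaTilde_nonneg fun j => (ha' j).1).trans hα.1.le
  have hc := h_smooth.continuous
  refine ⟨fun lam hlam x => ⟨memH1_testFunction hα0 hlam x, ?_⟩, fun K => ?_⟩
  · exact integrable_mul_continuous (integrable_singularWeight hc h_pos ha' hG)
      (Real.continuous_exp.comp ((continuous_testFunction hα0 hlam x).const_mul 2))
  have hpi := Real.pi_pos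
  have hρ0 : 0 < ρ := lt_trans (by positivity) hρ.1
  have hS := area_pos (M := M)
  -- `γ` is the gap that makes the coefficient of `log λ` negative.
  set γ := ρ - 4 * Real.pi * (1 + α) with hγ
  have hγ0 : 0 < γ := by
    have := hα.2
    rw [lt_sub_iff_add_lt, lt_div_iff₀ (by positivity)] at this
    linarith
  obtain ⟨δ₁, hδ₁, hup⟩ := exists_measure_ball_le (M := M)
  obtain ⟨δ, hδ, hδ1, hδγ⟩ : ∃ δ > 0, δ ≤ δ₁ ∧ δ ^ 2 ≤ γ * area M / (16 * Real.pi * ρ) := by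
    set t := γ * area M / (16 * Real.pi * ρ)
    have ht : 0 < t := by positivity
    refine ⟨min δ₁ (Real.sqrt t), lt_min hδ₁ (Real.sqrt_pos.2 ht), min_le_left _ _, ?_⟩
    calc _ ≤ Real.sqrt t ^ 2 := pow_le_pow_left₀ (by positivity) (min_le_right _ _) 2
      _ = t := Real.sq_sqrt ht.le
  obtain ⟨C₁, Λ₁, hΛ₁, hE⟩ := exists_lintegral_truncated_inv_sq_le (M := M)
    (γ / (16 * Real.pi * (1 + α))) (by positivity)
  obtain ⟨C₂, hI⟩ := exists_integral_testFunction_le (M := M) hα0 hδ fun x => hup x δ hδ1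
  obtain ⟨c, hc0, Λ₂, hW⟩ := exists_le_integral_singularWeight (ρ := ρ) (θ := θ) hc h_pos p_inj ha'
    hG hθ hα.1.le
  set B := 4 * (1 + α) ^ 2 * |C₁| + 2 * (ρ / area M) * C₂ - ρ * Real.log c with hB
  have hlim : Tendsto (fun lam : ℝ => -((1 + α) * γ) * Real.log lam + B) atTop atBot :=
    tendsto_atBot_add_const_right _ _
      (Real.tendsto_log_atTop.const_mul_atTop_of_neg (by nlinarith))
  obtain ⟨Λ₃, hΛ₃⟩ := eventually_atTop.1 (hlim.eventually_le_atBot K)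
  refine ⟨max Λ₁ (max Λ₂ Λ₃), lt_of_lt_of_le (by linarith) (le_max_left _ _), fun lam hlam x hx => ?_⟩
  have hl1 : Λ₁ ≤ lam := (le_max_left _ _).trans hlam
  have hl2 : Λ₂ ≤ lam := ((le_max_left _ _).trans (le_max_right _ _)).trans hlam
  have hl3 : Λ₃ ≤ lam := ((le_max_right _ _).trans (le_max_right _ _)).trans hlam
  have hone : 1 ≤ lam := hΛ₁.trans hl1
  have hlam0 : 0 < lam := by linarith
  have hlog := Real.log_nonneg hone
  refine le_trans ?_ (hΛ₃ lam hl3)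
  set L := Real.log lam
  set ε := γ / (16 * Real.pi * (1 + α)) with hε
  have h1 : (dirichletEnergy (testFunction α lam x)).toReal ≤
      4 * (1 + α) ^ 2 * ((1 + ε) * (2 * Real.pi) * L + |C₁|) := by
    refine ENNReal.toReal_le_of_le_ofReal (by positivity) ?_
    refine (dirichletEnergy_testFunction_le hα0 hlam0 x).trans ?_
    rw [ENNReal.ofReal_mul (p := 4 * (1 + α) ^ 2) (by positivity)]
    refine mul_le_mul_right ((hE lam hl1 x).trans (ENNReal.ofReal_le_ofReal ?_)) _
    linarith [le_abs_self C₁]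
  have h2 := mul_le_mul_of_nonneg_left (hI lam hone x) (by positivity : 0 ≤ 2 * (ρ / area M))
  have h3 := mul_le_mul_of_nonneg_left (Real.log_le_log hc0 (hW lam hl2 hlam0 x hx)) hρ0.le
  have h4 : 4 * (1 + α) ^ 2 * ((1 + ε) * (2 * Real.pi) * L) =
      8 * Real.pi * (1 + α) ^ 2 * L + (1 + α) * γ / 2 * L := by
    rw [hε]
    field_simp
    ring
  have h5 : 2 * (ρ / area M) * (-((1 + α) * L * area M) + 2 * (1 + α) * L * (2 * Real.pi * δ ^ 2) +
      C₂) ≤ -(2 * ρ * (1 + α) * L) + (1 + α) * γ / 2 * L + 2 * (ρ / area M) * C₂ := by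
    have e1 : 2 * (ρ / area M) * (-((1 + α) * L * area M) +
        2 * (1 + α) * L * (2 * Real.pi * δ ^ 2) + C₂) =
        -(2 * ρ * (1 + α) * L) + (8 * Real.pi * ρ * (1 + α) * L / area M) * δ ^ 2 +
          2 * (ρ / area M) * C₂ := by
      field_simp
      ring
    have e2 : (8 * Real.pi * ρ * (1 + α) * L / area M) * δ ^ 2 ≤ (1 + α) * γ / 2 * L := by
      calc _ ≤ (8 * Real.pi * ρ * (1 + α) * L / area M) * (γ * area M / (16 * Real.pi * ρ)) :=
            mul_le_mul_of_nonneg_left hδγ (by positivity)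
        _ = _ := by field_simp; ring
    linarith
  rw [energyFunctional]
  have h6 : -((1 + α) * γ) * L = 8 * Real.pi * (1 + α) ^ 2 * L - 2 * ρ * (1 + α) * L +
      (1 + α) * γ * L := by rw [hγ]; ring
  rw [h6, hB]
  linarith
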